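/- For $N\ge 1$ let $W_N$ be a random real symmetric $N\times N$ matrix whose entries $(W_N)_{jk}$, $1\le j\le k\le N$, are independent, with $\mathbb E (W_N)_{jk}=0$ for all $j\le k$, $\mathbb V (W_N)_{jk}=\sigma^2$ for $j<k$, and $$m_4:=\sup_{j\ne k,\,N}\mathbb E (W_N)_{jk}^4<\infty ,\qquad \sigma_1^2:=\sup_{i,N}\mathbb E (W_N)_{ii}^2<\infty .$$ Let $m\ge 1$ be a fixed integer and suppose that, for every $1\le i\le m$ and every $\epsilon>0$, $$\frac1N\sum_{j:\,j\ne i}\mathbb E\left(|(W_N)_{ij}|^4\,\mathbf 1_{\{|(W_N)_{ij}|\ge \epsilon N^{1/4}\}}\right)\to 0\qquad (N\to\infty).$$ Then, after an extension of the probability space if necessary (with $W_N$ lifted to it), there are random real symmetric matrices $T_N$ of size $N\times N$ satisfying the assumptions made on $W_N$ in the first sentence (independence, centering, the same $\sigma^2$, and finite suprema of the fourth moments off the diagonal and of the second moments on it), and non-random $\epsilon_N>0$ with $\epsilon_N\to 0$, such that: 1. $(T_N)_{jk}=(W_N)_{jk}$ for $m+1\le j,k\le N$; 2. $\mathbb P\left((T_N)_{ik}=(W_N)_{ik}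 \text{ for all } 1\le i\le m,\ 1\le k\le N\right)\to 1$ as $N\to\infty$; 3. $\mathbb E (T_N)_{ik}=0$ for $1\le i\le m$, $1\le k\le N$; 4. $\mathbb V (T_N)_{ik}=\sigma^2$ for $1\le i\le m$, $1\le k\le N$, $i\ne k$, and $\sup_{1\le i\le m,\,N}\mathbb V (T_N)_{ii}<\infty$; 5. $\sup\{\mathbb E (T_N)_{ik}^4:\ N\ge 1,\ 1\le i\le m,\ 1\le k\le N,\ i\neq k\}<\infty$; 6. $\sup_{1\le i\le m,\,1\le k\le N}|(T_N)_{ik}|\le \epsilon_N N^{1/4}$. (If $N<m$, indices $i\le m$ are to be read as $i\le \min(m,N)$.) In addition, for every $s>3$ there is a constant $\mathrm{const}_s$, depending only on $s,\sigma,\sigma_1,m_4$, such that for every $f\in\mathcal H_s$ the random variables $f(T_N/\sqrt N)_{ij}$ have finite second moments and $$\mathbb V\left[f(T_N/\sqrt N)_{ij}\right]\le \mathrm{const}_s\,\frac{\|f\|_s^2}{N},\qquad N\ge 1,\ 1\le i\le \min(m,N),\ 1\le j\le N .$$ Here $f(A)$ is the functional calculus of a real symmetric matrix $A$, and $\mathcal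 H_s$ is the space of functions $f:\mathbb R\to\mathbb R$ in $L^2(\mathbb R)$ with $$\|f\|_s^2:=\int_{\mathbb R}(1+2|k|)^{2s}|\hat f(k)|^2\,dk<\infty,\qquad \hat f(k)=\frac1{\sqrt{2\pi}}\int_{\mathbb R}e^{-ikx}f(x)\,dx$$ (Plancherel transform), each $f$ being taken to be the continuous function in its class, which exists since $s>1/2$. The matrices $T_N$ and the numbers $\epsilon_N$ do not depend on $s$ or $f$. -/

import Mathlib

open MeasureTheory ProbabilityTheory Filter Topology FourierTransform

universe u

/-- A sequence of real symmetric Wigner matrices `W N` of size `N × N`, `N = 0, 1, 2, …`, on a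
probability space `(Ω, P)`: for each `N` the entries on and above the diagonal are independent; the
off-diagonal entries have mean `0`, variance `σ ^ 2` and fourth moments at most `m₄`; the diagonal
entries have mean `0` and second moments at most `σ₁ ^ 2`. -/
structure IsRealWigner {Ω : Type u} [MeasurableSpace Ω] (P : Measure Ω)
    (W : (N : ℕ) → Ω → Matrix (Fin N) (Fin N) ℝ) (σ σ₁ m₄ : ℝ) : Prop where
  measurable : ∀ (N : ℕ) (j k : Fin N), Measurable fun ω => W N ω j k
  symm : ∀ (N : ℕ) (ω : Ω), (W N ω).IsSymm
  indep : ∀ N : ℕ,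
    iIndepFun (fun (p : {p : Fin N × Fin N // p.1 ≤ p.2}) (ω : Ω) => W N ω p.1.1 p.1.2) P
  memLp_offDiag : ∀ (N : ℕ) (j k : Fin N), j ≠ k → MemLp (fun ω => W N ω j k) 4 P
  mean_offDiag : ∀ (N : ℕ) (j k : Fin N), j ≠ k → ∫ ω, W N ω j k ∂P = 0
  variance_offDiag : ∀ (N : ℕ) (j k : Fin N), j ≠ k →
    variance (fun ω => W N ω j k) P = σ ^ 2
  fourth_moment_le : ∀ (N : ℕ) (j k : Fin N), j ≠ k → ∫ ω, (W N ω j k) ^ 4 ∂P ≤ m₄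
  memLp_diag : ∀ (N : ℕ) (i : Fin N), MemLp (fun ω => W N ω i i) 2 P
  mean_diag : ∀ (N : ℕ) (i : Fin N), ∫ ω, W N ω i i ∂P = 0
  second_moment_le : ∀ (N : ℕ) (i : Fin N), ∫ ω, (W N ω i i) ^ 2 ∂P ≤ σ₁ ^ 2

/-- The truncated fourth moments of row `i` (rows are numbered from `0`),
`(1/N) ∑_{j ≠ i} 𝔼 (|W_{ij}|⁴ ; |W_{ij}| ≥ ε N^{1/4})`; the value is `0` for the finitely many `N`
for which there is no row `i`. -/
noncomputable def lindebergRow {Ω : Type u} [MeasurableSpace Ω] (P : Measure Ω)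
    (W : (N : ℕ) → Ω → Matrix (Fin N) (Fin N) ℝ) (i : ℕ) (ε : ℝ) (N : ℕ) : ℝ :=
  if h : i < N then
    (1 / (N : ℝ)) * ∑ j ∈ Finset.univ.erase (⟨i, h⟩ : Fin N),
      ∫ ω in {ω | ε * (N : ℝ) ^ (1 / 4 : ℝ) ≤ |W N ω ⟨i, h⟩ j|}, |W N ω ⟨i, h⟩ j| ^ 4 ∂P
  else 0

open Classical in
/-- The (Plancherel) Fourier transform `(2π)^{-1/2} ∫ exp (-i k x) f x dx` of a square integrable
function `f : ℝ → ℝ`, a function of `k` that is determined up to a null set. Mathlib's transform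
`𝓕` has the kernel `exp (-2 π i ξ x)`, whence the rescaling. -/
noncomputable def fourierHat (f : ℝ → ℝ) (k : ℝ) : ℂ :=
  if hf : MemLp (fun x => (f x : ℂ)) 2 (volume : Measure ℝ) then
    ((√(2 * Real.pi))⁻¹ : ℝ) * (𝓕 hf.toLp : Lp ℂ 2 (volume : Measure ℝ)) (k / (2 * Real.pi))
  else 0

/-- The integrand `(1 + 2|k|)^{2s} |f̂ k|²` of the squared Sobolev norm. -/
noncomputable def sobolevDensity (s : ℝ) (f : ℝ → ℝ) (k : ℝ) : ℝ :=
  (1 + 2 * |k|) ^ (2 * s) * ‖fourierHat f k‖ ^ 2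

/-- `f` belongs to `𝓗_s`: it is square integrable, with finite squared Sobolev norm. -/
def MemSobolevH (s : ℝ) (f : ℝ → ℝ) : Prop :=
  MemLp (fun x => (f x : ℂ)) 2 (volume : Measure ℝ) ∧ Integrable (sobolevDensity s f)

/-- `‖f‖_s² = ∫ (1 + 2|k|)^{2s} |f̂ k|² dk`. -/
noncomputable def sobolevNormSq (s : ℝ) (f : ℝ → ℝ) : ℝ :=
  ∫ k, sobolevDensity s f k

/-- The entry `(i, j)` of `f (A / √N)`, for a real symmetric `N × N` matrix `A`, where `f` acts by
the functional calculus (on the eigenvalues). -/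
noncomputable def matrixFunEntry (f : ℝ → ℝ) {N : ℕ} (A : Matrix (Fin N) (Fin N) ℝ)
    (i j : Fin N) : ℝ :=
  (cfc f ((√(N : ℝ))⁻¹ • A) : Matrix (Fin N) (Fin N) ℝ) i j

/-! The statement splits into a coupling and a variance bound, and the variance bound does not use
the coupling: it holds for every Wigner sequence with bounded off-diagonal fourth moments, hence for
`T`.

Variance bound. Put `X = T/√N`. Fourier inversion writes `f(X)` as the integral of `f̂(k) exp(ikX)`
over `k`, so it suffices that an entry of `exp(itX)` has variance at most a constant times
`(1+2|t|)^4/N`; Cauchy–Schwarz against the weight `(1+2|k|)^s` does the rest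
(`EntryLaws.variance_cfc_le`). The variance of a group entry is controlled by an Efron–Stein
inequality for blocks of independent coordinates (`efronStein_blocks`), in which `F` may be compared
with any function that ignores the block. For the block of row `a`, that function is the same entry
for the matrix with row and column `a` deleted. By Duhamel's formula the two differ by at most a
product of two time-integrated linear forms in column `a`, with coefficients that are independent of
this column and have square sum at most one (`norm_expI_sub_zeroRow_le`). Each form has fourth
moment of order `N⁻²`, so a row costs `N⁻²` and all rows together cost `1/N`. The rows of the entry
itself are treated apart: off the diagonal the entry is compared with zero, its second moment being
of order `1/N`; on the diagonal the entries of row `i` are deleted one at a time.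

Coupling. Each entry in the first `m` rows is set to zero where it exceeds a level `K_N`, and an
independent variable with values in `{-K_N, 0, K_N}` is added, whose first two moments restore mean
and variance exactly (`corrected_moments`). The second moment lost by truncation, divided by `K_N²`,
controls the probability that the entry changes; summed over a row, the off-diagonal contribution is
at most a constant times a truncated fourth moment of the Lindeberg condition. A diagonal argument
yields `e_N → 0` so slow that the condition persists with `e_N N^{1/4}` as level
(`IsRealWigner.exists_levels`). The entries of `T` are then bounded by `2 K_N`, which is of smaller
order than `N^{1/4}`. -/

/-! ### Fourier inversion on the Sobolev space -/

/-- Fourier inversion for a continuous square integrable function with integrable transform. -/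
theorem eq_fourierInv_of_integrable {f : ℝ → ℂ} (hc : Continuous f)
    (hf : MemLp f 2 (volume : Measure ℝ))
    (hg : Integrable (𝓕 hf.toLp : Lp ℂ 2 (volume : Measure ℝ))) (x : ℝ) :
    f x = 𝓕⁻ ((𝓕 hf.toLp : Lp ℂ 2 (volume : Measure ℝ)) : ℝ → ℂ) x := by
  set G : Lp ℂ 2 (volume : Measure ℝ) := 𝓕 hf.toLp with hG
  have hcont : Continuous (𝓕⁻ (G : ℝ → ℂ)) := by
    have h1 : Continuous (𝓕 (G : ℝ → ℂ)) :=
      VectorFourier.fourierIntegral_continuous Real.continuous_fourierChar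
        (by exact continuous_inner) hg
    have h2 : 𝓕⁻ (G : ℝ → ℂ) = fun x => 𝓕 (G : ℝ → ℂ) (-x) := by
      ext x; exact Real.fourierInv_eq_fourier_neg _ _
    rw [h2]; exact h1.comp continuous_neg
  -- Both sides are tested against smooth compactly supported functions. The inverse transform of
  -- `G` as a tempered distribution is `f`, and Fubini moves the transform from the test function
  -- back to the integrable `G`.
  have hae : f =ᵐ[volume] 𝓕⁻ (G : ℝ → ℂ) := by
    refine ae_eq_of_integral_contDiff_smul_eq hc.locallyIntegrable hcont.locallyIntegrable ?_
    intro φ hφ hφs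
    have hφ' : ContDiff ℝ (⊤ : ℕ∞) (fun x => (φ x : ℂ)) := Complex.ofRealCLM.contDiff.comp hφ
    have hφs' : HasCompactSupport (fun x => (φ x : ℂ)) := hφs.comp_left (g := fun r : ℝ => (r : ℂ))
      Complex.ofReal_zero
    let Φ : SchwartzMap ℝ ℂ := hφs'.toSchwartzMap hφ'
    have hΦ : ∀ x, Φ x = (φ x : ℂ) := fun x => rfl
    have key := congrArg (fun T => T Φ) (Lp.fourierInv_toTemperedDistribution_eq G)
    simp only [TemperedDistribution.fourierInv_apply] at key
    rw [Lp.toTemperedDistribution_apply, Lp.toTemperedDistribution_apply] at key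
    have hinv : 𝓕⁻ G = hf.toLp := by rw [hG, fourierInv_fourier_eq]
    rw [hinv] at key
    have e1 : ∫ x, φ x • f x = ∫ x, Φ x • (hf.toLp : Lp ℂ 2 (volume : Measure ℝ)) x := by
      refine integral_congr_ae ?_
      filter_upwards [hf.coeFn_toLp] with x hx
      rw [hx, hΦ]; simp
    have e2 : ∫ x, (𝓕⁻ Φ) x • G x = ∫ x, φ x • 𝓕⁻ (G : ℝ → ℂ) x := by
      have h3 := VectorFourier.integral_fourierIntegral_smul_eq_flip (L := -innerₗ ℝ)
        (μ := volume) (ν := volume) (f := (Φ : ℝ → ℂ)) (g := (G : ℝ → ℂ))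
        Real.continuous_fourierChar
        (by exact continuous_inner.neg) Φ.integrable hg
      have h4 : ∀ x, (𝓕⁻ Φ) x = VectorFourier.fourierIntegral Real.fourierChar volume
          (-innerₗ ℝ) (Φ : ℝ → ℂ) x := by
        intro x
        rw [SchwartzMap.fourierInv_coe]
        rfl
      have h5 : ∀ x, 𝓕⁻ (G : ℝ → ℂ) x = VectorFourier.fourierIntegral Real.fourierChar volume
          (-innerₗ ℝ).flip (G : ℝ → ℂ) x := by
        intro x
        have : (-innerₗ ℝ).flip = -innerₗ ℝ := by
          ext; simp
        rw [this]; rfl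
      simp_rw [h4, h3, h5, hΦ]
      simp
    rw [e1, ← key, e2]
  exact congrFun ((hc.ae_eq_iff_eq volume hcont).1 hae) x

theorem fourierHat_eq {f : ℝ → ℝ} (hf : MemLp (fun x => (f x : ℂ)) 2 (volume : Measure ℝ)) (k : ℝ) :
    fourierHat f k = ((√(2 * Real.pi))⁻¹ : ℝ) *
      (𝓕 hf.toLp : Lp ℂ 2 (volume : Measure ℝ)) (k / (2 * Real.pi)) := by
  rw [fourierHat, dif_pos hf]

theorem aestronglyMeasurable_fourierHat (f : ℝ → ℝ) :
    AEStronglyMeasurable (fourierHat f) (volume : Measure ℝ) := by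
  by_cases hf : MemLp (fun x => (f x : ℂ)) 2 (volume : Measure ℝ)
  · have h1 := (Lp.aestronglyMeasurable (𝓕 hf.toLp : Lp ℂ 2 (volume : Measure ℝ)))
    have h2 : Measure.QuasiMeasurePreserving (fun k : ℝ => k / (2 * Real.pi)) volume volume := by
      have hp : (2 * Real.pi)⁻¹ ≠ 0 := by positivity
      refine ⟨by fun_prop, ?_⟩
      have := Real.map_volume_mul_right hp
      simp only [div_eq_mul_inv]
      rw [this]
      exact Measure.smul_absolutelyContinuous
    have h3 := h1.comp_quasiMeasurePreserving h2
    refine (h3.const_mul (((√(2 * Real.pi))⁻¹ : ℝ) : ℂ)).congr (Eventually.of_forall fun k => ?_)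
    simp [fourierHat_eq hf]
  · refine (aestronglyMeasurable_const (b := (0 : ℂ))).congr (Eventually.of_forall fun k => ?_)
    rw [fourierHat, dif_neg hf]

theorem integrable_sobolev_weight {r : ℝ} (hr : 1 < r) :
    Integrable (fun k : ℝ => (1 + 2 * |k|) ^ (-r)) := by
  have h := integrable_one_add_norm (E := ℝ) (μ := volume) (r := r) (by simpa using hr)
  have h2 := h.comp_mul_left' (R := 2) (by norm_num)
  refine h2.congr (Eventually.of_forall fun k => ?_)
  simp

/-- With `w = (1+2|k|)^{2s}`, one has `2|f̂| ≤ w|f̂|² + w⁻¹`, and `w⁻¹` is integrable because `2s >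
1`. -/
theorem MemSobolevH.integrable_fourierHat {s : ℝ} (hs : 1 / 2 < s) {f : ℝ → ℝ}
    (hf : MemSobolevH s f) : Integrable (fourierHat f) := by
  have h1 := (hf.2.add (integrable_sobolev_weight (r := 2 * s) (by linarith)))
  refine h1.mono' (aestronglyMeasurable_fourierHat f) (Eventually.of_forall fun k => ?_)
  have hw : (0 : ℝ) < 1 + 2 * |k| := by positivity
  simp only [Pi.add_apply, sobolevDensity]
  rw [Real.rpow_neg hw.le]
  set w := (1 + 2 * |k|) ^ (2 * s)
  have hwp : 0 < w := Real.rpow_pos_of_pos hw _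
  set a := ‖fourierHat f k‖
  have ha : 0 ≤ a := norm_nonneg _
  have h3 : w * a ^ 2 + w⁻¹ - 2 * a = w⁻¹ * (w * a - 1) ^ 2 := by field_simp; ring
  have : 0 ≤ w⁻¹ * (w * a - 1) ^ 2 := by positivity
  linarith

/-- The inversion formula `f x = (2π)^{-1/2} ∫ f̂ k exp (i k x) dk` on `𝓗_s`, `s > 1/2`. -/
theorem MemSobolevH.eq_integral {s : ℝ} (hs : 1 / 2 < s) {f : ℝ → ℝ} (hc : Continuous f)
    (hf : MemSobolevH s f) (x : ℝ) :
    (f x : ℂ) = ((√(2 * Real.pi))⁻¹ : ℝ) *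
      ∫ k, fourierHat f k * Complex.exp (Complex.I * (k * x)) := by
  have hp : (0 : ℝ) < 2 * Real.pi := by positivity
  have hi := hf.integrable_fourierHat hs
  have hsq : (0 : ℝ) < √(2 * Real.pi) := by positivity
  have hG : Integrable (𝓕 hf.1.toLp : Lp ℂ 2 (volume : Measure ℝ)) := by
    have h1 := (hi.const_mul ((√(2 * Real.pi) : ℝ) : ℂ)).comp_mul_left' hp.ne'
    refine h1.congr (Eventually.of_forall fun k => ?_)
    simp only [fourierHat_eq hf.1]
    rw [← mul_assoc, ← Complex.ofReal_mul, mul_inv_cancel₀ hsq.ne', mul_div_cancel_left₀ _ hp.ne']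
    simp
  have hc' : Continuous fun x => (f x : ℂ) := Complex.continuous_ofReal.comp hc
  have h0 := eq_fourierInv_of_integrable hc' hf.1 hG x
  rw [h0]
  rw [Real.fourierInv_eq']
  set G : ℝ → ℂ := ((𝓕 hf.1.toLp : Lp ℂ 2 (volume : Measure ℝ)) : ℝ → ℂ) with hGdef
  have h6 := Measure.integral_comp_div
    (fun ξ : ℝ => Complex.exp (((2 * Real.pi * inner ℝ ξ x : ℝ) : ℂ) * Complex.I) • G ξ)
    (2 * Real.pi)
  have h7 : ∫ k, fourierHat f k * Complex.exp (Complex.I * (k * x)) =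
      ((√(2 * Real.pi))⁻¹ : ℝ) * ∫ k : ℝ, Complex.exp
        (((2 * Real.pi * inner ℝ (k / (2 * Real.pi)) x : ℝ) : ℂ) * Complex.I) •
          G (k / (2 * Real.pi)) := by
    rw [← integral_const_mul]
    refine integral_congr_ae (Eventually.of_forall fun k => ?_)
    simp only [fourierHat_eq hf.1, smul_eq_mul]
    rw [mul_assoc, mul_comm (G _)]
    congr 3
    have : 2 * Real.pi * inner ℝ (k / (2 * Real.pi)) x = k * x := by
      simp; field_simp
    rw [this]; push_cast; ring
  rw [h7, h6, abs_of_pos hp, ← mul_assoc, Complex.real_smul, ← mul_assoc, ← Complex.ofReal_mul,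
    ← Complex.ofReal_mul]
  have : (√(2 * Real.pi))⁻¹ * (√(2 * Real.pi))⁻¹ * (2 * Real.pi) = 1 := by
    rw [← mul_inv, Real.mul_self_sqrt hp.le, inv_mul_cancel₀ hp.ne']
  rw [this]; simp

/-! ### Integrating out coordinates and the Efron–Stein inequality -/

section ProductSpace

variable {ι : Type*} [DecidableEq ι]

theorem measurable_piecewise (S : Finset ι) :
    Measurable (fun z : (ι → ℝ) × (ι → ℝ) => S.piecewise z.2 z.1) := by
  refine measurable_pi_lambda _ fun i => ?_
  by_cases hi : i ∈ S <;> simp only [Finset.piecewise, hi, if_true, if_false] <;> fun_prop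

theorem measurable_piecewise_left (S : Finset ι) (x : ι → ℝ) :
    Measurable (fun y : ι → ℝ => S.piecewise y x) :=
  (measurable_piecewise S).comp (measurable_const.prodMk measurable_id)

variable [Fintype ι] (μ : ι → Measure ℝ) [∀ i, IsProbabilityMeasure (μ i)]

/-- Resampling some coordinates from an independent copy leaves a product law unchanged; this is the
source of all the conditional integrations below. -/
theorem measurePreserving_piecewise (S : Finset ι) :
    MeasurePreserving (fun z : (ι → ℝ) × (ι → ℝ) => S.piecewise z.2 z.1)
      ((Measure.pi μ).prod (Measure.pi μ)) (Measure.pi μ) := by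
  have h1 := (measurePreserving_arrowProdEquivProdArrow ℝ ℝ ι μ μ).symm
  have h2 := measurePreserving_pi (fun i => (μ i).prod (μ i)) μ
    (f := fun i z => if i ∈ S then z.2 else z.1) (fun i => by
      by_cases hi : i ∈ S
      · simpa [hi] using! measurePreserving_snd (μ := μ i) (ν := μ i)
      · simpa [hi] using! measurePreserving_fst (μ := μ i) (ν := μ i))
  exact h2.comp h1

/-- Bounded measurable real functions. -/
def BddMeas {α : Type*} [MeasurableSpace α] (F : α → ℝ) : Prop :=
  Measurable F ∧ ∃ C, ∀ x, |F x| ≤ C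

theorem BddMeas.integrable {α : Type*} [MeasurableSpace α] {F : α → ℝ} (hF : BddMeas F)
    (ν : Measure α) [IsFiniteMeasure ν] : Integrable F ν := by
  obtain ⟨hm, C, hC⟩ := hF
  exact Integrable.of_bound hm.aestronglyMeasurable C (Eventually.of_forall hC)

theorem BddMeas.comp {α γ : Type*} [MeasurableSpace α] [MeasurableSpace γ] {F : α → ℝ}
    (hF : BddMeas F) {g : γ → α} (hg : Measurable g) : BddMeas (fun x => F (g x)) :=
  ⟨hF.1.comp hg, hF.2.imp fun _ h _ => h _⟩

theorem BddMeas.mul {α : Type*} [MeasurableSpace α] {F G : α → ℝ} (hF : BddMeas F)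
    (hG : BddMeas G) : BddMeas (fun x => F x * G x) := by
  obtain ⟨hm, C, hC⟩ := hF
  obtain ⟨hm', C', hC'⟩ := hG
  refine ⟨hm.mul hm', C * C', fun x => ?_⟩
  rw [abs_mul]
  exact mul_le_mul (hC x) (hC' x) (abs_nonneg _) ((abs_nonneg _).trans (hC x))

theorem BddMeas.sub {α : Type*} [MeasurableSpace α] {F G : α → ℝ} (hF : BddMeas F)
    (hG : BddMeas G) : BddMeas (fun x => F x - G x) := by
  obtain ⟨hm, C, hC⟩ := hF
  obtain ⟨hm', C', hC'⟩ := hG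
  exact ⟨hm.sub hm', C + C', fun x => (abs_sub _ _).trans (add_le_add (hC x) (hC' x))⟩

theorem BddMeas.sq {α : Type*} [MeasurableSpace α] {F : α → ℝ} (hF : BddMeas F) :
    BddMeas (fun x => F x ^ 2) := by
  simpa [pow_two] using hF.mul hF

theorem BddMeas.integral_sub_const_sq {α : Type*} [MeasurableSpace α] {F : α → ℝ}
    (hF : BddMeas F) (ν : Measure α) [IsProbabilityMeasure ν] (k : ℝ) :
    ∫ x, (F x - k) ^ 2 ∂ν = ∫ x, F x ^ 2 ∂ν - 2 * k * ∫ x, F x ∂ν + k ^ 2 := by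
  have e : ∀ x, (F x - k) ^ 2 = (F x ^ 2 - 2 * k * F x) + k ^ 2 := fun x => by ring
  simp only [e]
  have h : Integrable (fun x => F x ^ 2 - 2 * k * F x) ν :=
    (hF.sq.integrable ν).sub ((hF.integrable ν).const_mul _)
  rw [integral_add h (integrable_const _), integral_sub (hF.sq.integrable ν) ((hF.integrable ν).const_mul _),
    integral_const_mul]
  simp

/-- Integrate out the coordinates in `S`. -/
noncomputable def margOn (S : Finset ι) (F : (ι → ℝ) → ℝ) (x : ι → ℝ) : ℝ :=
  ∫ y, F (S.piecewise y x) ∂(Measure.pi μ)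

variable {μ}

theorem BddMeas.margOn {F : (ι → ℝ) → ℝ} (hF : BddMeas F) (S : Finset ι) :
    BddMeas (margOn μ S F) := by
  refine ⟨?_, ?_⟩
  · have := (hF.comp (measurable_piecewise S)).1.stronglyMeasurable
    exact (this.integral_prod_right (ν := Measure.pi μ)).measurable
  · obtain ⟨C, hC⟩ := hF.2
    refine ⟨C, fun x => ?_⟩
    have := norm_integral_le_of_norm_le_const (μ := Measure.pi μ)
      (f := fun y => F (S.piecewise y x)) (C := C) (Eventually.of_forall fun y => hC _)
    simpa [_root_.margOn] using! this

theorem integral_margOn {F : (ι → ℝ) → ℝ} (hF : BddMeas F) (S : Finset ι) :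
    ∫ x, margOn μ S F x ∂(Measure.pi μ) = ∫ x, F x ∂(Measure.pi μ) := by
  have h := measurePreserving_piecewise μ S
  have h2 : ∫ z, F (S.piecewise z.2 z.1) ∂((Measure.pi μ).prod (Measure.pi μ)) =
      ∫ x, F x ∂(Measure.pi μ) := by
    conv_rhs => rw [← h.map_eq]
    exact (integral_map h.measurable.aemeasurable
      (hF.1.aestronglyMeasurable)).symm
  rw [← h2, integral_prod _ ((hF.comp (measurable_piecewise S)).integrable _)]
  rfl

/-- Inserting `y` on `S` into a point resampled by `z` on `T` is the same as inserting, on `S ∪ T`,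
the mixture of `y` and `z`; this mixture again has the product law. -/
theorem margOn_margOn {F : (ι → ℝ) → ℝ} (hF : BddMeas F) (S T : Finset ι) :
    margOn μ T (margOn μ S F) = margOn μ (S ∪ T) F := by
  ext x
  have h := measurePreserving_piecewise μ S
  let Φ : (ι → ℝ) → ℝ := fun w => F ((S ∪ T).piecewise w x)
  have hΦ : BddMeas Φ := hF.comp (measurable_piecewise_left _ x)
  have := integral_margOn hΦ S (μ := μ)
  rw [margOn, show margOn μ (S ∪ T) F x = ∫ w, Φ w ∂(Measure.pi μ) from rfl, ← this]
  refine integral_congr_ae (Eventually.of_forall fun z => ?_)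
  refine integral_congr_ae (Eventually.of_forall fun y => ?_)
  simp only [Φ]
  congr 1
  ext i
  by_cases hS : i ∈ S <;> by_cases hT : i ∈ T <;> simp [Finset.piecewise, hS, hT]

/-- On each fibre of the coordinates outside `S` the function `K` is constant, and the variance of
`H` there is at most its mean square distance to any constant. -/
theorem integral_sq_sub_margOn_le {H K : (ι → ℝ) → ℝ} (hH : BddMeas H) (hK : BddMeas K)
    (S : Finset ι) (hKS : ∀ x y, K (S.piecewise y x) = K x) :
    ∫ x, H x ^ 2 ∂(Measure.pi μ) - ∫ x, margOn μ S H x ^ 2 ∂(Measure.pi μ) ≤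
      ∫ x, (H x - K x) ^ 2 ∂(Measure.pi μ) := by
  rw [← integral_margOn hH.sq S, ← integral_margOn (hH.sub hK).sq S, ← integral_sub
    ((hH.sq.margOn S).integrable _) ((hH.margOn S).sq.integrable _)]
  refine integral_mono (((hH.sq.margOn S).sub (hH.margOn S).sq).integrable _)
    (((hH.sub hK).sq.margOn S).integrable _) fun x => ?_
  have hb : BddMeas (fun y => H (S.piecewise y x)) := hH.comp (measurable_piecewise_left _ x)
  have h2 : margOn μ S (fun x => (H x - K x) ^ 2) x =
      margOn μ S (fun x => H x ^ 2) x - 2 * K x * margOn μ S H x + K x ^ 2 := by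
    simp only [margOn, hKS]
    exact hb.integral_sub_const_sq _ _
  simp only
  rw [h2]
  nlinarith [sq_nonneg (margOn μ S H x - K x)]

/-- Jensen's inequality on each fibre: a conditional mean contracts the `L²` norm. -/
theorem integral_margOn_sq_le {F : (ι → ℝ) → ℝ} (hF : BddMeas F) (S : Finset ι) :
    ∫ x, margOn μ S F x ^ 2 ∂(Measure.pi μ) ≤ ∫ x, F x ^ 2 ∂(Measure.pi μ) := by
  rw [← integral_margOn hF.sq S]
  refine integral_mono ((hF.margOn S).sq.integrable _) ((hF.sq.margOn S).integrable _) fun x => ?_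
  have hb : BddMeas (fun y => F (S.piecewise y x)) := hF.comp (measurable_piecewise_left _ x)
  set m := margOn μ S F x with hm
  have h : 0 ≤ ∫ y, (F (S.piecewise y x) - m) ^ 2 ∂(Measure.pi μ) :=
    integral_nonneg fun y => sq_nonneg _
  have h2 : ∫ y, (F (S.piecewise y x) - m) ^ 2 ∂(Measure.pi μ) =
      margOn μ S (fun x => F x ^ 2) x - 2 * m * m + m ^ 2 := by
    exact hb.integral_sub_const_sq _ _
  simp only
  nlinarith

/-- The Efron–Stein inequality for blocks of coordinates: `G c` is a function that does not depend
on the coordinates in the block `β ⁻¹ c`. -/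
theorem efronStein_blocks {κ : Type*} [Fintype κ] [DecidableEq κ] (β : ι → κ)
    {F : (ι → ℝ) → ℝ} (hF : BddMeas F) {G : κ → (ι → ℝ) → ℝ} (hG : ∀ c, BddMeas (G c))
    (hGβ : ∀ c x y, (∀ i, β i ≠ c → x i = y i) → G c x = G c y) :
    ∫ x, F x ^ 2 ∂(Measure.pi μ) - (∫ x, F x ∂(Measure.pi μ)) ^ 2 ≤
      ∑ c, ∫ x, (F x - G c x) ^ 2 ∂(Measure.pi μ) := by
  let B : Finset κ → Finset ι := fun s => Finset.univ.filter fun i => β i ∈ s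
  -- The blocks are integrated out one after another. The loss of second moment telescopes, and once
  -- all blocks are gone only the squared mean is left.
  have key : ∀ s : Finset κ, ∫ x, F x ^ 2 ∂(Measure.pi μ) -
      ∫ x, margOn μ (B s) F x ^ 2 ∂(Measure.pi μ) ≤
      ∑ c ∈ s, ∫ x, (F x - G c x) ^ 2 ∂(Measure.pi μ) := by
    intro s
    induction s using Finset.induction_on with
    | empty =>
      have hB : B ∅ = ∅ := by simp [B]
      rw [hB]
      simp [margOn]
    | insert c s hc ih =>
      rw [Finset.sum_insert hc]
      have hu : B (insert c s) = B s ∪ B {c} := by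
        ext i; simp [B, or_comm]
      rw [hu, ← margOn_margOn hF]
      -- The comparison function for the new block is `G c` with the earlier blocks integrated out;
      -- it still ignores block `c`. The `L²` contraction then returns to `F - G c` itself.
      have h1 := integral_sq_sub_margOn_le (μ := μ) (hF.margOn (B s) (μ := μ))
        ((hG c).margOn (B s) (μ := μ)) (B {c}) (fun x y => by
          simp only [margOn]
          refine integral_congr_ae (Eventually.of_forall fun z => hGβ c _ _ fun i hi => ?_)
          simp [Finset.piecewise, B, hi])
      have h2 := integral_margOn_sq_le (μ := μ) (hF.sub (hG c)) (B s)
      have h3 : ∀ x, margOn μ (B s) (fun x => F x - G c x) x =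
          margOn μ (B s) F x - margOn μ (B s) (G c) x := fun x =>
        integral_sub ((hF.comp (measurable_piecewise_left _ x)).integrable _)
          (((hG c).comp (measurable_piecewise_left _ x)).integrable _)
      simp only [h3] at h2
      linarith
  have h := key Finset.univ
  have hB : B Finset.univ = Finset.univ := by simp [B]
  rw [hB] at h
  simpa [margOn] using h

/-- Integration of the coordinates in `S` first, for nonnegative functions. -/
theorem lintegral_eq_lintegral_piecewise {F : (ι → ℝ) → ENNReal} (hF : Measurable F)
    (S : Finset ι) :
    ∫⁻ x, F x ∂(Measure.pi μ) =
      ∫⁻ x, ∫⁻ y, F (S.piecewise y x) ∂(Measure.pi μ) ∂(Measure.pi μ) := by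
  have h := measurePreserving_piecewise μ S
  rw [← h.lintegral_comp hF, lintegral_prod]
  exact (hF.comp h.measurable).aemeasurable

end ProductSpace

/-! ### Moments of linear forms in independent variables -/

/-- Second and fourth moments of a linear form in independent centered variables. -/
theorem moments_linear_form {Ω ι : Type*} [MeasurableSpace Ω] {P : Measure Ω}
    [IsProbabilityMeasure P] {Y : ι → Ω → ℝ} (hY : ∀ i, Measurable (Y i)) (hind : iIndepFun Y P)
    (c : ι → ℝ) {s M : ℝ} (S : Finset ι)
    (h4 : ∀ i ∈ S, MemLp (Y i) 4 P) (h1 : ∀ i ∈ S, ∫ ω, Y i ω ∂P = 0)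
    (h2 : ∀ i ∈ S, ∫ ω, Y i ω ^ 2 ∂P ≤ s) (hM : ∀ i ∈ S, ∫ ω, Y i ω ^ 4 ∂P ≤ M)
    (hs : 0 ≤ s) (hM0 : 0 ≤ M) :
    MemLp (fun ω => ∑ i ∈ S, c i * Y i ω) 4 P ∧
      ∫ ω, ∑ i ∈ S, c i * Y i ω ∂P = 0 ∧
      ∫ ω, (∑ i ∈ S, c i * Y i ω) ^ 2 ∂P ≤ s * ∑ i ∈ S, c i ^ 2 ∧
      ∫ ω, (∑ i ∈ S, c i * Y i ω) ^ 4 ∂P ≤ (3 * s ^ 2 + M) * (∑ i ∈ S, c i ^ 2) ^ 2 := by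
  classical
  induction S using Finset.induction_on with
  | empty => simp
  | insert p S hp ih =>
    obtain ⟨iL, i1, i2, i4⟩ := ih (fun i hi => h4 i (Finset.mem_insert_of_mem hi))
      (fun i hi => h1 i (Finset.mem_insert_of_mem hi))
      (fun i hi => h2 i (Finset.mem_insert_of_mem hi))
      (fun i hi => hM i (Finset.mem_insert_of_mem hi))
    have pL := h4 p (Finset.mem_insert_self _ _)
    have p1 := h1 p (Finset.mem_insert_self _ _)
    have p2 := h2 p (Finset.mem_insert_self _ _)
    have p4 := hM p (Finset.mem_insert_self _ _)
    set A : Ω → ℝ := fun ω => ∑ i ∈ S, c i * Y i ω with hA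
    set a : ℝ := c p with ha
    set y : Ω → ℝ := Y p with hy
    -- The family is rescaled by `c i` except at `p`, where the factor is `1`, so that independence
    -- is obtained for `Y p` itself and not only for its multiple `c p * Y p`.
    have hAy : IndepFun A y P := by
      have h := iIndepFun.indepFun_finsetSum_of_notMem
        (f := fun i ω => (if i = p then 1 else c i) * Y i ω)
        (hind.comp (fun i r => (if i = p then 1 else c i) * r) (fun i => by fun_prop))
        (fun i => (hY i).const_mul _) hp
      have e1 : (∑ j ∈ S, fun ω => (if j = p then 1 else c j) * Y j ω) = A := by
        ext ω
        rw [Finset.sum_apply]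
        refine Finset.sum_congr rfl fun j hj => ?_
        rw [if_neg (fun h : j = p => hp (h ▸ hj))]
      rw [e1] at h
      simpa using h
    have hAm : Measurable A := by
      refine Finset.measurable_sum _ fun i _ => (hY i).const_mul _
    have hym : Measurable y := hY p
    have pw : ∀ {f : Ω → ℝ}, MemLp f 4 P → ∀ k : ℕ, k ≤ 4 → Integrable (fun ω => f ω ^ k) P := by
      intro f hf k hk
      have h := (hf.mono_exponent (p := (k : ENNReal)) (by exact_mod_cast hk)).integrable_norm_pow'
      refine (integrable_norm_iff ?_).1 (by simpa using h)
      exact hf.1.pow k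
    have mulpow : ∀ k l : ℕ, k ≤ 4 → l ≤ 4 →
        Integrable (fun ω => A ω ^ k * y ω ^ l) P ∧
        ∫ ω, A ω ^ k * y ω ^ l ∂P = (∫ ω, A ω ^ k ∂P) * ∫ ω, y ω ^ l ∂P := by
      intro k l hk hl
      have hi : IndepFun (fun ω => A ω ^ k) (fun ω => y ω ^ l) P :=
        hAy.comp (φ := fun r : ℝ => r ^ k) (ψ := fun r : ℝ => r ^ l) (by fun_prop) (by fun_prop)
      refine ⟨hi.integrable_mul (pw iL k hk) (pw pL l hl), ?_⟩
      exact hi.integral_fun_mul_eq_mul_integral (hAm.pow_const k).aestronglyMeasurable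
        (hym.pow_const l).aestronglyMeasurable
    simp only [Finset.sum_insert hp]
    have hL : MemLp (fun ω => a * y ω + A ω) 4 P := (pL.const_mul a).add iL
    set τ := ∑ i ∈ S, c i ^ 2 with hτ
    have hτ0 : 0 ≤ τ := Finset.sum_nonneg fun i _ => sq_nonneg _
    have m11 := mulpow 1 1 (by norm_num) (by norm_num)
    have m31 := mulpow 3 1 (by norm_num) (by norm_num)
    have m22 := mulpow 2 2 (by norm_num) (by norm_num)
    have m13 := mulpow 1 3 (by norm_num) (by norm_num)
    simp only [pow_one, i1, p1, mul_zero, zero_mul] at m11 m31 m13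
    have j1 := pL.integrable (by norm_num)
    have j2 := iL.integrable (by norm_num)
    refine ⟨hL, ?_, ?_, ?_⟩
    · rw [integral_add (j1.const_mul a) j2, integral_const_mul, p1, i1]; simp
    · change ∫ ω, (a * y ω + A ω) ^ 2 ∂P ≤ s * (a ^ 2 + τ)
      have e : ∀ ω, (a * y ω + A ω) ^ 2 = a ^ 2 * y ω ^ 2 + (2 * a) * (A ω * y ω) + A ω ^ 2 := by
        intro ω; ring
      simp only [e]
      rw [integral_add (((pw pL 2 (by norm_num)).const_mul _).fun_add (m11.1.const_mul _))
        (pw iL 2 (by norm_num)), integral_add ((pw pL 2 (by norm_num)).const_mul _)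
        (m11.1.const_mul _), integral_const_mul, integral_const_mul, m11.2]
      nlinarith [mul_le_mul_of_nonneg_left p2 (sq_nonneg a)]
    · change ∫ ω, (a * y ω + A ω) ^ 4 ∂P ≤ (3 * s ^ 2 + M) * (a ^ 2 + τ) ^ 2
      have e : ∀ ω, (a * y ω + A ω) ^ 4 = a ^ 4 * y ω ^ 4 + (4 * a ^ 3) * (A ω * y ω ^ 3) +
          (6 * a ^ 2) * (A ω ^ 2 * y ω ^ 2) + (4 * a) * (A ω ^ 3 * y ω) + A ω ^ 4 := by
        intro ω; ring
      simp only [e]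
      have k1 := (pw pL 4 (by norm_num)).const_mul (a ^ 4)
      have k2 := m13.1.const_mul (4 * a ^ 3)
      have k3 := m22.1.const_mul (6 * a ^ 2)
      have k4 := m31.1.const_mul (4 * a)
      have k5 := pw iL 4 (by norm_num)
      rw [integral_add (((k1.fun_add k2).fun_add k3).fun_add k4) k5, integral_add ((k1.fun_add k2).fun_add k3) k4,
        integral_add (k1.fun_add k2) k3, integral_add k1 k2, integral_const_mul, integral_const_mul,
        integral_const_mul, integral_const_mul, m13.2, m31.2, m22.2]
      -- The terms with an odd power of `y` have vanished. The mixed term is at most `6 a² s² τ`,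
      -- which is the cross term of `3 s² (a² + τ)²`; this fixes the factor `3`.
      have q2 : 0 ≤ ∫ ω, y ω ^ 2 ∂P := integral_nonneg fun ω => sq_nonneg _
      have b1 : a ^ 4 * ∫ ω, y ω ^ 4 ∂P ≤ a ^ 4 * M :=
        mul_le_mul_of_nonneg_left p4 (by positivity)
      have b2 : (∫ ω, A ω ^ 2 ∂P) * (∫ ω, y ω ^ 2 ∂P) ≤ (s * τ) * s :=
        mul_le_mul i2 p2 q2 (by positivity)
      have b3 : 6 * a ^ 2 * ((∫ ω, A ω ^ 2 ∂P) * (∫ ω, y ω ^ 2 ∂P)) ≤ 6 * a ^ 2 * ((s * τ) * s) :=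
        mul_le_mul_of_nonneg_left b2 (by positivity)
      have b4 : 0 ≤ s ^ 2 * a ^ 4 := by positivity
      have b5 : 0 ≤ M * (τ * a ^ 2) := by positivity
      nlinarith

/-! ### The unitary group of a symmetric matrix and Duhamel estimates -/

section MatrixGroup

variable {n : Type*} [DecidableEq n]

/-- The generator `i X` of the unitary group of a real symmetric matrix. -/
noncomputable def genI {n : Type*} (X : Matrix n n ℝ) : Matrix n n ℂ := Complex.I • X.map Complex.ofReal

/-- The matrix with row and column `a` replaced by zero. -/
def zeroRow (a : n) (X : Matrix n n ℝ) : Matrix n n ℝ :=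
  Matrix.of fun j k => if j = a ∨ k = a then 0 else X j k

theorem zeroRow_isSymm {X : Matrix n n ℝ} (hX : X.IsSymm) (a : n) : (zeroRow a X).IsSymm := by
  ext j k
  simp [zeroRow, or_comm, hX.apply j k]

/-- The matrix with the entries `(i, k)` and `(k, i)` replaced by zero. -/
def zeroEntry (i k : n) (X : Matrix n n ℝ) : Matrix n n ℝ :=
  Matrix.of fun a b => if (a = i ∧ b = k) ∨ (a = k ∧ b = i) then 0 else X a b

theorem zeroEntry_isSymm {X : Matrix n n ℝ} (hX : X.IsSymm) (i k : n) :
    (zeroEntry i k X).IsSymm := by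
  ext a b
  simp only [zeroEntry, Matrix.transpose_apply, Matrix.of_apply, hX.apply a b]
  congr 1
  rw [eq_iff_iff]; tauto

theorem zeroRow_zeroEntry (i k : n) (X : Matrix n n ℝ) :
    zeroRow i (zeroEntry i k X) = zeroRow i X := by
  ext a b
  simp only [zeroRow, zeroEntry, Matrix.of_apply]
  by_cases ha : a = i <;> by_cases hb : b = i <;> simp [ha, hb]

variable [Fintype n]

/-- The unitary group `exp (i t X)` of a real symmetric matrix. -/
noncomputable def expI (X : Matrix n n ℝ) (t : ℝ) : Matrix n n ℂ :=
  NormedSpace.exp (t • genI X)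

@[simp]
theorem genI_apply {n : Type*} (X : Matrix n n ℝ) (i j : n) : genI X i j = Complex.I * X i j := rfl

@[simp]
theorem expI_zero (X : Matrix n n ℝ) : expI X 0 = 1 := by
  simp [expI, NormedSpace.exp_zero]

open scoped Matrix.Norms.Operator in
theorem hasDerivAt_expI_apply (X : Matrix n n ℝ) (t : ℝ) (i j : n) :
    HasDerivAt (fun t => expI X t i j) ((genI X * expI X t) i j) t := by
  have h := hasDerivAt_exp_smul_const' (𝕂 := ℝ) (genI X) t
  have h2 := (hasDerivAt_pi.1 (hasDerivAt_pi.1 h i) j)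
  exact h2

open scoped Matrix.Norms.Operator in
theorem commute_genI_expI (X : Matrix n n ℝ) (t : ℝ) : genI X * expI X t = expI X t * genI X := by
  have h1 := hasDerivAt_exp_smul_const' (𝕂 := ℝ) (genI X) t
  have h2 := hasDerivAt_exp_smul_const (𝕂 := ℝ) (genI X) t
  exact h1.unique h2

theorem hasDerivAt_expI_apply' (X : Matrix n n ℝ) (t : ℝ) (i j : n) :
    HasDerivAt (fun t => expI X t i j) ((expI X t * genI X) i j) t := by
  rw [← commute_genI_expI]; exact hasDerivAt_expI_apply X t i j

open scoped Matrix.Norms.Operator in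
theorem continuous_expI : Continuous fun z : Matrix n n ℝ × ℝ => expI z.1 z.2 := by
  have h : Continuous (NormedSpace.exp : Matrix n n ℂ → Matrix n n ℂ) :=
    NormedSpace.exp_continuous
  refine h.comp ?_
  refine continuous_pi fun i => continuous_pi fun j => ?_
  simp only [Matrix.smul_apply, genI_apply]
  fun_prop

theorem expI_transpose {X : Matrix n n ℝ} (hX : X.IsSymm) (t : ℝ) :
    (expI X t).transpose = expI X t := by
  rw [expI, ← Matrix.exp_transpose]
  congr 1
  ext i j
  simp [genI_apply, hX.apply i j]

theorem expI_symm {X : Matrix n n ℝ} (hX : X.IsSymm) (t : ℝ) (i j : n) :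
    expI X t i j = expI X t j i := by
  conv_lhs => rw [← expI_transpose hX]
  rfl

theorem expI_conjTranspose {X : Matrix n n ℝ} (hX : X.IsSymm) (t : ℝ) :
    (expI X t).conjTranspose = expI X (-t) := by
  rw [expI, ← Matrix.exp_conjTranspose, expI]
  congr 1
  ext i j
  simp [genI_apply, Matrix.conjTranspose_apply, hX.apply i j]

theorem expI_mul_neg (X : Matrix n n ℝ) (t : ℝ) : expI X t * expI X (-t) = 1 := by
  rw [expI, expI, ← Matrix.exp_add_of_commute]
  · simp [NormedSpace.exp_zero]
  · exact ((Commute.refl _).smul_left t).smul_right (-t)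

theorem expI_mul_conjTranspose {X : Matrix n n ℝ} (hX : X.IsSymm) (t : ℝ) :
    expI X t * (expI X t).conjTranspose = 1 := by
  rw [expI_conjTranspose hX, expI_mul_neg]

theorem sum_norm_sq_expI {X : Matrix n n ℝ} (hX : X.IsSymm) (t : ℝ) (i : n) :
    ∑ k, ‖expI X t i k‖ ^ 2 = 1 := by
  have h := congrFun (congrFun (expI_mul_conjTranspose hX t) i) i
  rw [Matrix.mul_apply] at h
  simp only [Matrix.conjTranspose_apply, Matrix.one_apply_eq, Complex.star_def,
    Complex.mul_conj] at h
  have h2 : ((∑ k, ‖expI X t i k‖ ^ 2 : ℝ) : ℂ) = 1 := by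
    rw [← h]; push_cast
    refine Finset.sum_congr rfl fun k _ => ?_
    rw [Complex.normSq_eq_norm_sq]; push_cast; rfl
  exact_mod_cast h2

theorem norm_expI_le_one {X : Matrix n n ℝ} (hX : X.IsSymm) (t : ℝ) (i j : n) :
    ‖expI X t i j‖ ≤ 1 := by
  have h := sum_norm_sq_expI hX t i
  have h2 := Finset.single_le_sum (f := fun k => ‖expI X t i k‖ ^ 2)
    (fun k _ => by positivity) (Finset.mem_univ j)
  simp only [h] at h2
  nlinarith [norm_nonneg (expI X t i j)]

theorem norm_expI_neg {X : Matrix n n ℝ} (hX : X.IsSymm) (t : ℝ) (i j : n) :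
    expI X (-t) i j = star (expI X t i j) := by
  rw [← expI_conjTranspose hX, Matrix.conjTranspose_apply, expI_symm hX]

theorem continuous_expI_apply (X : Matrix n n ℝ) (i j : n) :
    Continuous fun t => expI X t i j :=
  continuous_iff_continuousAt.2 fun t => (hasDerivAt_expI_apply X t i j).continuousAt

theorem continuous_expI_apply_comp {α : Type*} [TopologicalSpace α] {X : α → Matrix n n ℝ}
    {t : α → ℝ} (hX : Continuous X) (ht : Continuous t) (i j : n) :
    Continuous fun a => expI (X a) (t a) i j :=
  (continuous_expI.comp (hX.prodMk ht)).matrix_elem i j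

/-- A Duhamel bound for the entries of the difference of two unitary groups. -/
theorem norm_expI_sub_expI_le {X Y : Matrix n n ℝ} {t : ℝ} (ht : 0 ≤ t) (i j : n) {g : ℝ → ℝ}
    (hg : Continuous g)
    (hb : ∀ u ∈ Set.Icc 0 t, ‖(expI Y (t - u) * (X - Y).map Complex.ofReal * expI X u) i j‖ ≤ g u) :
    ‖expI X t i j - expI Y t i j‖ ≤ ∫ u in (0 : ℝ)..t, g u := by
  -- The product `exp(i(t-u)Y) exp(iuX)` interpolates between the two groups as `u` runs from `0` to
  -- `t`; its derivative contains only `X - Y`, between the two factors.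
  have hd : ∀ u, HasDerivAt (fun u => (expI Y (t - u) * expI X u) i j)
      (Complex.I * (expI Y (t - u) * (X - Y).map Complex.ofReal * expI X u) i j) u := by
    intro u
    have h1 : ∀ k, HasDerivAt (fun u => expI Y (t - u) i k * expI X u k j)
        (-(expI Y (t - u) * genI Y) i k * expI X u k j +
          expI Y (t - u) i k * (genI X * expI X u) k j) u := by
      intro k
      refine HasDerivAt.mul ?_ (hasDerivAt_expI_apply X u k j)
      have h2 := (hasDerivAt_expI_apply' Y (t - u) i k).comp_const_sub t u
      exact h2
    have h3 := HasDerivAt.fun_sum (u := Finset.univ) fun k _ => h1 k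
    have e1 : (fun u => (expI Y (t - u) * expI X u) i j) =
        fun u => ∑ k, expI Y (t - u) i k * expI X u k j := by
      ext u; rw [Matrix.mul_apply]
    rw [e1]
    refine h3.congr_deriv (Eq.symm ?_)
    have e2 : Complex.I • (expI Y (t - u) * (X - Y).map Complex.ofReal * expI X u) =
        -(expI Y (t - u) * genI Y) * expI X u + expI Y (t - u) * (genI X * expI X u) := by
      have e3 : Complex.I • (X - Y).map Complex.ofReal = genI X - genI Y := by
        ext a b; simp [genI_apply, mul_sub]
      have e4 : Complex.I • (expI Y (t - u) * (X - Y).map Complex.ofReal * expI X u) =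
          expI Y (t - u) * (Complex.I • (X - Y).map Complex.ofReal) * expI X u := by
        rw [Matrix.mul_smul, Matrix.smul_mul]
      rw [e4, e3]
      noncomm_ring
    have e5 := congrFun (congrFun e2 i) j
    rw [Matrix.smul_apply, smul_eq_mul] at e5
    rw [e5, Matrix.add_apply, Matrix.mul_apply, Matrix.mul_apply (M := expI Y (t - u)),
      ← Finset.sum_add_distrib]
    rfl
  have hcont : Continuous fun u =>
      Complex.I * (expI Y (t - u) * (X - Y).map Complex.ofReal * expI X u) i j := by
    refine continuous_const.mul ?_
    simp only [Matrix.mul_apply]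
    refine continuous_finsetSum _ fun k _ => Continuous.mul
      (continuous_finsetSum _ fun l _ => Continuous.mul ?_ continuous_const)
      (continuous_expI_apply X k j)
    exact (continuous_expI_apply Y i l).comp (by fun_prop)
  have hint_eq := intervalIntegral.integral_eq_sub_of_hasDerivAt (fun u _ => hd u)
    (hcont.intervalIntegrable 0 t)
  simp only [sub_self, expI_zero, one_mul, sub_zero, mul_one] at hint_eq
  rw [← hint_eq]
  refine intervalIntegral.norm_integral_le_of_norm_le ht ?_ (hg.intervalIntegrable 0 t)
  refine Eventually.of_forall fun u hu => ?_
  rw [norm_mul, Complex.norm_I, one_mul]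
  exact hb u ⟨hu.1.le, hu.2⟩

/-- Row `a` of the generator vanishes, so row `a` of the group does not move in time: index `a` is
decoupled. -/
theorem expI_zeroRow_row (X : Matrix n n ℝ) (a : n) (t : ℝ) (j : n) :
    expI (zeroRow a X) t a j = if a = j then 1 else 0 := by
  have hd : ∀ t, HasDerivAt (fun t => expI (zeroRow a X) t a j) 0 t := by
    intro t
    convert hasDerivAt_expI_apply (zeroRow a X) t a j using 1
    rw [Matrix.mul_apply]
    simp [zeroRow]
  have h : expI (zeroRow a X) t a j = expI (zeroRow a X) 0 a j :=
    is_const_of_deriv_eq_zero (fun t => (hd t).differentiableAt) (fun t => (hd t).deriv) t 0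
  rw [h, expI_zero, Matrix.one_apply]

theorem expI_zeroRow_col {X : Matrix n n ℝ} (hX : X.IsSymm) (a : n) (t : ℝ) (j : n) :
    expI (zeroRow a X) t j a = if a = j then 1 else 0 := by
  rw [expI_symm (zeroRow_isSymm hX a), expI_zeroRow_row]

/-- The linear form in the entries of column `a`, with coefficients from the unitary group of
the matrix without row and column `a`. -/
noncomputable def rowForm (a : n) (X : Matrix n n ℝ) (i : n) (v : ℝ) : ℂ :=
  ∑ k, expI (zeroRow a X) v i k * X k a

theorem continuous_rowForm (a : n) (X : Matrix n n ℝ) (i : n) : Continuous (rowForm a X i) :=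
  continuous_finsetSum _ fun k _ => (continuous_expI_apply _ i k).mul continuous_const

/-- The perturbation lives in row and column `a`. Since the decoupled group has no entry from `i` to
`a`, only the column part survives, and the Duhamel integrand factors into a linear form in column
`a` and one entry of the full group. -/
theorem expI_zeroRow_mul_sub {X : Matrix n n ℝ} (hX : X.IsSymm) {a i : n} (hi : i ≠ a) (j : n)
    (w u : ℝ) :
    (expI (zeroRow a X) w * (X - zeroRow a X).map Complex.ofReal * expI X u) i j =
      rowForm a X i w * expI X u a j := by
  rw [Matrix.mul_apply, Finset.sum_eq_single a]
  · congr 1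
    rw [Matrix.mul_apply, rowForm]
    refine Finset.sum_congr rfl fun k _ => ?_
    simp [zeroRow]
  · intro l _ hl
    rw [Matrix.mul_apply, Finset.sum_eq_single a]
    · rw [expI_zeroRow_col hX, if_neg hi.symm]; simp
    · intro k _ hk
      simp [zeroRow, hk, hl]
    · simp
  · simp

/-- The decoupled group has entry zero at `(i, a)`, so the entry of the full group is the Duhamel
integral alone, where the remaining group entry has modulus at most one. -/
theorem norm_expI_apply_le {X : Matrix n n ℝ} (hX : X.IsSymm) {a i : n} (hi : i ≠ a) {t : ℝ}
    (ht : 0 ≤ t) : ‖expI X t i a‖ ≤ ∫ v in (0 : ℝ)..t, ‖rowForm a X i v‖ := by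
  have h := norm_expI_sub_expI_le (X := X) (Y := zeroRow a X) ht i a
    (g := fun u => ‖rowForm a X i (t - u)‖)
    ((continuous_rowForm a X i).norm.comp (by fun_prop)) (fun u _ => by
      rw [expI_zeroRow_mul_sub hX hi, norm_mul]
      exact mul_le_of_le_one_right (norm_nonneg _) (norm_expI_le_one hX u a a))
  rw [expI_zeroRow_col hX, if_neg hi.symm, sub_zero] at h
  rw [intervalIntegral.integral_comp_sub_left (fun v => ‖rowForm a X i v‖)] at h
  simpa using h

theorem integral_rowForm_mono (a : n) (X : Matrix n n ℝ) (i : n) {u t : ℝ} (hu : 0 ≤ u)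
    (hut : u ≤ t) :
    ∫ v in (0 : ℝ)..u, ‖rowForm a X i v‖ ≤ ∫ v in (0 : ℝ)..t, ‖rowForm a X i v‖ :=
  intervalIntegral.integral_mono_interval le_rfl hu hut
    (Eventually.of_forall fun _ => norm_nonneg _)
    ((continuous_rowForm a X i).norm.intervalIntegrable _ _)

/-- The group entry left in the Duhamel integrand is again off-diagonal, hence bounded by a second
linear form. That the bound is quadratic is what makes the effect of deleting one row of order `1/N`
instead of `N^{-1/2}`. -/
theorem norm_expI_sub_zeroRow_le {X : Matrix n n ℝ} (hX : X.IsSymm) {a i j : n} (hi : i ≠ a)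
    (hj : j ≠ a) {t : ℝ} (ht : 0 ≤ t) :
    ‖expI X t i j - expI (zeroRow a X) t i j‖ ≤
      (∫ v in (0 : ℝ)..t, ‖rowForm a X i v‖) * ∫ v in (0 : ℝ)..t, ‖rowForm a X j v‖ := by
  have h := norm_expI_sub_expI_le (X := X) (Y := zeroRow a X) ht i j
    (g := fun u => ‖rowForm a X i (t - u)‖ * ∫ v in (0 : ℝ)..t, ‖rowForm a X j v‖)
    (((continuous_rowForm a X i).norm.comp (by fun_prop)).mul continuous_const) (fun u hu => by
      rw [expI_zeroRow_mul_sub hX hi, norm_mul]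
      refine mul_le_mul_of_nonneg_left ?_ (norm_nonneg _)
      rw [expI_symm hX]
      exact (norm_expI_apply_le hX hj hu.1).trans (integral_rowForm_mono a X j hu.1 hu.2))
  rw [intervalIntegral.integral_mul_const,
    intervalIntegral.integral_comp_sub_left (fun v => ‖rowForm a X i v‖)] at h
  simpa using h

theorem norm_expI_sub_zeroEntry_diag_le {X : Matrix n n ℝ} (hX : X.IsSymm) (i : n) {t : ℝ}
    (ht : 0 ≤ t) : ‖expI X t i i - expI (zeroEntry i i X) t i i‖ ≤ t * |X i i| := by
  have h := norm_expI_sub_expI_le (X := X) (Y := zeroEntry i i X) ht i i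
    (g := fun _ => |X i i|) continuous_const (fun u _ => by
      have e : (expI (zeroEntry i i X) (t - u) * (X - zeroEntry i i X).map Complex.ofReal *
          expI X u) i i = expI (zeroEntry i i X) (t - u) i i * X i i * expI X u i i := by
        rw [Matrix.mul_apply, Finset.sum_eq_single i]
        · rw [Matrix.mul_apply, Finset.sum_eq_single i]
          · simp [zeroEntry]
          · intro k _ hk; simp [zeroEntry, hk]
          · simp
        · intro l _ hl
          rw [Matrix.mul_apply, Finset.sum_eq_zero, zero_mul]
          intro k _; simp [zeroEntry, hl]
        · simp
      rw [e, norm_mul, norm_mul, Complex.norm_real, Real.norm_eq_abs]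
      have h1 := norm_expI_le_one (zeroEntry_isSymm hX i i) (t - u) i i
      have h2 := norm_expI_le_one hX u i i
      calc _ ≤ 1 * |X i i| * 1 := by gcongr
        _ = _ := by ring)
  simpa using h

/-- Deleting the pair `(i,k)`, `(k,i)` leaves two Duhamel terms, each with the factor `X k i` and an
off-diagonal group entry between `k` and `i`. That entry is bounded by a linear form, so the effect
is again quadratic in the entries. -/
theorem norm_expI_sub_zeroEntry_le {X : Matrix n n ℝ} (hX : X.IsSymm) {i k : n} (hk : k ≠ i)
    {t : ℝ} (ht : 0 ≤ t) :
    ‖expI X t i i - expI (zeroEntry i k X) t i i‖ ≤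
      t * (|X k i| * ((∫ v in (0 : ℝ)..t, ‖rowForm i (zeroEntry i k X) k v‖) +
        ∫ v in (0 : ℝ)..t, ‖rowForm i X k v‖)) := by
  set Y := zeroEntry i k X with hY
  have hYs : Y.IsSymm := zeroEntry_isSymm hX i k
  have h := norm_expI_sub_expI_le (X := X) (Y := Y) ht i i
    (g := fun _ => |X k i| * ((∫ v in (0 : ℝ)..t, ‖rowForm i Y k v‖) +
        ∫ v in (0 : ℝ)..t, ‖rowForm i X k v‖)) continuous_const (fun u hu => by
      have e : (expI Y (t - u) * (X - Y).map Complex.ofReal * expI X u) i i =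
          X k i * (expI Y (t - u) k i * expI X u i i + expI Y (t - u) i i * expI X u k i) := by
        have e0 : ∀ l, (expI Y (t - u) * (X - Y).map Complex.ofReal) i l =
            if l = i then expI Y (t - u) i k * X k i else
              if l = k then expI Y (t - u) i i * X k i else 0 := by
          intro l
          rw [Matrix.mul_apply]
          by_cases hl : l = i
          · rw [if_pos hl, Finset.sum_eq_single k]
            · simp [hY, zeroEntry, hl]
            · intro b _ hb; simp [hY, zeroEntry, hl, hb, hk.symm]
            · simp
          · rw [if_neg hl]
            by_cases hlk : l = k
            · rw [if_pos hlk, Finset.sum_eq_single i]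
              · simp [hY, zeroEntry, hlk, hX.apply i k]
              · intro b _ hb; simp [hY, zeroEntry, hlk, hb, hk]
              · simp
            · rw [if_neg hlk]
              refine Finset.sum_eq_zero fun b _ => ?_
              simp [hY, zeroEntry, hl, hlk]
        rw [Matrix.mul_apply]
        simp only [e0]
        rw [← Finset.sum_erase_add _ _ (Finset.mem_univ i), if_pos rfl,
          Finset.sum_eq_single k]
        · rw [if_neg hk, if_pos rfl, expI_symm hYs (t - u) i k]; ring
        · intro b hb hbk
          rw [if_neg (Finset.ne_of_mem_erase hb), if_neg hbk, zero_mul]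
        · intro hn; simp [hk] at hn
      rw [e, norm_mul, Complex.norm_real, Real.norm_eq_abs]
      refine mul_le_mul_of_nonneg_left ?_ (abs_nonneg _)
      refine (norm_add_le _ _).trans (add_le_add ?_ ?_)
      · rw [norm_mul]
        refine (mul_le_of_le_one_right (norm_nonneg _) (norm_expI_le_one hX u i i)).trans ?_
        refine (norm_expI_apply_le hYs hk (by linarith [hu.2])).trans ?_
        exact integral_rowForm_mono _ _ _ (by linarith [hu.2]) (by linarith [hu.1])
      · rw [norm_mul]
        refine (mul_le_of_le_one_left (norm_nonneg _)
          (norm_expI_le_one hYs (t - u) i i)).trans ?_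
        refine (norm_expI_apply_le hX hk hu.1).trans ?_
        exact integral_rowForm_mono _ _ _ hu.1 hu.2)
  rw [intervalIntegral.integral_const, sub_zero, smul_eq_mul] at h
  exact h

end MatrixGroup

/-! ### Functional calculus through the unitary group -/

/-- The spectral decomposition of a real symmetric matrix, of functions of it and of its unitary
group. -/
theorem exists_spectral_decomposition {n : Type*} [Fintype n] [DecidableEq n] {X : Matrix n n ℝ}
    (hX : X.IsSymm) : ∃ (V : n → n → ℝ) (l : n → ℝ),
      (∀ (f : ℝ → ℝ) (i j : n), (cfc f X : Matrix n n ℝ) i j = ∑ k, V i k * V j k * f (l k)) ∧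
      ∀ (t : ℝ) (i j : n), expI X t i j =
        ∑ k, (V i k * V j k : ℂ) * Complex.exp (Complex.I * (t * l k)) := by
  have hA : X.IsHermitian := by
    rw [Matrix.IsHermitian, Matrix.conjTranspose_eq_transpose_of_trivial]; exact hX
  set V : Matrix n n ℝ := (hA.eigenvectorUnitary : Matrix n n ℝ) with hV
  set l := hA.eigenvalues with hl
  have hVV : V * V.transpose = 1 := by
    have := Unitary.coe_mul_star_self hA.eigenvectorUnitary
    rwa [Unitary.coe_star, Matrix.star_eq_conjTranspose,
      Matrix.conjTranspose_eq_transpose_of_trivial] at this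
  have hcfc : ∀ (f : ℝ → ℝ) (i j : n), (cfc f X : Matrix n n ℝ) i j =
      ∑ k, V i k * V j k * f (l k) := by
    intro f i j
    rw [hA.cfc_eq, Matrix.IsHermitian.cfc, Unitary.conjStarAlgAut_apply, Matrix.mul_apply]
    refine Finset.sum_congr rfl fun k _ => ?_
    rw [Matrix.mul_diagonal, Matrix.star_apply]
    simp only [Function.comp_apply, RCLike.ofReal_real_eq_id, id_eq, star_trivial, hV]
    ring
  refine ⟨V, l, hcfc, ?_⟩
  intro t i j
  set W : Matrix n n ℂ := V.map Complex.ofReal with hW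
  have hWW : W * W.transpose = 1 := by
    have h := congrArg (fun M : Matrix n n ℝ => M.map Complex.ofRealHom) hVV
    simp only [Matrix.map_mul] at h
    rw [Matrix.map_one Complex.ofRealHom (map_zero _) (map_one _)] at h
    exact h
  have hinv : W⁻¹ = W.transpose := Matrix.inv_eq_right_inv hWW
  have hunit : IsUnit W := by
    rw [Matrix.isUnit_iff_isUnit_det]
    exact Matrix.isUnit_det_of_right_inverse hWW
  -- The functional calculus formula for the identity function is the spectral decomposition of `X`
  -- itself; conjugation by the eigenvector matrix then reduces the exponential to a diagonal one.
  have hgen : t • genI X =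
      W * Matrix.diagonal (fun k => Complex.I * (t * l k : ℂ)) * W⁻¹ := by
    ext a b
    rw [hinv, Matrix.mul_apply, Matrix.smul_apply, genI_apply]
    have h := hcfc id a b
    rw [cfc_id ℝ X (show IsSelfAdjoint X from hA)] at h
    rw [h]
    push_cast
    rw [Finset.mul_sum, Finset.smul_sum]
    refine Finset.sum_congr rfl fun k _ => ?_
    rw [Matrix.mul_diagonal, Matrix.transpose_apply]
    simp only [hW, Matrix.map_apply, id_eq, Complex.real_smul]
    ring
  rw [expI, hgen, Matrix.exp_conj _ _ hunit, Matrix.exp_diagonal, hinv, Matrix.mul_apply]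
  refine Finset.sum_congr rfl fun k _ => ?_
  rw [Matrix.mul_diagonal, Matrix.transpose_apply, Pi.coe_exp, ← Complex.exp_eq_exp_ℂ]
  simp only [hW, Matrix.map_apply]
  ring

/-- Matrix entries of `f(X)` for `f` in a Sobolev space, in terms of the unitary group. -/
theorem MemSobolevH.cfc_apply {s : ℝ} (hs : 1 / 2 < s) {f : ℝ → ℝ} (hc : Continuous f)
    (hf : MemSobolevH s f) {n : Type*} [Fintype n] [DecidableEq n] {X : Matrix n n ℝ}
    (hX : X.IsSymm) (i j : n) :
    (((cfc f X : Matrix n n ℝ) i j : ℝ) : ℂ) = ((√(2 * Real.pi))⁻¹ : ℝ) *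
      ∫ k, fourierHat f k * expI X k i j := by
  obtain ⟨V, l, h1, h2⟩ := exists_spectral_decomposition hX
  have hi := hf.integrable_fourierHat hs
  rw [h1]
  push_cast
  simp only [h2, hf.eq_integral hs hc]
  have hint_eq : ∀ x : ℝ, Integrable fun k : ℝ =>
      fourierHat f k * Complex.exp (Complex.I * (k * x)) := by
    intro x
    refine hi.mul_bdd (c := 1) (by fun_prop) (Eventually.of_forall fun k => ?_)
    rw [← Complex.ofReal_mul, mul_comm, Complex.norm_exp_ofReal_mul_I]
  have e : ∀ k : ℝ, fourierHat f k * ∑ m, (V i m * V j m : ℂ) * Complex.exp (Complex.I * (k * l m))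
      = ∑ m, (V i m * V j m : ℂ) * (fourierHat f k * Complex.exp (Complex.I * (k * l m))) := by
    intro k
    rw [Finset.mul_sum]
    exact Finset.sum_congr rfl fun m _ => by ring
  simp only [e]
  rw [integral_finsetSum _ fun m _ => (hint_eq _).const_mul _, Finset.mul_sum]
  refine Finset.sum_congr rfl fun m _ => ?_
  rw [integral_const_mul]
  push_cast; ring

/-! ### Complex Efron–Stein inequality and fourth moments of random linear forms -/

section Complex

variable {ι : Type*} [DecidableEq ι] [Fintype ι] {μ : ι → Measure ℝ}
  [∀ i, IsProbabilityMeasure (μ i)]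

theorem integrable_of_norm_le_one {α : Type*} [MeasurableSpace α] {ν : Measure α}
    [IsFiniteMeasure ν] {F : α → ℂ} (hF : Measurable F) (hF1 : ∀ x, ‖F x‖ ≤ 1) : Integrable F ν :=
  Integrable.of_bound hF.aestronglyMeasurable 1 (Eventually.of_forall hF1)

theorem norm_sq_eq_re_add_im (z : ℂ) : ‖z‖ ^ 2 = z.re ^ 2 + z.im ^ 2 := by
  rw [Complex.sq_norm, Complex.normSq_apply]; ring

/-- The Efron–Stein inequality for complex functions of modulus at most one. -/
theorem efronStein_blocks_complex {κ : Type*} [Fintype κ] [DecidableEq κ] (β : ι → κ)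
    {F : (ι → ℝ) → ℂ} (hF : Measurable F) (hF1 : ∀ x, ‖F x‖ ≤ 1) {G : κ → (ι → ℝ) → ℂ}
    (hG : ∀ c, Measurable (G c)) (hG1 : ∀ c x, ‖G c x‖ ≤ 1)
    (hGβ : ∀ c x y, (∀ i, β i ≠ c → x i = y i) → G c x = G c y) :
    ∫ x, ‖F x - ∫ y, F y ∂(Measure.pi μ)‖ ^ 2 ∂(Measure.pi μ) ≤
      ∑ c, ∫ x, ‖F x - G c x‖ ^ 2 ∂(Measure.pi μ) := by
  have hre : BddMeas (fun x => (F x).re) := ⟨Complex.measurable_re.comp hF, 1, fun x =>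
    (Complex.abs_re_le_norm _).trans (hF1 x)⟩
  have him : BddMeas (fun x => (F x).im) := ⟨Complex.measurable_im.comp hF, 1, fun x =>
    (Complex.abs_im_le_norm _).trans (hF1 x)⟩
  have hGre : ∀ c, BddMeas (fun x => (G c x).re) := fun c =>
    ⟨Complex.measurable_re.comp (hG c), 1, fun x => (Complex.abs_re_le_norm _).trans (hG1 c x)⟩
  have hGim : ∀ c, BddMeas (fun x => (G c x).im) := fun c =>
    ⟨Complex.measurable_im.comp (hG c), 1, fun x => (Complex.abs_im_le_norm _).trans (hG1 c x)⟩
  have h1 := efronStein_blocks (μ := μ) β hre hGre fun c x y h => by rw [hGβ c x y h]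
  have h2 := efronStein_blocks (μ := μ) β him hGim fun c x y h => by rw [hGβ c x y h]
  have hFi : Integrable F (Measure.pi μ) := integrable_of_norm_le_one hF hF1
  have e1 : (∫ y, F y ∂(Measure.pi μ)).re = ∫ y, (F y).re ∂(Measure.pi μ) :=
    (integral_re hFi).symm
  have e2 : (∫ y, F y ∂(Measure.pi μ)).im = ∫ y, (F y).im ∂(Measure.pi μ) :=
    (integral_im hFi).symm
  have hb : ∀ {f : (ι → ℝ) → ℝ}, BddMeas f → ∀ k : ℝ, Integrable (fun x => (f x - k) ^ 2)
      (Measure.pi μ) := fun hf k =>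
    (hf.sub ⟨measurable_const, |k|, fun _ => le_rfl⟩).sq.integrable _
  simp only [norm_sq_eq_re_add_im, Complex.sub_re, Complex.sub_im, e1, e2]
  rw [integral_add (hb hre _) (hb him _), hre.integral_sub_const_sq, him.integral_sub_const_sq]
  have e3 : ∀ c, ∫ x, (((F x).re - (G c x).re) ^ 2 + ((F x).im - (G c x).im) ^ 2)
      ∂(Measure.pi μ) = ∫ x, ((F x).re - (G c x).re) ^ 2 ∂(Measure.pi μ) +
        ∫ x, ((F x).im - (G c x).im) ^ 2 ∂(Measure.pi μ) := fun c =>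
    integral_add ((hre.sub (hGre c)).sq.integrable _) ((him.sub (hGim c)).sq.integrable _)
  simp only [e3, Finset.sum_add_distrib]
  nlinarith

/-- Fourth moment of a linear form in some of the coordinates, with coefficients that depend only
on the other coordinates. -/
theorem lintegral_norm_linear_form_le {κ : Type*} {e : κ → ι} (he : Function.Injective e)
    (T : Finset κ) (S : Finset ι) (hS : ∀ k ∈ T, e k ∈ S) {c : κ → (ι → ℝ) → ℂ}
    (hcm : ∀ k, Measurable (c k)) (hc : ∀ k ∈ T, ∀ x y, c k (S.piecewise y x) = c k x)
    (hc1 : ∀ x, ∑ k ∈ T, ‖c k x‖ ^ 2 ≤ 1) {s M : ℝ} (hs : 0 ≤ s) (hM : 0 ≤ M)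
    (h4 : ∀ k ∈ T, MemLp id 4 (μ (e k))) (h1 : ∀ k ∈ T, ∫ r, r ∂(μ (e k)) = 0)
    (h2 : ∀ k ∈ T, ∫ r, r ^ 2 ∂(μ (e k)) ≤ s) (h3 : ∀ k ∈ T, ∫ r, r ^ 4 ∂(μ (e k)) ≤ M) :
    ∫⁻ x, ENNReal.ofReal (‖∑ k ∈ T, c k x * x (e k)‖ ^ 4) ∂(Measure.pi μ) ≤
      ENNReal.ofReal (4 * (3 * s ^ 2 + M)) := by
  have hmeas : Measurable fun x : ι → ℝ => ENNReal.ofReal (‖∑ k ∈ T, c k x * x (e k)‖ ^ 4) := by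
    refine ENNReal.measurable_ofReal.comp ((Measurable.norm ?_).pow_const 4)
    refine Finset.measurable_sum _ fun k _ => (hcm k).mul ?_
    exact Complex.measurable_ofReal.comp (measurable_pi_apply _)
  -- Only the coordinates in `S` are resampled. The coefficients do not see them, so for fixed `x`
  -- the sum is a linear form with constant coefficients.
  rw [lintegral_eq_lintegral_piecewise hmeas S]
  have key : ∀ x : ι → ℝ, ∫⁻ y, ENNReal.ofReal (‖∑ k ∈ T, c k (S.piecewise y x) *
      (S.piecewise y x) (e k)‖ ^ 4) ∂(Measure.pi μ) ≤ ENNReal.ofReal (4 * (3 * s ^ 2 + M)) := by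
    intro x
    have hsum : ∀ y : ι → ℝ, ∑ k ∈ T, c k (S.piecewise y x) * ((S.piecewise y x) (e k) : ℂ) =
        ∑ k ∈ T, c k x * (y (e k) : ℂ) := fun y => Finset.sum_congr rfl fun k hk => by
      rw [hc k hk, Finset.piecewise_eq_of_mem _ _ _ (hS k hk)]
    simp only [hsum]
    have hev : ∀ k, MeasurePreserving (fun y : ι → ℝ => y (e k)) (Measure.pi μ) (μ (e k)) :=
      fun k => measurePreserving_eval μ (e k)
    have hint_eq : ∀ k (g : ℝ → ℝ), Measurable g →
        ∫ y, g (y (e k)) ∂(Measure.pi μ) = ∫ r, g r ∂(μ (e k)) := by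
      intro k g hg
      rw [← (hev k).map_eq, integral_map (hev k).measurable.aemeasurable hg.aestronglyMeasurable]
    have hind : iIndepFun (fun (k : κ) (y : ι → ℝ) => y (e k)) (Measure.pi μ) :=
      (iIndepFun_pi (X := fun _ => id) (μ := μ) fun _ => aemeasurable_id).precomp he
    have main : ∀ d : κ → ℝ, ∑ k ∈ T, d k ^ 2 ≤ 1 →
        Integrable (fun y => (∑ k ∈ T, d k * y (e k)) ^ 4) (Measure.pi μ) ∧
        ∫ y, (∑ k ∈ T, d k * y (e k)) ^ 4 ∂(Measure.pi μ) ≤ 3 * s ^ 2 + M := by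
      intro d hd
      obtain ⟨hL, -, -, hb⟩ := moments_linear_form (P := Measure.pi μ)
        (Y := fun (k : κ) (y : ι → ℝ) => y (e k)) (fun k => measurable_pi_apply _) hind d
        (s := s) (M := M) T
        (fun k hk => (h4 k hk).comp_measurePreserving (hev k))
        (fun k hk => (hint_eq k id measurable_id).trans (h1 k hk))
        (fun k hk => (hint_eq k (fun r => r ^ 2) (by fun_prop)).trans_le (h2 k hk))
        (fun k hk => (hint_eq k (fun r => r ^ 4) (by fun_prop)).trans_le (h3 k hk)) hs hM
      have h5 := hL.integrable_norm_pow'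
      refine ⟨?_, hb.trans ?_⟩
      · refine (integrable_norm_iff ?_).1 (by simpa using h5)
        exact hL.1.pow 4
      · have h6 : 0 ≤ ∑ k ∈ T, d k ^ 2 := Finset.sum_nonneg fun _ _ => sq_nonneg _
        have h7 : (∑ k ∈ T, d k ^ 2) ^ 2 ≤ 1 := by nlinarith
        have h8 : 0 ≤ 3 * s ^ 2 + M := by positivity
        nlinarith
    have hle : ∀ (g : ℂ → ℝ), (∀ z, g z ^ 2 ≤ ‖z‖ ^ 2) → ∑ k ∈ T, g (c k x) ^ 2 ≤ 1 := fun g hg =>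
      (Finset.sum_le_sum fun k _ => hg _).trans (hc1 x)
    obtain ⟨i1, b1⟩ := main (fun k => (c k x).re) (hle _ fun z => by
      rw [norm_sq_eq_re_add_im]; nlinarith [sq_nonneg z.im])
    obtain ⟨i2, b2⟩ := main (fun k => (c k x).im) (hle _ fun z => by
      rw [norm_sq_eq_re_add_im]; nlinarith [sq_nonneg z.re])
    -- From `(u² + v²)² ≤ 2u⁴ + 2v⁴` for real and imaginary parts; each fourth moment is at most
    -- `3s² + M`, whence the factor `4`.
    have hpt : ∀ y : ι → ℝ, ‖∑ k ∈ T, c k x * (y (e k) : ℂ)‖ ^ 4 ≤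
        2 * (∑ k ∈ T, (c k x).re * y (e k)) ^ 4 + 2 * (∑ k ∈ T, (c k x).im * y (e k)) ^ 4 := by
      intro y
      have := norm_sq_eq_re_add_im (∑ k ∈ T, c k x * (y (e k) : ℂ))
      simp only [Complex.re_sum, Complex.im_sum, Complex.re_mul_ofReal,
        Complex.im_mul_ofReal] at this
      rw [show ‖∑ k ∈ T, c k x * (y (e k) : ℂ)‖ ^ 4 = (‖∑ k ∈ T, c k x * (y (e k) : ℂ)‖ ^ 2) ^ 2
        by ring, this]
      nlinarith [sq_nonneg ((∑ k ∈ T, (c k x).re * y (e k)) ^ 2 -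
        (∑ k ∈ T, (c k x).im * y (e k)) ^ 2)]
    calc _ ≤ ∫⁻ y, ENNReal.ofReal (2 * (∑ k ∈ T, (c k x).re * y (e k)) ^ 4 +
          2 * (∑ k ∈ T, (c k x).im * y (e k)) ^ 4) ∂(Measure.pi μ) :=
          lintegral_mono fun y => ENNReal.ofReal_le_ofReal (hpt y)
      _ = ENNReal.ofReal (∫ y, 2 * (∑ k ∈ T, (c k x).re * y (e k)) ^ 4 +
          2 * (∑ k ∈ T, (c k x).im * y (e k)) ^ 4 ∂(Measure.pi μ)) :=
          (ofReal_integral_eq_lintegral_ofReal ((i1.const_mul 2).add (i2.const_mul 2))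
            (Eventually.of_forall fun y => by simp only [Pi.zero_apply, Pi.add_apply]; positivity)).symm
      _ ≤ _ := by
        refine ENNReal.ofReal_le_ofReal ?_
        rw [integral_add (i1.const_mul 2) (i2.const_mul 2), integral_const_mul,
          integral_const_mul]
        linarith
  calc _ ≤ ∫⁻ _ : ι → ℝ, ENNReal.ofReal (4 * (3 * s ^ 2 + M)) ∂(Measure.pi μ) :=
        lintegral_mono key
    _ = _ := by simp

end Complex

theorem sq_integral_le {t : ℝ} (ht : 0 ≤ t) {f : ℝ → ℝ} (hf : Continuous f) :
    (∫ v in (0 : ℝ)..t, f v) ^ 2 ≤ t * ∫ v in (0 : ℝ)..t, f v ^ 2 := by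
  rcases ht.eq_or_lt with rfl | ht'
  · simp
  set m := (∫ v in (0 : ℝ)..t, f v) / t with hm
  have hmt : ∫ v in (0 : ℝ)..t, f v = m * t := by rw [hm]; field_simp
  have h0 : 0 ≤ ∫ v in (0 : ℝ)..t, (f v - m) ^ 2 :=
    intervalIntegral.integral_nonneg ht fun v _ => sq_nonneg _
  have e : ∀ v, (f v - m) ^ 2 = f v ^ 2 - 2 * m * f v + m ^ 2 := fun v => by ring
  have i1 : IntervalIntegrable (fun v => f v ^ 2) volume 0 t := (hf.pow 2).intervalIntegrable _ _
  have i2 : IntervalIntegrable (fun v => 2 * m * f v) volume 0 t :=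
    (continuous_const.mul hf).intervalIntegrable _ _
  have i3 : IntervalIntegrable (fun v => f v ^ 2 - 2 * m * f v) volume 0 t := i1.sub i2
  simp only [e] at h0
  rw [intervalIntegral.integral_add i3 (by simp), intervalIntegral.integral_sub i1 i2,
    intervalIntegral.integral_const_mul, intervalIntegral.integral_const, hmt] at h0
  simp only [sub_zero, smul_eq_mul] at h0
  rw [hmt]
  nlinarith

theorem pow_four_integral_le {t : ℝ} (ht : 0 ≤ t) {f : ℝ → ℝ} (hf : Continuous f) :
    (∫ v in (0 : ℝ)..t, f v) ^ 4 ≤ t ^ 3 * ∫ v in (0 : ℝ)..t, f v ^ 4 := by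
  have h1 := sq_integral_le ht hf
  have h2 := sq_integral_le ht (hf.pow 2)
  simp only [Pi.pow_apply] at h2
  have e : ∀ v, (f v ^ 2) ^ 2 = f v ^ 4 := fun v => by ring
  simp only [e] at h2
  have h3 : 0 ≤ ∫ v in (0 : ℝ)..t, f v ^ 2 :=
    intervalIntegral.integral_nonneg ht fun v _ => sq_nonneg _
  calc (∫ v in (0 : ℝ)..t, f v) ^ 4 = ((∫ v in (0 : ℝ)..t, f v) ^ 2) ^ 2 := by ring
    _ ≤ (t * ∫ v in (0 : ℝ)..t, f v ^ 2) ^ 2 := by gcongr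
    _ = t ^ 2 * (∫ v in (0 : ℝ)..t, f v ^ 2) ^ 2 := by ring
    _ ≤ t ^ 2 * (t * ∫ v in (0 : ℝ)..t, f v ^ 4) := by gcongr
    _ = _ := by ring

/-- Fourth moment of a time integral of a continuous random process. -/
theorem integral_pow_four_integral_le {α : Type*} [TopologicalSpace α] [MeasurableSpace α]
    [BorelSpace α] [SecondCountableTopology α] {ν : Measure α} [IsFiniteMeasure ν] {q : α → ℝ → ℝ}
    (hq : Continuous fun z : α × ℝ => q z.1 z.2) {κ : ℝ} (hκ : 0 ≤ κ)
    (hb : ∀ v, ∫⁻ x, ENNReal.ofReal (q x v ^ 4) ∂ν ≤ ENNReal.ofReal κ) {t : ℝ} (ht : 0 ≤ t) :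
    Integrable (fun x => (∫ v in (0 : ℝ)..t, q x v) ^ 4) ν ∧
      ∫ x, (∫ v in (0 : ℝ)..t, q x v) ^ 4 ∂ν ≤ t ^ 4 * κ := by
  have hqx : ∀ x, Continuous (q x) := fun x => hq.comp (by fun_prop : Continuous fun v => (x, v))
  have hcont : Continuous fun x => (∫ v in (0 : ℝ)..t, q x v) ^ 4 :=
    (intervalIntegral.continuous_parametric_intervalIntegral_of_continuous' hq 0 t).pow 4
  have hl : ∫⁻ x, ENNReal.ofReal ((∫ v in (0 : ℝ)..t, q x v) ^ 4) ∂ν ≤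
      ENNReal.ofReal (t ^ 4 * κ) := by
    -- Two applications of Cauchy–Schwarz in time give the factor `t³`; after Tonelli the time
    -- integral of the uniform bound `κ` gives one more `t`.
    calc _ ≤ ∫⁻ x, (ENNReal.ofReal (t ^ 3) *
          ∫⁻ v in Set.Ioc 0 t, ENNReal.ofReal (q x v ^ 4)) ∂ν := by
          refine lintegral_mono fun x => ?_
          refine (ENNReal.ofReal_le_ofReal (pow_four_integral_le ht (hqx x))).trans ?_
          rw [ENNReal.ofReal_mul (by positivity), intervalIntegral.integral_of_le ht,
            ofReal_integral_eq_lintegral_ofReal]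
          · exact (((hqx x).pow 4).intervalIntegrable 0 t).1
          · exact Eventually.of_forall fun v => by positivity
      _ = ENNReal.ofReal (t ^ 3) * ∫⁻ x, (∫⁻ v in Set.Ioc 0 t, ENNReal.ofReal (q x v ^ 4)) ∂ν :=
          lintegral_const_mul' _ _ ENNReal.ofReal_ne_top
      _ = ENNReal.ofReal (t ^ 3) * ∫⁻ v in Set.Ioc 0 t, ∫⁻ x, ENNReal.ofReal (q x v ^ 4) ∂ν := by
          rw [lintegral_lintegral_swap]
          exact (ENNReal.continuous_ofReal.comp (hq.pow 4)).measurable.aemeasurable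
      _ ≤ ENNReal.ofReal (t ^ 3) * ∫⁻ _ in Set.Ioc 0 t, ENNReal.ofReal κ := by
          gcongr with v; exact hb v
      _ = _ := by
          rw [lintegral_const, Measure.restrict_apply_univ, Real.volume_Ioc, sub_zero,
            ← ENNReal.ofReal_mul hκ, ← ENNReal.ofReal_mul (by positivity)]
          congr 1; ring
  have hi : Integrable (fun x => (∫ v in (0 : ℝ)..t, q x v) ^ 4) ν := by
    refine ⟨hcont.aestronglyMeasurable, ?_⟩
    rw [hasFiniteIntegral_iff_ofReal (Eventually.of_forall fun x => by positivity)]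
    exact hl.trans_lt ENNReal.ofReal_lt_top
  refine ⟨hi, ?_⟩
  rw [← ENNReal.ofReal_le_ofReal_iff (by positivity), ofReal_integral_eq_lintegral_ofReal hi
    (Eventually.of_forall fun x => by positivity)]
  exact hl

/-! ### Symmetric matrices as functions of their independent entries -/

/-- The unordered pairs of indices of an `N × N` matrix. -/
abbrev UpperPair (N : ℕ) := {p : Fin N × Fin N // p.1 ≤ p.2}

/-- The unordered pair of two indices. -/
def upperPair {N : ℕ} (j k : Fin N) : UpperPair N := ⟨(min j k, max j k), min_le_max⟩

theorem upperPair_comm {N : ℕ} (j k : Fin N) : upperPair j k = upperPair k j := by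
  simp [upperPair, min_comm, max_comm]

theorem upperPair_of_le {N : ℕ} {j k : Fin N} (h : j ≤ k) : upperPair j k = ⟨(j, k), h⟩ := by
  simp [upperPair, min_eq_left h, max_eq_right h]

theorem upperPair_cases {N : ℕ} (j k : Fin N) :
    ((upperPair j k).1.1 = j ∧ (upperPair j k).1.2 = k) ∨
      ((upperPair j k).1.1 = k ∧ (upperPair j k).1.2 = j) := by
  rcases le_total j k with h | h
  · left; simp [upperPair_of_le h]
  · right; rw [upperPair_comm]; simp [upperPair_of_le h]

theorem upperPair_injective {N : ℕ} (a : Fin N) :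
    Function.Injective fun k : Fin N => upperPair k a := by
  intro j k h
  simp only at h
  have h1 : (upperPair j a).1.1 = (upperPair k a).1.1 := by rw [h]
  have h2 : (upperPair j a).1.2 = (upperPair k a).1.2 := by rw [h]
  rcases upperPair_cases j a with ⟨e1, e2⟩ | ⟨e1, e2⟩ <;>
  rcases upperPair_cases k a with ⟨e3, e4⟩ | ⟨e3, e4⟩ <;>
  simp_all

/-- The symmetric matrix with given entries on and above the diagonal. -/
def symMat {N : ℕ} (x : UpperPair N → ℝ) : Matrix (Fin N) (Fin N) ℝ :=
  Matrix.of fun j k => x (upperPair j k)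

@[simp]
theorem symMat_apply {N : ℕ} (x : UpperPair N → ℝ) (j k : Fin N) :
    symMat x j k = x (upperPair j k) := rfl

theorem symMat_isSymm {N : ℕ} (x : UpperPair N → ℝ) : (symMat x).IsSymm := by
  ext j k
  simp [upperPair_comm]

theorem continuous_symMat {N : ℕ} : Continuous (symMat : (UpperPair N → ℝ) → _) :=
  continuous_pi fun _ => continuous_pi fun _ => continuous_apply _

theorem continuous_zeroRow {n : Type*} [DecidableEq n] (a : n) :
    Continuous (zeroRow a : Matrix n n ℝ → Matrix n n ℝ) := by
  refine continuous_pi fun j => continuous_pi fun k => ?_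
  by_cases h : j = a ∨ k = a
  · simpa [zeroRow, h] using continuous_const
  · simpa [zeroRow, h] using continuous_id.matrix_elem j k

theorem continuous_zeroEntry {n : Type*} [DecidableEq n] (i k : n) :
    Continuous (zeroEntry i k : Matrix n n ℝ → Matrix n n ℝ) := by
  refine continuous_pi fun a => continuous_pi fun b => ?_
  by_cases h : (a = i ∧ b = k) ∨ (a = k ∧ b = i)
  · simpa [zeroEntry, h] using continuous_const
  · simpa [zeroEntry, h] using continuous_id.matrix_elem a b

theorem continuous_rowForm_comp {n α : Type*} [Fintype n] [DecidableEq n] [TopologicalSpace α]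
    {X : α → Matrix n n ℝ} {t : α → ℝ} (hX : Continuous X) (ht : Continuous t) (a i : n) :
    Continuous fun z => rowForm a (X z) i (t z) := by
  refine continuous_finsetSum _ fun k _ => ?_
  exact (continuous_expI_apply_comp ((continuous_zeroRow a).comp hX) ht i k).mul
    (Complex.continuous_ofReal.comp (hX.matrix_elem k a))

theorem zeroRow_symMat_congr {N : ℕ} {a : Fin N} {x y : UpperPair N → ℝ}
    (h : ∀ p : UpperPair N, p.1.1 ≠ a → p.1.2 ≠ a → x p = y p) :
    zeroRow a (symMat x) = zeroRow a (symMat y) := by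
  ext j k
  simp only [zeroRow, Matrix.of_apply, symMat_apply]
  split_ifs with hjk
  · rfl
  · push Not at hjk
    refine h _ ?_ ?_ <;> rcases upperPair_cases j k with ⟨e1, e2⟩ | ⟨e1, e2⟩ <;> simp [e1, e2, hjk]

/-! ### Variance of the entries of the unitary group -/

/-- The moment conditions on the laws of the entries of a symmetric matrix. -/
structure EntryLaws {N : ℕ} (μ : UpperPair N → Measure ℝ) (s M d : ℝ) : Prop where
  s_nonneg : 0 ≤ s
  M_nonneg : 0 ≤ M
  d_nonneg : 0 ≤ d
  memLp : ∀ p, p.1.1 ≠ p.1.2 → MemLp id 4 (μ p)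
  mean : ∀ p, p.1.1 ≠ p.1.2 → ∫ r, r ∂(μ p) = 0
  second : ∀ p, p.1.1 ≠ p.1.2 → ∫ r, r ^ 2 ∂(μ p) ≤ s
  fourth : ∀ p, p.1.1 ≠ p.1.2 → ∫ r, r ^ 4 ∂(μ p) ≤ M
  memLp_diag : ∀ p, p.1.1 = p.1.2 → MemLp id 2 (μ p)
  second_diag : ∀ p, p.1.1 = p.1.2 → ∫ r, r ^ 2 ∂(μ p) ≤ d

namespace EntryLaws

variable {N : ℕ} {μ : UpperPair N → Measure ℝ} {s M d : ℝ} [∀ p, IsProbabilityMeasure (μ p)]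

/-- The coefficients are computed from the matrix without row and column `a`, hence are independent
of the entries in column `a`, and unitarity bounds their square sum by one. Excluding `a` from `T`
keeps out the diagonal entry, for which no fourth moment is available. -/
theorem lintegral_sum_le (h : EntryLaws μ s M d) {a : Fin N} (i : Fin N) (T : Finset (Fin N))
    (hT : a ∉ T) (v : ℝ) :
    ∫⁻ x, ENNReal.ofReal (‖∑ k ∈ T, expI (zeroRow a (symMat x)) v i k *
      (x (upperPair k a) : ℂ)‖ ^ 4) ∂(Measure.pi μ) ≤ ENNReal.ofReal (4 * (3 * s ^ 2 + M)) := by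
  have hne : ∀ k ∈ T, (upperPair k a).1.1 ≠ (upperPair k a).1.2 := by
    intro k hk
    have hka : k ≠ a := fun e => hT (e ▸ hk)
    rcases upperPair_cases k a with ⟨e1, e2⟩ | ⟨e1, e2⟩ <;> simp [e1, e2, hka, hka.symm]
  refine lintegral_norm_linear_form_le (upperPair_injective a) T
    (Finset.univ.filter fun p : UpperPair N => p.1.1 = a ∨ p.1.2 = a) ?_
    (c := fun k x => expI (zeroRow a (symMat x)) v i k) ?_ ?_ ?_ h.s_nonneg h.M_nonneg
    (fun k hk => h.memLp _ (hne k hk)) (fun k hk => h.mean _ (hne k hk))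
    (fun k hk => h.second _ (hne k hk)) (fun k hk => h.fourth _ (hne k hk))
  · intro k _
    rcases upperPair_cases k a with ⟨e1, e2⟩ | ⟨e1, e2⟩ <;> simp [e1, e2]
  · intro k
    exact (continuous_expI_apply_comp ((continuous_zeroRow a).comp continuous_symMat)
      continuous_const i k).measurable
  · intro k _ x y
    have e : zeroRow a (symMat ((Finset.univ.filter fun p : UpperPair N =>
        p.1.1 = a ∨ p.1.2 = a).piecewise y x)) = zeroRow a (symMat x) :=
      zeroRow_symMat_congr fun p h1 h2 => by simp [Finset.piecewise, h1, h2]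
    exact congrArg (fun Z => expI Z v i k) e
  · intro x
    refine (Finset.sum_le_sum_of_subset_of_nonneg (Finset.subset_univ T)
      fun _ _ _ => by positivity).trans ?_
    rw [sum_norm_sq_expI (zeroRow_isSymm (symMat_isSymm x) a)]

/-- The summand with the diagonal entry `(a, a)` drops out, because the decoupled group has entry
zero at `(i, a)`. -/
theorem integral_rowForm_le (h : EntryLaws μ s M d) {a i : Fin N} (hi : i ≠ a) {t : ℝ}
    (ht : 0 ≤ t) :
    Integrable (fun x => (∫ v in (0 : ℝ)..t, ‖rowForm a (symMat x) i v‖) ^ 4) (Measure.pi μ) ∧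
      ∫ x, (∫ v in (0 : ℝ)..t, ‖rowForm a (symMat x) i v‖) ^ 4 ∂(Measure.pi μ) ≤
        t ^ 4 * (4 * (3 * s ^ 2 + M)) := by
  have hs := h.s_nonneg
  have hM := h.M_nonneg
  refine integral_pow_four_integral_le (continuous_rowForm_comp
    (continuous_symMat.comp continuous_fst) continuous_snd a i).norm (by positivity) ?_ ht
  intro v
  refine le_of_eq_of_le ?_ (h.lintegral_sum_le (a := a) i (Finset.univ.erase a) (by simp) v)
  refine lintegral_congr fun x => ?_
  rw [rowForm, ← Finset.sum_erase_add _ _ (Finset.mem_univ a),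
    expI_zeroRow_col (symMat_isSymm x), if_neg hi.symm, zero_mul, add_zero]
  simp

/-- The deleted entry lies in row `a`, so the coefficients of the linear form are unchanged; the
form merely loses its summand `i`. -/
theorem integral_rowForm_zeroEntry_le (h : EntryLaws μ s M d) {a i : Fin N} (hi : i ≠ a) {t : ℝ}
    (ht : 0 ≤ t) :
    Integrable (fun x => (∫ v in (0 : ℝ)..t, ‖rowForm a (zeroEntry a i (symMat x)) i v‖) ^ 4)
      (Measure.pi μ) ∧
      ∫ x, (∫ v in (0 : ℝ)..t, ‖rowForm a (zeroEntry a i (symMat x)) i v‖) ^ 4 ∂(Measure.pi μ) ≤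
        t ^ 4 * (4 * (3 * s ^ 2 + M)) := by
  have hs := h.s_nonneg
  have hM := h.M_nonneg
  refine integral_pow_four_integral_le (continuous_rowForm_comp
    ((continuous_zeroEntry a i).comp (continuous_symMat.comp continuous_fst))
    continuous_snd a i).norm (by positivity) ?_ ht
  intro v
  refine le_of_eq_of_le ?_ (h.lintegral_sum_le (a := a) i ((Finset.univ.erase a).erase i) (by simp) v)
  refine lintegral_congr fun x => ?_
  rw [rowForm, zeroRow_zeroEntry, ← Finset.sum_erase_add _ _ (Finset.mem_univ a),
    expI_zeroRow_col (symMat_isSymm x), if_neg hi.symm, zero_mul, add_zero,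
    ← Finset.sum_erase_add _ _ (Finset.mem_erase.2 ⟨hi, Finset.mem_univ i⟩)]
  congr 3
  have e0 : zeroEntry a i (symMat x) i a = 0 := by simp [zeroEntry]
  rw [e0, Complex.ofReal_zero, mul_zero, add_zero]
  refine Finset.sum_congr rfl fun k hk => ?_
  simp only [Finset.mem_erase, Finset.mem_univ, and_true] at hk
  simp [zeroEntry, hk]

theorem integral_norm_sub_zeroRow_le (h : EntryLaws μ s M d) {a i j : Fin N} (hi : i ≠ a)
    (hj : j ≠ a) {t : ℝ} (ht : 0 ≤ t) :
    ∫ x, ‖expI (symMat x) t i j - expI (zeroRow a (symMat x)) t i j‖ ^ 2 ∂(Measure.pi μ) ≤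
      t ^ 4 * (4 * (3 * s ^ 2 + M)) := by
  obtain ⟨i1, b1⟩ := h.integral_rowForm_le hi ht
  obtain ⟨i2, b2⟩ := h.integral_rowForm_le hj ht
  have hle : ∀ x : UpperPair N → ℝ,
      ‖expI (symMat x) t i j - expI (zeroRow a (symMat x)) t i j‖ ^ 2 ≤
      1 / 2 * (∫ v in (0 : ℝ)..t, ‖rowForm a (symMat x) i v‖) ^ 4 +
      1 / 2 * (∫ v in (0 : ℝ)..t, ‖rowForm a (symMat x) j v‖) ^ 4 := by
    intro x
    have h1 := norm_expI_sub_zeroRow_le (symMat_isSymm x) hi hj ht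
    set A := ∫ v in (0 : ℝ)..t, ‖rowForm a (symMat x) i v‖
    set B := ∫ v in (0 : ℝ)..t, ‖rowForm a (symMat x) j v‖
    calc _ ≤ (A * B) ^ 2 := by gcongr
      _ ≤ _ := by nlinarith [sq_nonneg (A ^ 2 - B ^ 2)]
  refine (integral_mono_of_nonneg (Eventually.of_forall fun x => by positivity)
    ((i1.const_mul _).add (i2.const_mul _)) (Eventually.of_forall hle)).trans ?_
  rw [integral_add' (i1.const_mul _) (i2.const_mul _), integral_const_mul, integral_const_mul]
  linarith

/-- The fourth moment bound is turned into a second moment bound by `2A² ≤ δ⁻¹ + δA⁴`. The later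
choice `δ = N` balances the terms, since the fourth moment is of order `N⁻²`. -/
theorem integral_norm_offDiag_le (h : EntryLaws μ s M d) {i j : Fin N} (hij : i ≠ j) {t : ℝ}
    (ht : 0 ≤ t) {δ : ℝ} (hδ : 0 < δ) :
    ∫ x, ‖expI (symMat x) t i j‖ ^ 2 ∂(Measure.pi μ) ≤
      δ⁻¹ + δ * (t ^ 4 * (4 * (3 * s ^ 2 + M))) := by
  obtain ⟨i1, b1⟩ := h.integral_rowForm_le hij ht
  have hle : ∀ x : UpperPair N → ℝ, ‖expI (symMat x) t i j‖ ^ 2 ≤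
      δ⁻¹ + δ * (∫ v in (0 : ℝ)..t, ‖rowForm j (symMat x) i v‖) ^ 4 := by
    intro x
    have h1 := norm_expI_apply_le (symMat_isSymm x) hij ht
    set A := ∫ v in (0 : ℝ)..t, ‖rowForm j (symMat x) i v‖
    have h2 : δ⁻¹ + δ * A ^ 4 - 2 * A ^ 2 = δ * (A ^ 2 - δ⁻¹) ^ 2 := by field_simp; ring
    have h3 : 0 ≤ δ * (A ^ 2 - δ⁻¹) ^ 2 := by positivity
    calc _ ≤ A ^ 2 := by gcongr
      _ ≤ _ := by nlinarith [sq_nonneg A]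
  refine (integral_mono_of_nonneg (Eventually.of_forall fun x => by positivity)
    ((integrable_const _).add (i1.const_mul _)) (Eventually.of_forall hle)).trans ?_
  rw [integral_add' (integrable_const _) (i1.const_mul _), integral_const_mul]
  simp only [integral_const, probReal_univ, smul_eq_mul, one_mul]
  gcongr

theorem integral_eval {p : UpperPair N} {g : ℝ → ℝ} (hg : Measurable g) :
    ∫ x, g (x p) ∂(Measure.pi μ) = ∫ r, g r ∂(μ p) := by
  have hev := measurePreserving_eval μ p
  rw [← hev.map_eq, integral_map hev.measurable.aemeasurable hg.aestronglyMeasurable]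

theorem integral_norm_sub_zeroEntry_diag_le (h : EntryLaws μ s M d) (i : Fin N) {t : ℝ}
    (ht : 0 ≤ t) :
    ∫ x, ‖expI (symMat x) t i i - expI (zeroEntry i i (symMat x)) t i i‖ ^ 2 ∂(Measure.pi μ) ≤
      t ^ 2 * d := by
  have hp : (upperPair i i).1.1 = (upperPair i i).1.2 := by simp [upperPair]
  have hL := (h.memLp_diag _ hp).comp_measurePreserving (measurePreserving_eval μ (upperPair i i))
  have hi : Integrable (fun x : UpperPair N → ℝ => (x (upperPair i i)) ^ 2) (Measure.pi μ) :=
    hL.integrable_sq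
  have hle : ∀ x : UpperPair N → ℝ,
      ‖expI (symMat x) t i i - expI (zeroEntry i i (symMat x)) t i i‖ ^ 2 ≤
      t ^ 2 * (x (upperPair i i)) ^ 2 := by
    intro x
    have h1 := norm_expI_sub_zeroEntry_diag_le (symMat_isSymm x) i ht
    calc _ ≤ (t * |symMat x i i|) ^ 2 := by gcongr
      _ = _ := by rw [mul_pow, sq_abs, symMat_apply]
  refine (integral_mono_of_nonneg (Eventually.of_forall fun x => by positivity)
    (hi.const_mul _) (Eventually.of_forall hle)).trans ?_
  rw [integral_const_mul, integral_eval (g := fun r => r ^ 2) (by fun_prop)]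
  exact mul_le_mul_of_nonneg_left (h.second_diag _ hp) (by positivity)

theorem integral_norm_sub_zeroEntry_le (h : EntryLaws μ s M d) {i k : Fin N} (hk : k ≠ i) {t : ℝ}
    (ht : 0 ≤ t) :
    ∫ x, ‖expI (symMat x) t i i - expI (zeroEntry i k (symMat x)) t i i‖ ^ 2 ∂(Measure.pi μ) ≤
      2 * t ^ 4 * M + 2 * t ^ 4 * (4 * (3 * s ^ 2 + M)) := by
  obtain ⟨i1, b1⟩ := h.integral_rowForm_le hk ht
  obtain ⟨i2, b2⟩ := h.integral_rowForm_zeroEntry_le hk ht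
  have hp : (upperPair k i).1.1 ≠ (upperPair k i).1.2 := by
    rcases upperPair_cases k i with ⟨e1, e2⟩ | ⟨e1, e2⟩ <;> simp [e1, e2, hk, hk.symm]
  have hL := (h.memLp _ hp).comp_measurePreserving (measurePreserving_eval μ (upperPair k i))
  have hi : Integrable (fun x : UpperPair N → ℝ => (x (upperPair k i)) ^ 4) (Measure.pi μ) := by
    have h5 := hL.integrable_norm_pow'
    refine (integrable_norm_iff ?_).1 (by simpa using h5)
    exact hL.1.pow 4
  have hle : ∀ x : UpperPair N → ℝ,
      ‖expI (symMat x) t i i - expI (zeroEntry i k (symMat x)) t i i‖ ^ 2 ≤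
      2 * t ^ 4 * (x (upperPair k i)) ^ 4 +
      (1 * (∫ v in (0 : ℝ)..t, ‖rowForm i (zeroEntry i k (symMat x)) k v‖) ^ 4 +
      1 * (∫ v in (0 : ℝ)..t, ‖rowForm i (symMat x) k v‖) ^ 4) := by
    intro x
    have h1 := norm_expI_sub_zeroEntry_le (symMat_isSymm x) hk ht
    set A := ∫ v in (0 : ℝ)..t, ‖rowForm i (zeroEntry i k (symMat x)) k v‖
    set B := ∫ v in (0 : ℝ)..t, ‖rowForm i (symMat x) k v‖
    rw [symMat_apply] at h1
    set y := x (upperPair k i)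
    calc _ ≤ (t * (|y| * (A + B))) ^ 2 := by gcongr
      _ = t ^ 2 * y ^ 2 * (A + B) ^ 2 := by rw [mul_pow, mul_pow, sq_abs]; ring
      _ ≤ t ^ 2 * y ^ 2 * (2 * A ^ 2 + 2 * B ^ 2) := by
        gcongr; nlinarith [sq_nonneg (A - B)]
      _ ≤ _ := by nlinarith [sq_nonneg (t ^ 2 * y ^ 2 - A ^ 2), sq_nonneg (t ^ 2 * y ^ 2 - B ^ 2)]
  have i12 : Integrable (fun x : UpperPair N → ℝ =>
      1 * (∫ v in (0 : ℝ)..t, ‖rowForm i (zeroEntry i k (symMat x)) k v‖) ^ 4 +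
      1 * (∫ v in (0 : ℝ)..t, ‖rowForm i (symMat x) k v‖) ^ 4) (Measure.pi μ) :=
    (i2.const_mul _).add (i1.const_mul _)
  refine (integral_mono_of_nonneg (Eventually.of_forall fun x => by positivity)
    ((hi.const_mul _).add i12) (Eventually.of_forall hle)).trans ?_
  rw [integral_add' (hi.const_mul _) i12, integral_add (i2.const_mul _) (i1.const_mul _),
    integral_const_mul, integral_const_mul, integral_const_mul,
    integral_eval (g := fun r => r ^ 4) (by fun_prop)]
  have := mul_le_mul_of_nonneg_left (h.fourth _ hp) (show 0 ≤ 2 * t ^ 4 by positivity)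
  linarith

theorem measurable_expI_symMat_comp {f : Matrix (Fin N) (Fin N) ℝ → Matrix (Fin N) (Fin N) ℝ}
    (hf : Continuous f) (t : ℝ) (i j : Fin N) :
    Measurable fun x : UpperPair N → ℝ => expI (f (symMat x)) t i j :=
  (continuous_expI_apply_comp (hf.comp continuous_symMat) continuous_const i j).measurable

/-- All entries in the rows and columns `i`, `j` form one block, for which the comparison function
is zero: the cost is the second moment of the group entry. Every other row is compared with its
deletion. -/
theorem variance_offDiag_le (h : EntryLaws μ s M d) {i j : Fin N} (hij : i ≠ j) {t : ℝ}
    (ht : 0 ≤ t) :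
    ∫ x, ‖expI (symMat x) t i j - ∫ y, expI (symMat y) t i j ∂(Measure.pi μ)‖ ^ 2
      ∂(Measure.pi μ) ≤ (N : ℝ)⁻¹ + 2 * N * (t ^ 4 * (4 * (3 * s ^ 2 + M))) := by
  have hN : (0 : ℝ) < N := by exact_mod_cast i.pos
  have hs := h.s_nonneg
  have hM := h.M_nonneg
  set K := t ^ 4 * (4 * (3 * s ^ 2 + M)) with hK
  have hK0 : 0 ≤ K := by positivity
  let F : (UpperPair N → ℝ) → ℂ := fun x => expI (symMat x) t i j
  have hFm : Measurable F := measurable_expI_symMat_comp continuous_id t i j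
  have hF1 : ∀ x, ‖F x‖ ≤ 1 := fun x => norm_expI_le_one (symMat_isSymm x) t i j
  -- The entries outside the special block are grouped by their smaller index, so block `a` is a
  -- part of row and column `a`. The labels `Sum.inl c` with `c ≠ i`, and `Sum.inr i`, `Sum.inr j`,
  -- are empty blocks; there `G = F` costs nothing.
  let β : UpperPair N → Fin N ⊕ Fin N := fun p =>
    if p.1.1 = i ∨ p.1.2 = i ∨ p.1.1 = j ∨ p.1.2 = j then Sum.inl i else Sum.inr p.1.1
  let G : Fin N ⊕ Fin N → (UpperPair N → ℝ) → ℂ := Sum.elim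
    (fun c => if c = i then fun _ => 0 else F)
    (fun a => if a = i ∨ a = j then F else fun x => expI (zeroRow a (symMat x)) t i j)
  have key := efronStein_blocks_complex (μ := μ) β hFm hF1 (G := G) ?_ ?_ ?_
  · refine key.trans ?_
    rw [Fintype.sum_sum_type]
    refine add_le_add ?_ ?_ |>.trans (b := ((N : ℝ)⁻¹ + N * K) + N * K) (by linarith)
    · rw [Finset.sum_eq_single i]
      · simpa [G, F] using! h.integral_norm_offDiag_le hij ht hN
      · intro c _ hc; simp [G, hc]
      · simp
    · have hb : ∀ a ∈ (Finset.univ : Finset (Fin N)),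
          ∫ x, ‖F x - G (Sum.inr a) x‖ ^ 2 ∂(Measure.pi μ) ≤ K := by
        intro a _
        by_cases ha : a = i ∨ a = j
        · simpa [G, ha] using hK0
        · have := h.integral_norm_sub_zeroRow_le (a := a) (i := i) (j := j)
            (fun e => ha (Or.inl e.symm)) (fun e => ha (Or.inr e.symm)) ht
          simpa [G, ha, F] using! this
      refine (Finset.sum_le_card_nsmul _ _ _ hb).trans (le_of_eq ?_)
      simp
  · rintro (c | a)
    · by_cases hc : c = i
      · simp [G, hc]
      · simpa [G, hc] using hFm
    · by_cases ha : a = i ∨ a = j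
      · simpa [G, ha] using hFm
      · simpa [G, ha] using measurable_expI_symMat_comp (continuous_zeroRow a) t i j
  · rintro (c | a) x
    · by_cases hc : c = i
      · simp [G, hc]
      · simpa [G, hc] using hF1 x
    · by_cases ha : a = i ∨ a = j
      · simpa [G, ha] using hF1 x
      · simpa [G, ha] using norm_expI_le_one (zeroRow_isSymm (symMat_isSymm x) a) t i j
  · rintro (c | a) x y hxy
    · by_cases hc : c = i
      · simp [G, hc]
      · have : x = y := by
          ext p; refine hxy p ?_
          simp only [β]; split_ifs <;> simp [Ne.symm hc]
        rw [this]
    · by_cases ha : a = i ∨ a = j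
      · have : x = y := by
          ext p; refine hxy p ?_
          simp only [β]
          split_ifs with hp
          · simp
          · rintro e
            simp only [Sum.inr.injEq] at e
            rw [e] at hp; tauto
        rw [this]
      · have : zeroRow a (symMat x) = zeroRow a (symMat y) := by
          refine zeroRow_symMat_congr fun p h1 h2 => hxy p ?_
          simp only [β]; split_ifs <;> simp [h1]
        simp [G, ha, this]

/-- A diagonal group entry is not small, so comparison with zero is impossible. The entries of row
`i` are separate blocks instead, each compared with its own deletion; the diagonal one costs only a
second moment, occurring once. -/
theorem variance_diag_le (h : EntryLaws μ s M d) (i : Fin N) {t : ℝ} (ht : 0 ≤ t) :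
    ∫ x, ‖expI (symMat x) t i i - ∫ y, expI (symMat y) t i i ∂(Measure.pi μ)‖ ^ 2
      ∂(Measure.pi μ) ≤ t ^ 2 * d + N * (2 * t ^ 4 * M) +
        3 * N * (t ^ 4 * (4 * (3 * s ^ 2 + M))) := by
  have hs := h.s_nonneg
  have hM := h.M_nonneg
  have hd := h.d_nonneg
  set K := t ^ 4 * (4 * (3 * s ^ 2 + M)) with hK
  have hK0 : 0 ≤ K := by positivity
  let F : (UpperPair N → ℝ) → ℂ := fun x => expI (symMat x) t i i
  have hFm : Measurable F := measurable_expI_symMat_comp continuous_id t i i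
  have hF1 : ∀ x, ‖F x‖ ≤ 1 := fun x => norm_expI_le_one (symMat_isSymm x) t i i
  -- `Sum.inl k` holds the single entry on the pair `{i, k}`; the entries that avoid `i` are grouped
  -- by their smaller index, and `Sum.inr i` is empty.
  let β : UpperPair N → Fin N ⊕ Fin N := fun p =>
    if p.1.1 = i then Sum.inl p.1.2 else if p.1.2 = i then Sum.inl p.1.1 else Sum.inr p.1.1
  let G : Fin N ⊕ Fin N → (UpperPair N → ℝ) → ℂ := Sum.elim
    (fun k x => expI (zeroEntry i k (symMat x)) t i i)
    (fun a => if a = i then F else fun x => expI (zeroRow a (symMat x)) t i i)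
  have key := efronStein_blocks_complex (μ := μ) β hFm hF1 (G := G) ?_ ?_ ?_
  · refine key.trans ?_
    rw [Fintype.sum_sum_type]
    refine (add_le_add (b := t ^ 2 * d + N * (2 * t ^ 4 * M + 2 * K)) (d := N * K) ?_ ?_).trans
      (by linarith)
    · rw [← Finset.add_sum_erase _ _ (Finset.mem_univ i)]
      refine add_le_add (h.integral_norm_sub_zeroEntry_diag_le i ht) ?_
      have hb : ∀ k ∈ (Finset.univ.erase i : Finset (Fin N)),
          ∫ x, ‖F x - G (Sum.inl k) x‖ ^ 2 ∂(Measure.pi μ) ≤ 2 * t ^ 4 * M + 2 * K := by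
        intro k hk
        have := h.integral_norm_sub_zeroEntry_le (Finset.ne_of_mem_erase hk) ht
        rw [hK, ← mul_assoc 2]
        exact this
      refine (Finset.sum_le_card_nsmul _ _ _ hb).trans ?_
      rw [nsmul_eq_mul]
      gcongr
      exact (Finset.card_le_univ _).trans (by simp)
    · have hb : ∀ a ∈ (Finset.univ : Finset (Fin N)),
          ∫ x, ‖F x - G (Sum.inr a) x‖ ^ 2 ∂(Measure.pi μ) ≤ K := by
        intro a _
        by_cases ha : a = i
        · simpa [G, ha] using hK0
        · have := h.integral_norm_sub_zeroRow_le (a := a) (i := i) (j := i)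
            (fun e => ha e.symm) (fun e => ha e.symm) ht
          simpa [G, ha, F] using! this
      refine (Finset.sum_le_card_nsmul _ _ _ hb).trans (le_of_eq ?_)
      simp
  · rintro (c | a)
    · exact measurable_expI_symMat_comp (continuous_zeroEntry i c) t i i
    · by_cases ha : a = i
      · simpa [G, ha] using hFm
      · simpa [G, ha] using measurable_expI_symMat_comp (continuous_zeroRow a) t i i
  · rintro (c | a) x
    · exact norm_expI_le_one (zeroEntry_isSymm (symMat_isSymm x) i c) t i i
    · by_cases ha : a = i
      · simpa [G, ha] using hF1 x
      · simpa [G, ha] using norm_expI_le_one (zeroRow_isSymm (symMat_isSymm x) a) t i i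
  · rintro (c | a) x y hxy
    · have : zeroEntry i c (symMat x) = zeroEntry i c (symMat y) := by
        ext a b
        simp only [zeroEntry, Matrix.of_apply, symMat_apply]
        split_ifs with hab
        · rfl
        · refine hxy _ ?_
          intro e
          apply hab
          simp only [β] at e
          rcases upperPair_cases a b with ⟨e1, e2⟩ | ⟨e1, e2⟩ <;> rw [e1, e2] at e <;>
            split_ifs at e with h1 h2 <;> simp_all
      simp [G, this]
    · by_cases ha : a = i
      · have : x = y := by
          ext p; refine hxy p ?_
          simp only [β]
          split_ifs with hp hp2
          · simp
          · simp
          · simpa [ha] using hp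
        rw [this]
      · have : zeroRow a (symMat x) = zeroRow a (symMat y) := by
          refine zeroRow_symMat_congr fun p h1 h2 => hxy p ?_
          simp only [β]; split_ifs <;> simp [h1]
        simp [G, ha, this]

end EntryLaws

namespace EntryLaws

variable {N : ℕ} {μ : UpperPair N → Measure ℝ} [∀ p, IsProbabilityMeasure (μ p)]

/-- The variance of the entries of the unitary group, at all times. -/
theorem variance_expI_le {σ σ₁ m₄ : ℝ}
    (h : EntryLaws μ (σ ^ 2 / N) (|m₄| / N ^ 2) (σ₁ ^ 2 / N)) (i j : Fin N) (t : ℝ) :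
    ∫ x, ‖expI (symMat x) t i j - ∫ y, expI (symMat y) t i j ∂(Measure.pi μ)‖ ^ 2
      ∂(Measure.pi μ) ≤
      (1 + σ₁ ^ 2 + 36 * σ ^ 4 + 14 * |m₄|) * (1 + 2 * |t|) ^ 4 / N := by
  -- For a symmetric matrix, reversing time conjugates every entry of the group, which leaves the
  -- variance unchanged.
  wlog ht : 0 ≤ t generalizing t
  · have h1 := this (-t) (by linarith)
    have e : ∀ x : UpperPair N → ℝ, expI (symMat x) (-t) i j = star (expI (symMat x) t i j) :=
      fun x => norm_expI_neg (symMat_isSymm x) t i j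
    simp only [e, abs_neg] at h1
    refine le_of_eq_of_le (integral_congr_ae (Eventually.of_forall fun x => ?_)) h1
    simp only
    have e2 : ∫ y, star (expI (symMat y) t i j) ∂(Measure.pi μ) =
        star (∫ y, expI (symMat y) t i j ∂(Measure.pi μ)) := integral_conj
    rw [e2, ← star_sub, norm_star]
  have hN : (0 : ℝ) < N := by exact_mod_cast i.pos
  have hm := abs_nonneg m₄
  rw [abs_of_nonneg ht]
  have p1 : 1 ≤ (1 + 2 * t) ^ 4 := one_le_pow₀ (by linarith)
  have p4 : t ^ 4 ≤ (1 + 2 * t) ^ 4 := pow_le_pow_left₀ ht (by linarith) 4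
  have p2 : t ^ 2 ≤ (1 + 2 * t) ^ 4 :=
    (pow_le_pow_left₀ ht (by linarith : t ≤ 1 + 2 * t) 2).trans
      (pow_le_pow_right₀ (by linarith) (by norm_num))
  have q1 := mul_le_mul_of_nonneg_left p2 (sq_nonneg σ₁)
  have q2 := mul_le_mul_of_nonneg_left p4 hm
  have q3 := mul_le_mul_of_nonneg_left p4 (show 0 ≤ σ ^ 4 by positivity)
  have r1 : 0 ≤ σ₁ ^ 2 * (1 + 2 * t) ^ 4 := by positivity
  have r2 : 0 ≤ |m₄| * (1 + 2 * t) ^ 4 := by positivity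
  have r3 : 0 ≤ σ ^ 4 * (1 + 2 * t) ^ 4 := by positivity
  by_cases hij : i = j
  · subst hij
    refine (h.variance_diag_le i ht).trans ?_
    rw [le_div_iff₀ hN]
    -- The diagonal case fixes the constants: `14 = 2 + 3·4` and `36 = 3·4·3`. The summand `1` of
    -- the final constant comes from the off-diagonal case.
    have e : (t ^ 2 * (σ₁ ^ 2 / N) + N * (2 * t ^ 4 * (|m₄| / N ^ 2)) +
        3 * N * (t ^ 4 * (4 * (3 * (σ ^ 2 / N) ^ 2 + |m₄| / N ^ 2)))) * N =
        t ^ 2 * σ₁ ^ 2 + 14 * t ^ 4 * |m₄| + 36 * t ^ 4 * σ ^ 4 := by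
      field_simp; ring
    rw [e]
    linarith
  · refine (h.variance_offDiag_le hij ht).trans ?_
    rw [le_div_iff₀ hN]
    have e : ((N : ℝ)⁻¹ + 2 * N * (t ^ 4 * (4 * (3 * (σ ^ 2 / N) ^ 2 + |m₄| / N ^ 2)))) * N =
        1 + 24 * t ^ 4 * σ ^ 4 + 8 * t ^ 4 * |m₄| := by
      field_simp; ring
    rw [e]
    linarith

end EntryLaws

/-! ### From the unitary group to functions in the Sobolev space -/

theorem lintegral_mul_sq_le {α : Type*} [MeasurableSpace α] {ν : Measure α} {f g : α → ENNReal}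
    (hf : AEMeasurable f ν) (hg : AEMeasurable g ν) :
    (∫⁻ a, f a * g a ∂ν) ^ 2 ≤ (∫⁻ a, f a ^ 2 ∂ν) * ∫⁻ a, g a ^ 2 ∂ν := by
  have h := ENNReal.lintegral_mul_le_Lp_mul_Lq ν (Real.HolderConjugate.two_two) hf hg
  simp only [Pi.mul_apply, ENNReal.rpow_two] at h
  calc _ ≤ ((∫⁻ a, f a ^ 2 ∂ν) ^ (1 / 2 : ℝ) * (∫⁻ a, g a ^ 2 ∂ν) ^ (1 / 2 : ℝ)) ^ 2 := by
        gcongr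
    _ = _ := by
      rw [mul_pow, ← ENNReal.rpow_natCast, ← ENNReal.rpow_natCast, ← ENNReal.rpow_mul,
        ← ENNReal.rpow_mul]
      norm_num

theorem integrable_fourierHat_mul_expI {s : ℝ} (hs : 1 / 2 < s) {f : ℝ → ℝ}
    (hf : MemSobolevH s f) {n : Type*} [Fintype n] [DecidableEq n] {X : Matrix n n ℝ}
    (hX : X.IsSymm) (i j : n) : Integrable fun k => fourierHat f k * expI X k i j :=
  (hf.integrable_fourierHat hs).mul_bdd (c := 1)
    (continuous_expI_apply X i j).aestronglyMeasurable
    (Eventually.of_forall fun k => norm_expI_le_one hX k i j)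

/-- Dominated convergence in the Fourier representation, with dominating function `|f̂|`. This
supplies the measurability of the entries of `f(X)`. -/
theorem continuous_cfc_symMat {s : ℝ} (hs : 1 / 2 < s) {f : ℝ → ℝ} (hc : Continuous f)
    (hf : MemSobolevH s f) {N : ℕ} (i j : Fin N) :
    Continuous fun x : UpperPair N → ℝ => (cfc f (symMat x) : Matrix (Fin N) (Fin N) ℝ) i j := by
  have h : Continuous fun x : UpperPair N → ℝ => ((√(2 * Real.pi))⁻¹ : ℝ) *
      ∫ k, fourierHat f k * expI (symMat x) k i j := by
    refine continuous_const.mul (continuous_of_dominated (bound := fun k => ‖fourierHat f k‖)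
      (fun x => (integrable_fourierHat_mul_expI hs hf (symMat_isSymm x) i j).1)
      (fun x => Eventually.of_forall fun k => ?_) (hf.integrable_fourierHat hs).norm
      (Eventually.of_forall fun k => ?_))
    · rw [norm_mul]
      exact mul_le_of_le_one_right (norm_nonneg _) (norm_expI_le_one (symMat_isSymm x) k i j)
    · exact continuous_const.mul
        (continuous_expI_apply_comp continuous_symMat continuous_const i j)
  refine (Complex.continuous_re.comp h).congr fun x => ?_
  simp only [Function.comp_apply]
  rw [← hf.cfc_apply hs hc (symMat_isSymm x), Complex.ofReal_re]

theorem abs_cfc_le {s : ℝ} (hs : 1 / 2 < s) {f : ℝ → ℝ} (hc : Continuous f)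
    (hf : MemSobolevH s f) {n : Type*} [Fintype n] [DecidableEq n] {X : Matrix n n ℝ}
    (hX : X.IsSymm) (i j : n) :
    |(cfc f X : Matrix n n ℝ) i j| ≤ (√(2 * Real.pi))⁻¹ * ∫ k, ‖fourierHat f k‖ := by
  rw [← Real.norm_eq_abs, ← Complex.norm_real, hf.cfc_apply hs hc hX, norm_mul, Complex.norm_real,
    Real.norm_of_nonneg (by positivity)]
  gcongr
  refine norm_integral_le_of_norm_le (hf.integrable_fourierHat hs).norm
    (Eventually.of_forall fun k => ?_)
  rw [norm_mul]
  exact mul_le_of_le_one_right (norm_nonneg _) (norm_expI_le_one hX k i j)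

set_option maxHeartbeats 800000 in
/-- The variance of an entry of `f(X)` from that of the entries of the unitary group. -/
theorem EntryLaws.variance_cfc_le {N : ℕ} {μ : UpperPair N → Measure ℝ}
    [∀ p, IsProbabilityMeasure (μ p)] {σ σ₁ m₄ : ℝ}
    (h : EntryLaws μ (σ ^ 2 / N) (|m₄| / N ^ 2) (σ₁ ^ 2 / N)) {s : ℝ} (hs : 3 < s) {f : ℝ → ℝ}
    (hc : Continuous f) (hf : MemSobolevH s f) (i j : Fin N) :
    MemLp (fun x : UpperPair N → ℝ => (cfc f (symMat x) : Matrix (Fin N) (Fin N) ℝ) i j) 2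
        (Measure.pi μ) ∧
      variance (fun x : UpperPair N → ℝ => (cfc f (symMat x) : Matrix (Fin N) (Fin N) ℝ) i j)
        (Measure.pi μ) ≤ (1 + σ₁ ^ 2 + 36 * σ ^ 4 + 14 * |m₄|) *
          (∫ k : ℝ, (1 + 2 * |k|) ^ (-(2 * s - 4))) * sobolevNormSq s f / N := by
  have hs2 : 1 / 2 < s := by linarith
  have hN : (0 : ℝ) < N := by exact_mod_cast i.pos
  set π := Measure.pi μ with hπ
  set A : ℝ := 1 + σ₁ ^ 2 + 36 * σ ^ 4 + 14 * |m₄| with hA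
  have hA0 : 0 ≤ A := by positivity
  set Y : (UpperPair N → ℝ) → ℝ := fun x => (cfc f (symMat x) : Matrix (Fin N) (Fin N) ℝ) i j
    with hY
  have hYc : Continuous Y := continuous_cfc_symMat hs2 hc hf i j
  have hYL : ∀ p, MemLp Y p π := fun p =>
    MemLp.of_bound hYc.aestronglyMeasurable ((√(2 * Real.pi))⁻¹ * ∫ k, ‖fourierHat f k‖)
      (Eventually.of_forall fun x => abs_cfc_le hs2 hc hf (symMat_isSymm x) i j)
  refine ⟨hYL 2, ?_⟩
  let U : (UpperPair N → ℝ) → ℝ → ℂ := fun x k => expI (symMat x) k i j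
  have hUc : Continuous fun z : (UpperPair N → ℝ) × ℝ => U z.1 z.2 :=
    continuous_expI_apply_comp (continuous_symMat.comp continuous_fst) continuous_snd i j
  have hU1 : ∀ x k, ‖U x k‖ ≤ 1 := fun x k => norm_expI_le_one (symMat_isSymm x) k i j
  let u : ℝ → ℂ := fun k => ∫ y, U y k ∂π
  have hum : StronglyMeasurable u := by
    have : StronglyMeasurable (fun z : ℝ × (UpperPair N → ℝ) => U z.2 z.1) :=
      (hUc.comp continuous_swap).stronglyMeasurable
    exact this.integral_prod_right
  have hu1 : ∀ k, ‖u k‖ ≤ 1 := fun k => by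
    have := norm_integral_le_of_norm_le_const (μ := π) (f := fun y => U y k) (C := 1)
      (Eventually.of_forall fun y => hU1 y k)
    simpa using! this
  let c : ℝ := (√(2 * Real.pi))⁻¹
  have hc0 : 0 ≤ c := by positivity
  have hc1 : c ^ 2 ≤ 1 := by
    have h2 : (1 : ℝ) ≤ √(2 * Real.pi) := by
      rw [Real.one_le_sqrt]; linarith [Real.pi_gt_three]
    have h3 : c ≤ 1 := inv_le_one_of_one_le₀ h2
    nlinarith
  have hfu : Integrable fun k => fourierHat f k * u k :=
    (hf.integrable_fourierHat hs2).mul_bdd (c := 1) hum.aestronglyMeasurable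
      (Eventually.of_forall hu1)
  -- By Fubini this should be the mean of `Y`, but that need not be checked: the variance is at most
  -- the mean square distance to any constant.
  set m : ℝ := ((c : ℂ) * ∫ k, fourierHat f k * u k).re with hm
  let D : (UpperPair N → ℝ) → ℝ → ℂ := fun x k => U x k - u k
  have hDm : Measurable fun z : (UpperPair N → ℝ) × ℝ => D z.1 z.2 :=
    hUc.measurable.sub (hum.measurable.comp measurable_snd)
  have hYm : ∀ x, |Y x - m| ≤ c * ‖∫ k, fourierHat f k * D x k‖ := by
    intro x
    have e1 : (Y x : ℂ) = (c : ℂ) * ∫ k, fourierHat f k * U x k :=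
      hf.cfc_apply hs2 hc (symMat_isSymm x) i j
    have e2 : Y x - m = ((c : ℂ) * ∫ k, fourierHat f k * D x k).re := by
      have e3 : ∫ k, fourierHat f k * D x k =
          (∫ k, fourierHat f k * U x k) - ∫ k, fourierHat f k * u k := by
        rw [← integral_sub (integrable_fourierHat_mul_expI hs2 hf (symMat_isSymm x) i j) hfu]
        exact integral_congr_ae (Eventually.of_forall fun k => by simp only [D]; ring)
      rw [e3, mul_sub, Complex.sub_re, ← e1, Complex.ofReal_re]
    rw [e2]
    refine (Complex.abs_re_le_norm _).trans ?_
    rw [norm_mul, Complex.norm_real, Real.norm_of_nonneg hc0]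
  let w : ℝ → ℝ := fun k => 1 + 2 * |k|
  have hw : ∀ k, 0 < w k := fun k => by positivity
  have hwm : Measurable w := by fun_prop
  -- The weights `w^s` and `w^{-s}` are split so that Cauchy–Schwarz in `k` produces exactly the
  -- squared Sobolev norm as one factor.
  let a : ℝ → ENNReal := fun k => ENNReal.ofReal (w k ^ s * ‖fourierHat f k‖)
  let b : (UpperPair N → ℝ) → ℝ → ENNReal := fun x k => ENNReal.ofReal (w k ^ (-s) * ‖D x k‖)
  have ham : AEMeasurable a volume :=
    ((hwm.pow_const s).aemeasurable.mul
      (aestronglyMeasurable_fourierHat f).norm.aemeasurable).ennreal_ofReal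
  have hbm : Measurable fun z : (UpperPair N → ℝ) × ℝ => b z.1 z.2 :=
    (((hwm.pow_const (-s)).comp measurable_snd).mul hDm.norm).ennreal_ofReal
  have hbx : ∀ x, Measurable (b x) := fun x => hbm.comp (measurable_const.prodMk measurable_id)
  have ha2 : ∫⁻ k, a k ^ 2 = ENNReal.ofReal (sobolevNormSq s f) := by
    rw [sobolevNormSq, ofReal_integral_eq_lintegral_ofReal hf.2]
    · refine lintegral_congr fun k => ?_
      simp only [a, sobolevDensity]
      rw [← ENNReal.ofReal_pow (by have := Real.rpow_nonneg (hw k).le s; positivity), mul_pow,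
        ← Real.rpow_natCast (w k ^ s), ← Real.rpow_mul (hw k).le]
      congr 3
      push_cast; ring
    · exact Eventually.of_forall fun k => by
        have := Real.rpow_nonneg (hw k).le (2 * s)
        exact mul_nonneg this (by positivity)
  have hCS : ∀ x, ENNReal.ofReal ((Y x - m) ^ 2) ≤
      ENNReal.ofReal (sobolevNormSq s f) * ∫⁻ k, b x k ^ 2 := by
    intro x
    have e1 : (Y x - m) ^ 2 ≤ ‖∫ k, fourierHat f k * D x k‖ ^ 2 := by
      rw [← sq_abs]
      calc |Y x - m| ^ 2 ≤ (c * ‖∫ k, fourierHat f k * D x k‖) ^ 2 := by gcongr; exact hYm x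
        _ = c ^ 2 * ‖∫ k, fourierHat f k * D x k‖ ^ 2 := by ring
        _ ≤ _ := mul_le_of_le_one_left (by positivity) hc1
    have e2 : ENNReal.ofReal ‖∫ k, fourierHat f k * D x k‖ ≤ ∫⁻ k, a k * b x k := by
      rw [ofReal_norm]
      refine (enorm_integral_le_lintegral_enorm _).trans (le_of_eq ?_)
      refine lintegral_congr fun k => ?_
      simp only [a, b]
      rw [← ENNReal.ofReal_mul (by have := Real.rpow_nonneg (hw k).le s; positivity),
        ← ofReal_norm, norm_mul]
      congr 1
      have : w k ^ s * w k ^ (-s) = 1 := by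
        rw [← Real.rpow_add (hw k)]; simp
      calc _ = (w k ^ s * w k ^ (-s)) * (‖fourierHat f k‖ * ‖D x k‖) := by rw [this, one_mul]
        _ = _ := by ring
    calc _ ≤ ENNReal.ofReal (‖∫ k, fourierHat f k * D x k‖ ^ 2) := ENNReal.ofReal_le_ofReal e1
      _ = (ENNReal.ofReal ‖∫ k, fourierHat f k * D x k‖) ^ 2 :=
          ENNReal.ofReal_pow (norm_nonneg _) 2
      _ ≤ (∫⁻ k, a k * b x k) ^ 2 := by gcongr
      _ ≤ _ := by
        rw [← ha2]
        exact lintegral_mul_sq_le ham (hbx x).aemeasurable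
  have hb2 : ∀ k, ∫⁻ x, b x k ^ 2 ∂π ≤
      ENNReal.ofReal (A / N) * ENNReal.ofReal ((1 + 2 * |k|) ^ (-(2 * s - 4))) := by
    intro k
    have hDb : ∀ x, ‖D x k‖ ^ 2 ≤ 4 := fun x => by
      have : ‖D x k‖ ≤ 2 := (norm_sub_le _ _).trans (by linarith [hU1 x k, hu1 k])
      nlinarith [norm_nonneg (D x k)]
    have hDk : Measurable fun x => D x k := hDm.comp (measurable_id.prodMk measurable_const)
    have hDi : Integrable (fun x => ‖D x k‖ ^ 2) π :=
      Integrable.of_bound (hDk.norm.pow_const 2).aestronglyMeasurable 4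
        (Eventually.of_forall fun x => by
          rw [Real.norm_of_nonneg (by positivity)]; exact hDb x)
    have hwk : 0 ≤ w k ^ (-(2 * s)) := Real.rpow_nonneg (hw k).le _
    have e1 : ∀ x, b x k ^ 2 = ENNReal.ofReal (w k ^ (-(2 * s)) * ‖D x k‖ ^ 2) := by
      intro x
      simp only [b]
      rw [← ENNReal.ofReal_pow (by have := Real.rpow_nonneg (hw k).le (-s); positivity), mul_pow,
        ← Real.rpow_natCast (w k ^ (-s)), ← Real.rpow_mul (hw k).le]
      congr 3
      push_cast; ring
    simp only [e1]
    rw [← ofReal_integral_eq_lintegral_ofReal (hDi.const_mul _)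
      (Eventually.of_forall fun x => by positivity), integral_const_mul,
      ← ENNReal.ofReal_mul (by positivity)]
    refine ENNReal.ofReal_le_ofReal ?_
    -- The group variance grows like the fourth power of `w`, which leaves `w^{4-2s}`; this is
    -- integrable since `s > 3` gives `2s - 4 > 1`.
    have e2 : (1 + 2 * |k|) ^ (-(2 * s - 4)) = w k ^ (-(2 * s)) * w k ^ 4 := by
      rw [← Real.rpow_natCast (w k) 4, ← Real.rpow_add (hw k)]
      congr 1; push_cast; ring
    have e3 := mul_le_mul_of_nonneg_left (h.variance_expI_le i j k) hwk
    refine e3.trans (le_of_eq ?_)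
    rw [e2]
    simp only [w, hA]
    ring
  have hwi : Integrable fun k : ℝ => (1 + 2 * |k|) ^ (-(2 * s - 4)) :=
    integrable_sobolev_weight (by linarith)
  have hwn : ∀ k : ℝ, 0 ≤ (1 + 2 * |k|) ^ (-(2 * s - 4)) := fun k =>
    Real.rpow_nonneg (hw k).le _
  have hSn : 0 ≤ sobolevNormSq s f := integral_nonneg fun k =>
    mul_nonneg (Real.rpow_nonneg (hw k).le _) (by positivity)
  have htot : ∫⁻ x, ENNReal.ofReal ((Y x - m) ^ 2) ∂π ≤ ENNReal.ofReal
      (A * (∫ k : ℝ, (1 + 2 * |k|) ^ (-(2 * s - 4))) * sobolevNormSq s f / N) := by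
    calc _ ≤ ∫⁻ x, ENNReal.ofReal (sobolevNormSq s f) * (∫⁻ k, b x k ^ 2) ∂π := lintegral_mono hCS
      _ = ENNReal.ofReal (sobolevNormSq s f) * ∫⁻ x, (∫⁻ k, b x k ^ 2) ∂π :=
          lintegral_const_mul' _ _ ENNReal.ofReal_ne_top
      _ = ENNReal.ofReal (sobolevNormSq s f) * ∫⁻ k, (∫⁻ x, b x k ^ 2 ∂π) := by
          rw [lintegral_lintegral_swap]
          exact (hbm.pow_const 2).aemeasurable
      _ ≤ ENNReal.ofReal (sobolevNormSq s f) * ∫⁻ k : ℝ, (ENNReal.ofReal (A / N) *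
            ENNReal.ofReal ((1 + 2 * |k|) ^ (-(2 * s - 4)))) := by
          gcongr with k; exact hb2 k
      _ = _ := by
          rw [lintegral_const_mul' _ _ ENNReal.ofReal_ne_top,
            ← ofReal_integral_eq_lintegral_ofReal hwi (Eventually.of_forall hwn),
            ← ENNReal.ofReal_mul (by positivity), ← ENNReal.ofReal_mul hSn]
          congr 1; ring
  have hint_eq : Integrable (fun x => (Y x - m) ^ 2) π := ((hYL 2).sub (memLp_const m)).integrable_sq
  have hvar : variance Y π ≤ ∫ x, (Y x - m) ^ 2 ∂π := by
    rw [← variance_sub_const hYc.aestronglyMeasurable m]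
    exact variance_le_expectation_sq (hYc.sub continuous_const).aestronglyMeasurable
  refine hvar.trans ?_
  rw [← ENNReal.ofReal_le_ofReal_iff, ofReal_integral_eq_lintegral_ofReal hint_eq
    (Eventually.of_forall fun x => sq_nonneg _)]
  · exact htot
  · have := integral_nonneg (μ := volume) (f := fun k : ℝ => (1 + 2 * |k|) ^ (-(2 * s - 4))) hwn
    positivity

/-- The constant in the variance bound. -/
noncomputable def varianceConst (σ σ₁ m₄ s : ℝ) : ℝ :=
  (1 + σ₁ ^ 2 + 36 * σ ^ 4 + 14 * |m₄|) * ∫ k : ℝ, (1 + 2 * |k|) ^ (-(2 * s - 4))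

/-- The variance of the entries of regular functions of Wigner matrices. -/
theorem IsRealWigner.variance_matrixFunEntry_le {Ω : Type u} [MeasurableSpace Ω] {P : Measure Ω}
    [IsProbabilityMeasure P] {T : (N : ℕ) → Ω → Matrix (Fin N) (Fin N) ℝ} {σ σ₁ m₄ : ℝ}
    (hT : IsRealWigner P T σ σ₁ m₄) {s : ℝ} (hs : 3 < s) {f : ℝ → ℝ} (hc : Continuous f)
    (hf : MemSobolevH s f) (N : ℕ) (i j : Fin N) :
    MemLp (fun ω => matrixFunEntry f (T N ω) i j) 2 P ∧
      variance (fun ω => matrixFunEntry f (T N ω) i j) P ≤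
        varianceConst σ σ₁ m₄ s * sobolevNormSq s f / N := by
  have hN : (0 : ℝ) < N := by exact_mod_cast i.pos
  set c : ℝ := (√(N : ℝ))⁻¹ with hcdef
  have hc2 : c ^ 2 = (N : ℝ)⁻¹ := by rw [hcdef, inv_pow, Real.sq_sqrt hN.le]
  have hc4 : c ^ 4 = ((N : ℝ) ^ 2)⁻¹ := by
    rw [show c ^ 4 = (c ^ 2) ^ 2 by ring, hc2, inv_pow]
  -- The entries scaled by `N^{-1/2}` have second moments of order `1/N` and, off the diagonal,
  -- fourth moments of order `N⁻²`; by independence their joint law is a product measure, so the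
  -- estimates above apply.
  let y : UpperPair N → Ω → ℝ := fun p ω => c * T N ω p.1.1 p.1.2
  have hym : ∀ p, Measurable (y p) := fun p => (hT.measurable N _ _).const_mul c
  have hyi : iIndepFun y P := (hT.indep N).comp (fun _ r => c * r) fun _ => by fun_prop
  let μ : UpperPair N → Measure ℝ := fun p => P.map (y p)
  have hμ : ∀ p, IsProbabilityMeasure (μ p) := fun p =>
    Measure.isProbabilityMeasure_map (hym p).aemeasurable
  let Z : Ω → UpperPair N → ℝ := fun ω p => y p ω
  have hZm : Measurable Z := measurable_pi_lambda _ hym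
  have hZ : P.map Z = Measure.pi μ := hyi.map_fun_eq_pi_map fun p => (hym p).aemeasurable
  have hint_eq : ∀ p (g : ℝ → ℝ), Measurable g → ∫ r, g r ∂(μ p) = ∫ ω, g (y p ω) ∂P :=
    fun p g hg => integral_map (hym p).aemeasurable hg.aestronglyMeasurable
  have hlaws : EntryLaws μ (σ ^ 2 / N) (|m₄| / N ^ 2) (σ₁ ^ 2 / N) := by
    refine ⟨by positivity, by positivity, by positivity, ?_, ?_, ?_, ?_, ?_, ?_⟩
    · intro p hp
      refine (memLp_map_measure_iff aestronglyMeasurable_id (hym p).aemeasurable).2 ?_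
      exact (hT.memLp_offDiag N _ _ hp).const_mul c
    · intro p hp
      rw [hint_eq p (fun r => r) measurable_id]
      simp only [y]
      rw [integral_const_mul, hT.mean_offDiag N _ _ hp, mul_zero]
    · intro p hp
      rw [hint_eq p (fun r => r ^ 2) (by fun_prop)]
      simp only [y, mul_pow]
      have hv := hT.variance_offDiag N _ _ hp
      rw [variance_of_integral_eq_zero (hT.measurable N _ _).aemeasurable
        (hT.mean_offDiag N _ _ hp)] at hv
      rw [integral_const_mul, hv, hc2, div_eq_inv_mul]
    · intro p hp
      rw [hint_eq p (fun r => r ^ 4) (by fun_prop)]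
      simp only [y, mul_pow]
      rw [integral_const_mul, hc4, div_eq_inv_mul]
      have := (hT.fourth_moment_le N _ _ hp).trans (le_abs_self m₄)
      gcongr
    · intro p hp
      refine (memLp_map_measure_iff aestronglyMeasurable_id (hym p).aemeasurable).2 ?_
      have h2 := (hT.memLp_diag N p.1.1).const_mul c
      have e : (id ∘ y p) = fun ω => c * T N ω p.1.1 p.1.1 := by
        ext ω; simp [y, ← hp]
      rw [e]; exact h2
    · intro p hp
      rw [hint_eq p (fun r => r ^ 2) (by fun_prop)]
      simp only [y, mul_pow, ← hp]
      rw [integral_const_mul, hc2, div_eq_inv_mul]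
      have := hT.second_moment_le N p.1.1
      gcongr
  obtain ⟨h1, h2⟩ := hlaws.variance_cfc_le hs hc hf i j
  have hX : ∀ ω, (c • T N ω) = symMat (Z ω) := by
    intro ω
    ext j k
    rw [symMat_apply, Matrix.smul_apply, smul_eq_mul]
    simp only [Z, y]
    rcases upperPair_cases j k with ⟨e1, e2⟩ | ⟨e1, e2⟩ <;> rw [e1, e2]
    rw [(hT.symm N ω).apply j k]
  have hfun : (fun ω => matrixFunEntry f (T N ω) i j) =
      (fun x : UpperPair N → ℝ => (cfc f (symMat x) : Matrix (Fin N) (Fin N) ℝ) i j) ∘ Z := by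
    ext ω
    simp only [matrixFunEntry, Function.comp_apply, ← hX, hcdef]
  rw [hfun]
  rw [← hZ] at h1 h2
  refine ⟨(memLp_map_measure_iff h1.1 hZm.aemeasurable).1 h1, ?_⟩
  rw [variance_map h1.1.aemeasurable hZm.aemeasurable] at h2
  exact h2

/-! ### Truncation and the three-point correction -/

/-- Truncation of a real number at level `K`. -/
noncomputable def truncAt (K x : ℝ) : ℝ := if |x| ≤ K then x else 0

/-- Projection of a real number to `[-K, K]`. -/
noncomputable def clampAt (K x : ℝ) : ℝ := max (-K) (min K x)

theorem measurable_truncAt (K : ℝ) : Measurable (truncAt K) :=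
  Measurable.ite (measurableSet_le (by fun_prop) measurable_const) measurable_id measurable_const

theorem measurable_clampAt (K : ℝ) : Measurable (clampAt K) := by
  unfold clampAt; fun_prop

theorem abs_truncAt_le {K : ℝ} (hK : 0 ≤ K) (x : ℝ) : |truncAt K x| ≤ K := by
  unfold truncAt; split_ifs with h
  · exact h
  · simpa using hK

theorem abs_truncAt_le_abs (K x : ℝ) : |truncAt K x| ≤ |x| := by
  unfold truncAt; split_ifs <;> simp

theorem abs_clampAt_le {K : ℝ} (hK : 0 ≤ K) (x : ℝ) : |clampAt K x| ≤ K := by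
  rw [abs_le, clampAt]
  exact ⟨le_max_left _ _, max_le (by linarith) (min_le_left _ _)⟩

theorem clampAt_self {K : ℝ} (hK : 0 ≤ K) : clampAt K K = K := by
  simp [clampAt]; linarith

theorem clampAt_neg {K : ℝ} (hK : 0 ≤ K) : clampAt K (-K) = -K := by
  simp [clampAt, hK]

theorem clampAt_zero {K : ℝ} (hK : 0 ≤ K) : clampAt K 0 = 0 := by
  simp [clampAt, hK]

/-- The law on `{-K, 0, K}` with mean `a` and second moment `q`. -/
noncomputable def threePoint (K a q : ℝ) : Measure ℝ :=
  ENNReal.ofReal ((q / K ^ 2 + a / K) / 2) • Measure.dirac K +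
    ENNReal.ofReal ((q / K ^ 2 - a / K) / 2) • Measure.dirac (-K) +
      ENNReal.ofReal (1 - q / K ^ 2) • Measure.dirac 0

section ThreePoint

variable {K a q : ℝ}

/-- The two conditions on `a` and `q` are exactly what makes the weights at `±K` and at `0`
nonnegative. -/
theorem threePoint_weights (hK : 0 < K) (ha : |a| * K ≤ q) (hq : q ≤ K ^ 2) :
    0 ≤ (q / K ^ 2 + a / K) / 2 ∧ 0 ≤ (q / K ^ 2 - a / K) / 2 ∧ 0 ≤ 1 - q / K ^ 2 := by
  have h1 : |a / K| ≤ q / K ^ 2 := by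
    rw [abs_div, abs_of_pos hK, div_le_div_iff₀ hK (by positivity)]
    nlinarith
  have h2 := abs_le.1 h1
  refine ⟨by linarith [h2.1], by linarith [h2.2], ?_⟩
  rw [sub_nonneg, div_le_one (by positivity)]
  exact hq

theorem isProbabilityMeasure_threePoint (hK : 0 < K) (ha : |a| * K ≤ q) (hq : q ≤ K ^ 2) :
    IsProbabilityMeasure (threePoint K a q) := by
  obtain ⟨h1, h2, h3⟩ := threePoint_weights hK ha hq
  constructor
  simp only [threePoint, Measure.add_apply, Measure.smul_apply, measure_univ, smul_eq_mul, mul_one]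
  rw [← ENNReal.ofReal_add h1 h2, ← ENNReal.ofReal_add (by linarith) h3, ← ENNReal.ofReal_one]
  congr 1; ring

theorem integral_threePoint (hK : 0 < K) (ha : |a| * K ≤ q) (hq : q ≤ K ^ 2) (g : ℝ → ℝ) :
    ∫ x, g x ∂(threePoint K a q) = (q / K ^ 2 + a / K) / 2 * g K +
      (q / K ^ 2 - a / K) / 2 * g (-K) + (1 - q / K ^ 2) * g 0 := by
  obtain ⟨h1, h2, h3⟩ := threePoint_weights hK ha hq
  have hi : ∀ (c y : ℝ), Integrable g (ENNReal.ofReal c • Measure.dirac y) := fun c y =>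
    (integrable_dirac (by simp)).smul_measure ENNReal.ofReal_ne_top
  rw [threePoint, integral_add_measure ((hi _ _).add_measure (hi _ _)) (hi _ _),
    integral_add_measure (hi _ _) (hi _ _)]
  simp only [integral_smul_measure, integral_dirac, smul_eq_mul]
  rw [ENNReal.toReal_ofReal h1, ENNReal.toReal_ofReal h2, ENNReal.toReal_ofReal h3]

theorem threePoint_ne_zero (hK : 0 < K) (ha : |a| * K ≤ q) (hq : q ≤ K ^ 2) :
    threePoint K a q {0}ᶜ = ENNReal.ofReal (q / K ^ 2) := by
  obtain ⟨h1, h2, h3⟩ := threePoint_weights hK ha hq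
  simp only [threePoint, Measure.add_apply, Measure.smul_apply, smul_eq_mul]
  rw [Measure.dirac_apply_of_mem (by simpa using hK.ne'),
    Measure.dirac_apply_of_mem (by simpa using hK.ne'),
    Measure.dirac_apply' _ (MeasurableSet.singleton _).compl]
  simp only [mul_one, Set.mem_compl_iff, Set.mem_singleton_iff, not_true_eq_false,
    not_false_eq_true, Set.indicator_of_notMem, mul_zero, add_zero]
  rw [← ENNReal.ofReal_add h1 h2]
  congr 1; ring

end ThreePoint

section Truncation

variable {Ω : Type*} [MeasurableSpace Ω]

/-- The mean that has to be added to the truncation of a centered variable. -/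
noncomputable def meanDefect (P : Measure Ω) (X : Ω → ℝ) (K : ℝ) : ℝ :=
  -∫ ω, truncAt K (X ω) ∂P

/-- The second moment removed by a truncation. -/
noncomputable def secondDefect (P : Measure Ω) (X : Ω → ℝ) (K : ℝ) : ℝ :=
  ∫ ω, X ω ^ 2 ∂P - ∫ ω, truncAt K (X ω) ^ 2 ∂P

/-- The law of the independent correction of a truncated variable. -/
noncomputable def correctionLaw (P : Measure Ω) (X : Ω → ℝ) (K : ℝ) : Measure ℝ :=
  threePoint K (meanDefect P X K) (secondDefect P X K + 2 * meanDefect P X K ^ 2)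

theorem secondDefect_le (P : Measure Ω) (X : Ω → ℝ) (K : ℝ) :
    secondDefect P X K ≤ ∫ ω, X ω ^ 2 ∂P := by
  have : 0 ≤ ∫ ω, truncAt K (X ω) ^ 2 ∂P := integral_nonneg fun _ => sq_nonneg _
  rw [secondDefect]; linarith

variable {P : Measure Ω} [IsProbabilityMeasure P] {X : Ω → ℝ} {K : ℝ}

theorem memLp_truncAt (hX : Measurable X) (hK : 0 < K) (p : ENNReal) :
    MemLp (fun ω => truncAt K (X ω)) p P :=
  MemLp.of_bound ((measurable_truncAt K).comp hX).aestronglyMeasurable K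
    (Eventually.of_forall fun _ => abs_truncAt_le hK.le _)

/-- The truncation and the removed part live on disjoint events, so their squares add up to `X²`. -/
theorem secondDefect_eq (hX : Measurable X) (h2 : MemLp X 2 P) (hK : 0 < K) :
    secondDefect P X K = ∫ ω, (X ω - truncAt K (X ω)) ^ 2 ∂P := by
  rw [secondDefect, ← integral_sub h2.integrable_sq (memLp_truncAt hX hK 2).integrable_sq]
  refine integral_congr_ae (Eventually.of_forall fun _ => ?_)
  simp only [truncAt]; split_ifs <;> simp

theorem secondDefect_nonneg (hX : Measurable X) (h2 : MemLp X 2 P) (hK : 0 < K) :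
    0 ≤ secondDefect P X K := by
  rw [secondDefect_eq hX h2 hK]; exact integral_nonneg fun _ => sq_nonneg _

theorem sq_integral_le_integral_sq {Y : Ω → ℝ} (hY : MemLp Y 2 P) :
    (∫ ω, Y ω ∂P) ^ 2 ≤ ∫ ω, Y ω ^ 2 ∂P := by
  have h := variance_nonneg Y P
  rw [variance_eq_sub hY] at h
  simpa using h

theorem meanDefect_eq (hX : Measurable X) (h2 : MemLp X 2 P) (h0 : ∫ ω, X ω ∂P = 0)
    (hK : 0 < K) : meanDefect P X K = ∫ ω, (X ω - truncAt K (X ω)) ∂P := by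
  rw [integral_sub (h2.integrable (by norm_num)) ((memLp_truncAt hX hK 1).integrable le_rfl), h0,
    meanDefect, zero_sub]

theorem meanDefect_sq_le (hX : Measurable X) (h2 : MemLp X 2 P) (h0 : ∫ ω, X ω ∂P = 0)
    (hK : 0 < K) : meanDefect P X K ^ 2 ≤ secondDefect P X K := by
  rw [meanDefect_eq hX h2 h0 hK, secondDefect_eq hX h2 hK]
  exact sq_integral_le_integral_sq (h2.sub (memLp_truncAt hX hK 2))

theorem meanDefect_sq_le' (hX : Measurable X) (hK : 0 < K) :
    meanDefect P X K ^ 2 ≤ ∫ ω, truncAt K (X ω) ^ 2 ∂P := by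
  rw [meanDefect, neg_sq]
  exact sq_integral_le_integral_sq (memLp_truncAt hX hK 2)

/-- The removed part is either zero or larger than `K` in modulus, so `K` times its modulus is at
most its square. -/
theorem abs_meanDefect_mul_le (hX : Measurable X) (h2 : MemLp X 2 P) (h0 : ∫ ω, X ω ∂P = 0)
    (hK : 0 < K) : |meanDefect P X K| * K ≤ secondDefect P X K := by
  rw [meanDefect_eq hX h2 h0 hK, secondDefect_eq hX h2 hK]
  have hd := h2.sub (memLp_truncAt (P := P) hX hK 2)
  calc _ ≤ (∫ ω, |X ω - truncAt K (X ω)| ∂P) * K := by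
        gcongr; exact abs_integral_le_integral_abs
    _ = ∫ ω, |X ω - truncAt K (X ω)| * K ∂P := (integral_mul_const _ _).symm
    _ ≤ _ := by
      refine integral_mono ((hd.integrable (by norm_num)).abs.mul_const K) hd.integrable_sq
        fun ω => ?_
      simp only
      unfold truncAt
      split_ifs with h
      · simp
      · rw [sub_zero, ← sq_abs]; push Not at h
        nlinarith [abs_nonneg (X ω)]

/-- With `a` the mean defect and `τ` the second defect, `a²` is at most `τ` and also at most the
truncated second moment `E X² - τ`. Adding gives `2a² ≤ E X²`, so `τ + 2a² ≤ 2 E X² ≤ K²`. -/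
theorem correction_conditions (hX : Measurable X) (h2 : MemLp X 2 P) (h0 : ∫ ω, X ω ∂P = 0)
    (hK : 0 < K) (hK2 : 2 * ∫ ω, X ω ^ 2 ∂P ≤ K ^ 2) :
    |meanDefect P X K| * K ≤ secondDefect P X K + 2 * meanDefect P X K ^ 2 ∧
      secondDefect P X K + 2 * meanDefect P X K ^ 2 ≤ K ^ 2 := by
  have h1 := abs_meanDefect_mul_le hX h2 h0 hK
  have h3 := meanDefect_sq_le hX h2 h0 hK
  have h4 := meanDefect_sq_le' (P := P) hX hK
  refine ⟨by nlinarith [sq_nonneg (meanDefect P X K)], ?_⟩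
  rw [secondDefect] at h3 ⊢
  have h5 : 0 ≤ ∫ ω, truncAt K (X ω) ^ 2 ∂P := integral_nonneg fun _ => sq_nonneg _
  linarith

theorem isProbabilityMeasure_correctionLaw (hX : Measurable X) (h2 : MemLp X 2 P)
    (h0 : ∫ ω, X ω ∂P = 0) (hK : 0 < K) (hK2 : 2 * ∫ ω, X ω ^ 2 ∂P ≤ K ^ 2) :
    IsProbabilityMeasure (correctionLaw P X K) :=
  isProbabilityMeasure_threePoint hK (correction_conditions hX h2 h0 hK hK2).1
    (correction_conditions hX h2 h0 hK hK2).2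

/-- On the event where something is removed, `K² X² ≤ X⁴`. This is the link between the defect and
the truncated fourth moments of the Lindeberg condition. -/
theorem sq_mul_secondDefect_le (hX : Measurable X) (h4 : MemLp X 4 P) (hK : 0 < K) :
    K ^ 2 * secondDefect P X K ≤ ∫ ω in {ω | K ≤ |X ω|}, |X ω| ^ 4 ∂P := by
  have h2 : MemLp X 2 P := h4.mono_exponent (by norm_num)
  have hd := h2.sub (memLp_truncAt (P := P) hX hK 2)
  have hS : MeasurableSet {ω | K ≤ |X ω|} := measurableSet_le measurable_const hX.abs
  have hi : Integrable (fun ω => |X ω| ^ 4) P := by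
    have := h4.integrable_norm_pow'
    simpa using this
  rw [secondDefect_eq hX h2 hK, ← integral_const_mul, ← integral_indicator hS]
  refine integral_mono (hd.integrable_sq.const_mul _) (hi.indicator hS) fun ω => ?_
  simp only
  unfold truncAt
  split_ifs with h
  · simp only [sub_self, ne_eq, OfNat.ofNat_ne_zero, not_false_eq_true, zero_pow, mul_zero]
    exact Set.indicator_nonneg (fun _ _ => by positivity) _
  · push Not at h
    rw [Set.indicator_of_mem (show ω ∈ {ω | K ≤ |X ω|} from h.le), sub_zero, ← sq_abs (X ω)]
    calc K ^ 2 * |X ω| ^ 2 ≤ |X ω| ^ 2 * |X ω| ^ 2 := by gcongr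
      _ = _ := by ring

theorem setIntegral_pow_four_le (h4 : MemLp X 4 P) (S : Set Ω) :
    ∫ ω in S, |X ω| ^ 4 ∂P ≤ ∫ ω, X ω ^ 4 ∂P := by
  have hi : Integrable (fun ω => |X ω| ^ 4) P := by
    have := h4.integrable_norm_pow'
    simpa using this
  refine (setIntegral_le_integral hi (Eventually.of_forall fun _ => by positivity)).trans
    (le_of_eq (integral_congr_ae (Eventually.of_forall fun ω => ?_)))
  simp only
  rw [Even.pow_abs (by decide)]

theorem sq_mul_measure_lt_le (hX : Measurable X) (h2 : MemLp X 2 P) (hK : 0 < K) :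
    P {ω | K < |X ω|} ≤ ENNReal.ofReal (secondDefect P X K / K ^ 2) := by
  have hS : MeasurableSet {ω | K < |X ω|} := measurableSet_lt measurable_const hX.abs
  have hd := h2.sub (memLp_truncAt (P := P) hX hK 2)
  rw [← ENNReal.ofReal_toReal (measure_ne_top P _)]
  refine ENNReal.ofReal_le_ofReal ?_
  rw [le_div_iff₀ (by positivity), secondDefect_eq hX h2 hK]
  have : (P {ω | K < |X ω|}).toReal * K ^ 2 =
      ∫ ω, {ω | K < |X ω|}.indicator (fun _ => K ^ 2) ω ∂P := by
    rw [integral_indicator hS, setIntegral_const, smul_eq_mul]; rfl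
  rw [this]
  refine integral_mono ((integrable_const _).indicator hS) hd.integrable_sq fun ω => ?_
  by_cases h : K < |X ω|
  · rw [Set.indicator_of_mem (show ω ∈ {ω | K < |X ω|} from h)]
    simp only [truncAt, if_neg (not_le.2 h), sub_zero]
    rw [← sq_abs (X ω)]
    gcongr
  · rw [Set.indicator_of_notMem (show ω ∉ {ω | K < |X ω|} from h)]
    simp only
    positivity

/-- The truncated and corrected variable. -/
noncomputable def corrected (K x y : ℝ) : ℝ := truncAt K x + clampAt K y

theorem measurable_corrected (K : ℝ) : Measurable fun z : ℝ × ℝ => corrected K z.1 z.2 :=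
  ((measurable_truncAt K).comp measurable_fst).add ((measurable_clampAt K).comp measurable_snd)

theorem abs_corrected_le (hK : 0 < K) (x y : ℝ) : |corrected K x y| ≤ 2 * K :=
  (abs_add_le _ _).trans (by linarith [abs_truncAt_le hK.le x, abs_clampAt_le hK.le y])

/-- The truncated variable has mean `-a`, so independence makes the cross term in the second moment
equal to `-2a²`; a correction of mean `a` and second moment `τ + 2a²` compensates both defects. The
variable changes only if `|X| > K` or the correction is nonzero, with total probability at most `(2τ
+ 2a²)/K² ≤ 4τ/K²`. -/
theorem corrected_moments {ξ : Ω → ℝ} (hX : Measurable X) (hξ : Measurable ξ)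
    (hind : IndepFun X ξ P) (h2 : MemLp X 2 P) (h0 : ∫ ω, X ω ∂P = 0) (hK : 0 < K)
    (hK2 : 2 * ∫ ω, X ω ^ 2 ∂P ≤ K ^ 2) (hlaw : P.map ξ = correctionLaw P X K) :
    ∫ ω, corrected K (X ω) (ξ ω) ∂P = 0 ∧
      ∫ ω, corrected K (X ω) (ξ ω) ^ 2 ∂P = ∫ ω, X ω ^ 2 ∂P ∧
      (MemLp X 4 P → ∫ ω, corrected K (X ω) (ξ ω) ^ 4 ∂P ≤ 32 * ∫ ω, X ω ^ 4 ∂P) ∧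
      P {ω | corrected K (X ω) (ξ ω) ≠ X ω} ≤
        ENNReal.ofReal (4 * secondDefect P X K / K ^ 2) := by
  obtain ⟨c1, c2⟩ := correction_conditions hX h2 h0 hK hK2
  have hdn := secondDefect_nonneg hX h2 hK
  have hms := meanDefect_sq_le hX h2 h0 hK
  have ha : ∫ ω, truncAt K (X ω) ∂P = -meanDefect P X K := by simp [meanDefect]
  have hτ : ∫ ω, truncAt K (X ω) ^ 2 ∂P = ∫ ω, X ω ^ 2 ∂P - secondDefect P X K := by
    simp [secondDefect]
  set a := meanDefect P X K with hadef
  set τ := secondDefect P X K with hτdef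
  have hKne := hK.ne'
  have hE : ∀ g : ℝ → ℝ, Measurable g → ∫ ω, g (ξ ω) ∂P =
      ((τ + 2 * a ^ 2) / K ^ 2 + a / K) / 2 * g K +
      ((τ + 2 * a ^ 2) / K ^ 2 - a / K) / 2 * g (-K) +
      (1 - (τ + 2 * a ^ 2) / K ^ 2) * g 0 := by
    intro g hg
    rw [← integral_map hξ.aemeasurable hg.aestronglyMeasurable, hlaw]
    exact integral_threePoint hK c1 c2 g
  have hcl := measurable_clampAt K
  -- Clamping does nothing at the atoms `-K`, `0`, `K`. It serves to make the bound `2K` hold at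
  -- every sample point and not only almost surely.
  have e1 : ∫ ω, clampAt K (ξ ω) ∂P = a := by
    rw [hE _ hcl, clampAt_self hK.le, clampAt_neg hK.le, clampAt_zero hK.le]
    field_simp; ring
  have e2 : ∫ ω, clampAt K (ξ ω) ^ 2 ∂P = τ + 2 * a ^ 2 := by
    rw [hE (fun y => clampAt K y ^ 2) (hcl.pow_const 2), clampAt_self hK.le, clampAt_neg hK.le,
      clampAt_zero hK.le]
    field_simp; ring
  have e4 : ∫ ω, clampAt K (ξ ω) ^ 4 ∂P = K ^ 2 * (τ + 2 * a ^ 2) := by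
    rw [hE (fun y => clampAt K y ^ 4) (hcl.pow_const 4), clampAt_self hK.le, clampAt_neg hK.le,
      clampAt_zero hK.le]
    field_simp; ring
  have hcL : ∀ p, MemLp (fun ω => clampAt K (ξ ω)) p P := fun p =>
    MemLp.of_bound (hcl.comp hξ).aestronglyMeasurable K
      (Eventually.of_forall fun ω => abs_clampAt_le hK.le _)
  have htL : ∀ p, MemLp (fun ω => truncAt K (X ω)) p P := fun p => memLp_truncAt hX hK p
  have hind' : IndepFun (fun ω => truncAt K (X ω)) (fun ω => clampAt K (ξ ω)) P :=
    hind.comp (measurable_truncAt K) hcl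
  have it := (htL 1).integrable le_rfl
  have ic := (hcL 1).integrable le_rfl
  have itc : Integrable (fun ω => truncAt K (X ω) * clampAt K (ξ ω)) P := hind'.integrable_mul it ic
  have etc : ∫ ω, truncAt K (X ω) * clampAt K (ξ ω) ∂P = -a * a := by
    have := hind'.integral_fun_mul_eq_mul_integral (htL 1).1 (hcL 1).1
    rw [this, ha, e1]
  refine ⟨?_, ?_, ?_, ?_⟩
  · simp only [corrected]
    rw [integral_add it ic, ha, e1]; ring
  · have e : ∀ ω, corrected K (X ω) (ξ ω) ^ 2 = truncAt K (X ω) ^ 2 +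
        (2 * (truncAt K (X ω) * clampAt K (ξ ω)) + clampAt K (ξ ω) ^ 2) := fun ω => by
      simp only [corrected]; ring
    simp only [e]
    rw [integral_add (htL 2).integrable_sq ((itc.const_mul 2).fun_add (hcL 2).integrable_sq),
      integral_add (itc.const_mul 2) (hcL 2).integrable_sq, integral_const_mul, hτ, etc, e2]
    ring
  · intro h4
    have p4 : ∀ {f : Ω → ℝ}, MemLp f 4 P → Integrable (fun ω => f ω ^ 4) P := by
      intro f hf
      refine (integrable_norm_iff ?_).1 (by simpa using hf.integrable_norm_pow')
      exact hf.1.pow 4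
    have i1 := (p4 (htL 4)).const_mul 8
    have i2 := (p4 (hcL 4)).const_mul 8
    have hle : ∀ ω, corrected K (X ω) (ξ ω) ^ 4 ≤
        8 * truncAt K (X ω) ^ 4 + 8 * clampAt K (ξ ω) ^ 4 := fun ω => by
      simp only [corrected]
      set u := truncAt K (X ω)
      set v := clampAt K (ξ ω)
      have h1 : (u + v) ^ 2 ≤ 2 * u ^ 2 + 2 * v ^ 2 := by nlinarith [sq_nonneg (u - v)]
      have h2 : ((u + v) ^ 2) ^ 2 ≤ (2 * u ^ 2 + 2 * v ^ 2) ^ 2 :=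
        pow_le_pow_left₀ (sq_nonneg _) h1 2
      nlinarith [sq_nonneg (u ^ 2 - v ^ 2)]
    have b1 : ∫ ω, truncAt K (X ω) ^ 4 ∂P ≤ ∫ ω, X ω ^ 4 ∂P :=
      integral_mono (p4 (htL 4)) (p4 h4) fun ω => by
        simp only
        rw [← Even.pow_abs (by decide : Even 4), ← Even.pow_abs (by decide : Even 4) (X ω)]
        exact pow_le_pow_left₀ (abs_nonneg _) (abs_truncAt_le_abs K _) 4
    have b2 : K ^ 2 * τ ≤ ∫ ω, X ω ^ 4 ∂P :=
      (sq_mul_secondDefect_le hX h4 hK).trans (setIntegral_pow_four_le h4 _)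
    -- The correction has fourth moment `K²(τ + 2a²) ≤ 3K²τ ≤ 3 E X⁴`, which together with the
    -- truncated part gives `8·(1 + 3) = 32`.
    have b3 : K ^ 2 * a ^ 2 ≤ K ^ 2 * τ := mul_le_mul_of_nonneg_left hms (by positivity)
    refine (integral_mono_of_nonneg (Eventually.of_forall fun ω => by positivity)
      (i1.fun_add i2) (Eventually.of_forall hle)).trans ?_
    rw [integral_add i1 i2, integral_const_mul, integral_const_mul, e4]
    linarith
  · have hsub : {ω | corrected K (X ω) (ξ ω) ≠ X ω} ⊆ {ω | K < |X ω|} ∪ ξ ⁻¹' {0}ᶜ := by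
      intro ω hω
      by_contra hc
      simp only [Set.mem_union, Set.mem_ofPred_eq, not_or, not_lt, Set.mem_preimage,
        Set.mem_compl_iff, Set.mem_singleton_iff, not_not] at hc
      exact hω (by simp [corrected, truncAt, hc.1, hc.2, clampAt_zero hK.le])
    refine (measure_mono hsub).trans ((measure_union_le _ _).trans ?_)
    rw [← Measure.map_apply hξ (MeasurableSet.singleton _).compl, hlaw, correctionLaw,
      threePoint_ne_zero hK c1 c2]
    refine (add_le_add_left (sq_mul_measure_lt_le hX h2 hK) _).trans ?_
    rw [← ENNReal.ofReal_add (by positivity) (by positivity), ← add_div]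
    refine ENNReal.ofReal_le_ofReal ?_
    gcongr
    linarith

end Truncation

/-! ### Diagonal sequences, independence on product spaces and the coupling -/

/-- A slow diagonal sequence along which a family of null sequences still tends to zero. -/
theorem exists_tendsto_diagonal {g : ℕ → ℕ → ℝ} (hg : ∀ n, Tendsto (g n) atTop (𝓝 0)) :
    ∃ k : ℕ → ℕ, Tendsto k atTop atTop ∧ Tendsto (fun N => g (k N) N) atTop (𝓝 0) := by
  have h : ∀ n : ℕ, ∃ M : ℕ, ∀ N ≥ M, |g n N| ≤ 1 / ((n : ℝ) + 1) := by
    intro n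
    have hpos : (0 : ℝ) < 1 / ((n : ℝ) + 1) := by positivity
    obtain ⟨M, hM⟩ := (Metric.tendsto_atTop.1 (hg n)) _ hpos
    exact ⟨M, fun N hN => by simpa using (hM N hN).le⟩
  choose M hM using h
  -- The largest index `n ≤ N` whose threshold `M n` has been passed. If none has, the value is the
  -- default `0`, excluded below by taking `N ≥ M 0`.
  let k : ℕ → ℕ := fun N => Nat.findGreatest (fun n => M n ≤ N) N
  have hk : Tendsto k atTop atTop := by
    refine tendsto_atTop.2 fun b => ?_
    filter_upwards [eventually_ge_atTop (max b (M b))] with N hN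
    exact Nat.le_findGreatest ((le_max_left _ _).trans hN) ((le_max_right _ _).trans hN)
  refine ⟨k, hk, ?_⟩
  refine squeeze_zero_norm' ?_ (tendsto_one_div_add_atTop_nhds_zero_nat.comp hk)
  filter_upwards [eventually_ge_atTop (M 0)] with N hN
  exact hM (k N) N (Nat.findGreatest_spec (P := fun n => M n ≤ N) (Nat.zero_le N) hN)

/-- Independence of pairs built from two independent families. -/
theorem iIndepFun_prodMk_of_prod {ι Ω Ω₂ : Type*} [Fintype ι] [MeasurableSpace Ω]
    [MeasurableSpace Ω₂] {P : Measure Ω} {Q : Measure Ω₂} [IsProbabilityMeasure P]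
    [IsProbabilityMeasure Q] {X : ι → Ω → ℝ} {Y : ι → Ω₂ → ℝ} (hX : ∀ i, Measurable (X i))
    (hY : ∀ i, Measurable (Y i)) (hXi : iIndepFun X P) (hYi : iIndepFun Y Q) :
    iIndepFun (fun i (z : Ω × Ω₂) => (X i z.1, Y i z.2)) (P.prod Q) := by
  have hpx : ∀ i, IsProbabilityMeasure (P.map (X i)) := fun i =>
    Measure.isProbabilityMeasure_map (hX i).aemeasurable
  have hpy : ∀ i, IsProbabilityMeasure (Q.map (Y i)) := fun i =>
    Measure.isProbabilityMeasure_map (hY i).aemeasurable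
  have hm : ∀ i, Measurable fun z : Ω × Ω₂ => (X i z.1, Y i z.2) := fun i =>
    ((hX i).comp measurable_fst).prodMk ((hY i).comp measurable_snd)
  rw [iIndepFun_iff_map_fun_eq_pi_map fun i => (hm i).aemeasurable]
  have e1 : ∀ i, (P.prod Q).map (fun z : Ω × Ω₂ => (X i z.1, Y i z.2)) =
      (P.map (X i)).prod (Q.map (Y i)) := fun i =>
    (Measure.map_prod_map P Q (hX i) (hY i)).symm
  simp only [e1]
  have h1 := hXi.map_fun_eq_pi_map fun i => (hX i).aemeasurable
  have h2 := hYi.map_fun_eq_pi_map fun i => (hY i).aemeasurable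
  have hXm : Measurable fun ω i => X i ω := measurable_pi_lambda _ hX
  have hYm : Measurable fun ω i => Y i ω := measurable_pi_lambda _ hY
  have h3 := Measure.map_prod_map P Q hXm hYm
  rw [h1, h2] at h3
  have h4 := (measurePreserving_arrowProdEquivProdArrow ℝ ℝ ι (fun i => P.map (X i))
    (fun i => Q.map (Y i))).symm
  rw [← h4.map_eq, h3, Measure.map_map h4.measurable (hXm.prodMap hYm)]
  rfl

/-- The entries of a sequence of matrices, extended by zero. -/
def natEntry {Ω : Type u} (W : (N : ℕ) → Ω → Matrix (Fin N) (Fin N) ℝ) (N j k : ℕ) (ω : Ω) : ℝ :=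
  if h : j < N ∧ k < N then W N ω ⟨j, h.1⟩ ⟨k, h.2⟩ else 0

theorem natEntry_coe {Ω : Type u} (W : (N : ℕ) → Ω → Matrix (Fin N) (Fin N) ℝ) (N : ℕ) (j k : Fin N) :
    natEntry W N j k = fun ω => W N ω j k := by
  ext ω; simp [natEntry]

theorem natEntry_of_not {Ω : Type u} (W : (N : ℕ) → Ω → Matrix (Fin N) (Fin N) ℝ) {N j k : ℕ}
    (h : ¬(j < N ∧ k < N)) : natEntry W N j k = fun _ => 0 := by
  ext ω; simp only [natEntry, dif_neg h]

section Coupling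

variable {Ω : Type u} [MeasurableSpace Ω] {P : Measure Ω}
  {W : (N : ℕ) → Ω → Matrix (Fin N) (Fin N) ℝ} {σ σ₁ m₄ : ℝ}

theorem IsRealWigner.mean (hW : IsRealWigner P W σ σ₁ m₄) (N : ℕ) (j k : Fin N) :
    ∫ ω, W N ω j k ∂P = 0 := by
  by_cases h : j = k
  · subst h; exact hW.mean_diag N j
  · exact hW.mean_offDiag N j k h

theorem IsRealWigner.integral_sq_offDiag (hW : IsRealWigner P W σ σ₁ m₄) (N : ℕ) (j k : Fin N)
    (h : j ≠ k) : ∫ ω, W N ω j k ^ 2 ∂P = σ ^ 2 := by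
  rw [← hW.variance_offDiag N j k h,
    variance_of_integral_eq_zero (hW.measurable N _ _).aemeasurable (hW.mean_offDiag N _ _ h)]

theorem IsRealWigner.integral_sq_le (hW : IsRealWigner P W σ σ₁ m₄) (N : ℕ) (j k : Fin N) :
    ∫ ω, W N ω j k ^ 2 ∂P ≤ σ ^ 2 + σ₁ ^ 2 := by
  by_cases h : j = k
  · subst h; nlinarith [hW.second_moment_le N j, sq_nonneg σ]
  · rw [hW.integral_sq_offDiag N j k h]; nlinarith [sq_nonneg σ₁]

theorem lindebergRow_nonneg (W : (N : ℕ) → Ω → Matrix (Fin N) (Fin N) ℝ) (i : ℕ) (ε : ℝ) (N : ℕ) :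
    0 ≤ lindebergRow P W i ε N := by
  unfold lindebergRow
  split_ifs
  · exact mul_nonneg (by positivity) (Finset.sum_nonneg fun j _ =>
      integral_nonneg fun ω => by positivity)
  · exact le_rfl

variable [IsProbabilityMeasure P]

theorem IsRealWigner.memLp_two (hW : IsRealWigner P W σ σ₁ m₄) (N : ℕ) (j k : Fin N) :
    MemLp (fun ω => W N ω j k) 2 P := by
  by_cases h : j = k
  · subst h; exact hW.memLp_diag N j
  · exact (hW.memLp_offDiag N j k h).mono_exponent (by norm_num)

theorem IsRealWigner.isProbabilityMeasure_correctionLaw (hW : IsRealWigner P W σ σ₁ m₄)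
    {K : ℝ} (hK : 0 < K) (hK2 : 2 * (σ ^ 2 + σ₁ ^ 2) ≤ K ^ 2) (N j k : ℕ) :
    IsProbabilityMeasure (correctionLaw P (natEntry W N j k) K) := by
  by_cases h : j < N ∧ k < N
  · have e := natEntry_coe W N ⟨j, h.1⟩ ⟨k, h.2⟩
    simp only at e
    rw [e]
    refine _root_.isProbabilityMeasure_correctionLaw (hW.measurable N _ _) (hW.memLp_two N _ _)
      (hW.mean N _ _) hK ?_
    linarith [hW.integral_sq_le N ⟨j, h.1⟩ ⟨k, h.2⟩]
  · rw [natEntry_of_not W h]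
    refine _root_.isProbabilityMeasure_correctionLaw measurable_const (memLp_const 0) (by simp)
      hK ?_
    simp only [ne_eq, OfNat.ofNat_ne_zero, not_false_eq_true, zero_pow, integral_zero, mul_zero]
    positivity

/-- The entries of the first `m` rows and columns of a Wigner matrix can be truncated, and
corrected by independent variables so that mean and variance are unchanged. -/
theorem IsRealWigner.exists_truncation (hW : IsRealWigner P W σ σ₁ m₄) (m : ℕ) {K : ℕ → ℝ}
    (hK : ∀ N, 0 < K N) (hK2 : ∀ N, 2 * (σ ^ 2 + σ₁ ^ 2) ≤ K N ^ 2) :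
    ∃ (Ω' : Type u) (_ : MeasurableSpace Ω') (P' : Measure Ω') (_ : IsProbabilityMeasure P')
      (π : Ω' → Ω) (T : (N : ℕ) → Ω' → Matrix (Fin N) (Fin N) ℝ),
      MeasurePreserving π P' P ∧ IsRealWigner P' T σ σ₁ (32 * |m₄|) ∧
      (∀ (N : ℕ) (ω : Ω') (j k : Fin N), m ≤ (j : ℕ) → m ≤ (k : ℕ) →
        T N ω j k = W N (π ω) j k) ∧
      (∀ (N : ℕ) (ω : Ω') (i k : Fin N), (i : ℕ) < m → |T N ω i k| ≤ 2 * K N) ∧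
      ∀ (N : ℕ) (i k : Fin N), P' {ω | T N ω i k ≠ W N (π ω) i k} ≤
        ENNReal.ofReal (4 * secondDefect P (fun ω => W N ω i k) (K N) / K N ^ 2) := by
  -- One infinite product carries the corrections for all `N` at once. Extending the entries by zero
  -- gives a correction law at every index triple, including those outside the matrix.
  let ν : ℕ × ℕ × ℕ → Measure ℝ := fun n => correctionLaw P (natEntry W n.1 n.2.1 n.2.2) (K n.1)
  have hν : ∀ n, IsProbabilityMeasure (ν n) := fun n =>
    hW.isProbabilityMeasure_correctionLaw (hK _) (hK2 _) _ _ _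
  let Q : Measure (ℕ × ℕ × ℕ → ℝ) := Measure.infinitePi ν
  let P' : Measure (Ω × (ℕ × ℕ × ℕ → ℝ)) := P.prod Q
  let idx : (N : ℕ) → UpperPair N → ℕ × ℕ × ℕ := fun N p => (N, p.1.1, p.1.2)
  -- The first index of the pair is the smaller one, so this condition says that both indices lie
  -- outside the first `m` rows.
  let φ : (N : ℕ) → UpperPair N → ℝ × ℝ → ℝ := fun N p r =>
    if m ≤ (p.1.1 : ℕ) then r.1 else corrected (K N) r.1 r.2
  have hφ : ∀ N p, Measurable (φ N p) := by
    intro N p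
    by_cases h : m ≤ (p.1.1 : ℕ)
    · simpa only [φ, h, if_true] using measurable_fst
    · simpa only [φ, h, if_false] using measurable_corrected (K N)
  let E : (N : ℕ) → UpperPair N → Ω × (ℕ × ℕ × ℕ → ℝ) → ℝ := fun N p z =>
    φ N p (W N z.1 p.1.1 p.1.2, z.2 (idx N p))
  let T : (N : ℕ) → Ω × (ℕ × ℕ × ℕ → ℝ) → Matrix (Fin N) (Fin N) ℝ := fun N z =>
    symMat fun p => E N p z
  have hfst : MeasurePreserving Prod.fst P' P := measurePreserving_fst
  have hXm : ∀ N (p : UpperPair N), Measurable fun z : Ω × (ℕ × ℕ × ℕ → ℝ) =>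
      W N z.1 p.1.1 p.1.2 := fun N p => (hW.measurable N _ _).comp measurable_fst
  have hξm : ∀ N (p : UpperPair N), Measurable fun z : Ω × (ℕ × ℕ × ℕ → ℝ) =>
      z.2 (idx N p) := fun N p => (measurable_pi_apply _).comp measurable_snd
  have hEm : ∀ N p, Measurable (E N p) := fun N p =>
    (hφ N p).comp ((hXm N p).prodMk (hξm N p))
  have hI : ∀ N (p : UpperPair N) (g : ℝ → ℝ), Measurable g →
      ∫ z, g (W N z.1 p.1.1 p.1.2) ∂P' = ∫ ω, g (W N ω p.1.1 p.1.2) ∂P := by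
    intro N p g hg
    have h := integral_map (μ := P') (φ := Prod.fst) measurable_fst.aemeasurable
      (f := fun ω => g (W N ω p.1.1 p.1.2)) (hg.comp (hW.measurable N _ _)).aestronglyMeasurable
    rw [hfst.map_eq] at h
    exact h.symm
  have hL : ∀ N (p : UpperPair N) q, MemLp (fun ω => W N ω p.1.1 p.1.2) q P →
      MemLp (fun z : Ω × (ℕ × ℕ × ℕ → ℝ) => W N z.1 p.1.1 p.1.2) q P' := fun N p q h =>
    h.comp_measurePreserving hfst
  have h0 : ∀ N (p : UpperPair N), ∫ z, W N z.1 p.1.1 p.1.2 ∂P' = 0 := fun N p =>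
    (hI N p (fun r => r) measurable_id).trans (hW.mean N _ _)
  have hindep : ∀ N, iIndepFun (E N) P' := by
    intro N
    have hinj : Function.Injective (idx N) := by
      rintro ⟨⟨a, b⟩, h⟩ ⟨⟨a', b'⟩, h'⟩ he
      simp only [idx, Prod.mk.injEq, true_and] at he
      simp [Fin.ext he.1, Fin.ext he.2]
    have h1 : iIndepFun (fun (n : ℕ × ℕ × ℕ) (z : ℕ × ℕ × ℕ → ℝ) => z n) Q :=
      iIndepFun_infinitePi (X := fun _ => id) (P := ν) fun _ => measurable_id
    have h2 := iIndepFun_prodMk_of_prod (fun p => hW.measurable N _ _)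
      (fun p => measurable_pi_apply (idx N p)) (hW.indep N) (h1.precomp hinj)
    exact h2.comp (φ N) (hφ N)
  have hdef : ∀ N (p : UpperPair N),
      secondDefect P' (fun z => W N z.1 p.1.1 p.1.2) (K N) =
        secondDefect P (fun ω => W N ω p.1.1 p.1.2) (K N) ∧
      meanDefect P' (fun z => W N z.1 p.1.1 p.1.2) (K N) =
        meanDefect P (fun ω => W N ω p.1.1 p.1.2) (K N) := by
    intro N p
    simp only [secondDefect, meanDefect]
    rw [hI N p (fun r => r ^ 2) (by fun_prop),
      hI N p (fun r => truncAt (K N) r ^ 2) ((measurable_truncAt _).pow_const 2),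
      hI N p (fun r => truncAt (K N) r) (measurable_truncAt _)]
    exact ⟨rfl, rfl⟩
  have hmom := fun N (p : UpperPair N) => corrected_moments (P := P') (K := K N)
    (hXm N p) (hξm N p)
    (indepFun_prod (X := fun ω => W N ω p.1.1 p.1.2)
      (Y := fun z : ℕ × ℕ × ℕ → ℝ => z (idx N p)) (hW.measurable N _ _) (measurable_pi_apply _))
    (hL N p 2 (hW.memLp_two N _ _)) (h0 N p) (hK N)
    (by rw [hI N p (fun r => r ^ 2) (by fun_prop)]
        linarith [hW.integral_sq_le N p.1.1 p.1.2, hK2 N])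
    (by
      have e1 : P'.map (fun z => z.2 (idx N p)) = ν (idx N p) := by
        have h1 : MeasurePreserving (fun z : ℕ × ℕ × ℕ → ℝ => z (idx N p)) Q (ν (idx N p)) :=
          measurePreserving_eval_infinitePi ν (idx N p)
        exact (h1.comp (measurePreserving_snd (μ := P) (ν := Q))).map_eq
      rw [e1]
      simp only [ν, idx, natEntry_coe, correctionLaw]
      rw [(hdef N p).1, (hdef N p).2])
  have hEL : ∀ N (p : UpperPair N) q, MemLp (fun ω => W N ω p.1.1 p.1.2) q P →
      MemLp (E N p) q P' := by
    intro N p q hq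
    by_cases h : m ≤ (p.1.1 : ℕ)
    · simpa only [E, φ, h, if_true] using hL N p q hq
    · refine MemLp.of_bound (hEm N p).aestronglyMeasurable (2 * K N)
        (Eventually.of_forall fun z => ?_)
      simp only [E, φ, h, if_false]
      exact abs_corrected_le (hK N) _ _
  have hE0 : ∀ N p, ∫ z, E N p z ∂P' = 0 := by
    intro N p
    by_cases h : m ≤ (p.1.1 : ℕ)
    · simpa only [E, φ, h, if_true] using h0 N p
    · simpa only [E, φ, h, if_false] using (hmom N p).1
  have hE2 : ∀ N (p : UpperPair N), ∫ z, E N p z ^ 2 ∂P' = ∫ ω, W N ω p.1.1 p.1.2 ^ 2 ∂P := by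
    intro N p
    rw [← hI N p (fun r => r ^ 2) (by fun_prop)]
    by_cases h : m ≤ (p.1.1 : ℕ)
    · simp only [E, φ, h, if_true]
    · simpa only [E, φ, h, if_false] using (hmom N p).2.1
  have hE4 : ∀ N (p : UpperPair N), p.1.1 ≠ p.1.2 → ∫ z, E N p z ^ 4 ∂P' ≤ 32 * |m₄| := by
    intro N p hp
    have h1 := (hW.fourth_moment_le N _ _ hp).trans (le_abs_self m₄)
    rw [← hI N p (fun r => r ^ 4) (by fun_prop)] at h1
    by_cases h : m ≤ (p.1.1 : ℕ)
    · simp only [E, φ, h, if_true]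
      linarith [abs_nonneg m₄]
    · simp only [E, φ, h, if_false]
      have := (hmom N p).2.2.1 (hL N p 4 (hW.memLp_offDiag N _ _ hp))
      linarith
  have hEP : ∀ N (p : UpperPair N), P' {z | E N p z ≠ W N z.1 p.1.1 p.1.2} ≤
      ENNReal.ofReal (4 * secondDefect P (fun ω => W N ω p.1.1 p.1.2) (K N) / K N ^ 2) := by
    intro N p
    by_cases h : m ≤ (p.1.1 : ℕ)
    · simp [E, φ, h]
    · rw [← (hdef N p).1]
      simpa only [E, φ, h, if_false] using (hmom N p).2.2.2
  have hTE : ∀ N z (j k : Fin N), T N z j k = E N (upperPair j k) z := fun _ _ _ _ => rfl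
  have hWp : ∀ N ω (j k : Fin N),
      W N ω j k = W N ω (upperPair j k).1.1 (upperPair j k).1.2 := by
    intro N ω j k
    rcases upperPair_cases j k with ⟨e1, e2⟩ | ⟨e1, e2⟩ <;> rw [e1, e2]
    exact ((hW.symm N ω).apply j k).symm
  have hne : ∀ N (j k : Fin N), j ≠ k → (upperPair j k).1.1 ≠ (upperPair j k).1.2 := by
    intro N j k hjk
    rcases upperPair_cases j k with ⟨e1, e2⟩ | ⟨e1, e2⟩ <;> simp [e1, e2, hjk, hjk.symm]
  refine ⟨Ω × (ℕ × ℕ × ℕ → ℝ), inferInstance, P', inferInstance, Prod.fst, T, hfst,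
    ⟨?_, ?_, ?_, ?_, ?_, ?_, ?_, ?_, ?_, ?_⟩, ?_, ?_, ?_⟩
  · exact fun N j k => hEm N _
  · exact fun N z => symMat_isSymm _
  · intro N
    have e : (fun (p : {p : Fin N × Fin N // p.1 ≤ p.2}) (z : Ω × (ℕ × ℕ × ℕ → ℝ)) =>
        T N z p.1.1 p.1.2) = E N := by
      ext p z
      rw [hTE, upperPair_of_le p.2]
    rw [e]; exact hindep N
  · exact fun N j k hjk => hEL N _ 4 (hW.memLp_offDiag N _ _ (hne N j k hjk))
  · exact fun N j k _ => hE0 N _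
  · intro N j k hjk
    refine (variance_of_integral_eq_zero (hEm N (upperPair j k)).aemeasurable
      (hE0 N _)).trans ?_
    exact (hE2 N _).trans (hW.integral_sq_offDiag N _ _ (hne N j k hjk))
  · exact fun N j k hjk => hE4 N _ (hne N j k hjk)
  · exact fun N i => hEL N _ 2 (hW.memLp_two N _ _)
  · exact fun N i => hE0 N _
  · intro N i
    refine (hE2 N (upperPair i i)).trans_le ?_
    simp only [← hWp]
    exact hW.second_moment_le N i
  · intro N z j k hj hk
    have h : m ≤ ((upperPair j k).1.1 : ℕ) := by
      rcases upperPair_cases j k with ⟨e1, -⟩ | ⟨e1, -⟩ <;> rw [e1] <;> assumption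
    rw [hTE, hWp N z.1 j k]
    simp only [E, φ, h, if_true]
  · intro N z i k hi
    have h : ¬ m ≤ ((upperPair i k).1.1 : ℕ) := by
      have : (upperPair i k).1.1 ≤ i := min_le_left i k
      have : ((upperPair i k).1.1 : ℕ) ≤ i := this
      omega
    rw [hTE]
    simp only [E, φ, h, if_false]
    exact abs_corrected_le (hK N) _ _
  · intro N i k
    have h := hEP N (upperPair i k)
    simp only [← hWp] at h
    exact h

theorem IsRealWigner.integrable_pow_four (hW : IsRealWigner P W σ σ₁ m₄) (N : ℕ) {j k : Fin N}
    (h : j ≠ k) : Integrable (fun ω => |W N ω j k| ^ 4) P := by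
  have := (hW.memLp_offDiag N j k h).integrable_norm_pow'
  simpa using this

theorem IsRealWigner.lindebergRow_anti (hW : IsRealWigner P W σ σ₁ m₄) (i N : ℕ) {ε ε' : ℝ}
    (h : ε ≤ ε') : lindebergRow P W i ε' N ≤ lindebergRow P W i ε N := by
  unfold lindebergRow
  split_ifs with hi
  · refine mul_le_mul_of_nonneg_left (Finset.sum_le_sum fun j hj => ?_) (by positivity)
    refine setIntegral_mono_set (hW.integrable_pow_four N (Finset.ne_of_mem_erase hj).symm).integrableOn
      (Eventually.of_forall fun ω => by positivity) (Eventually.of_forall fun ω hω => ?_)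
    exact (mul_le_mul_of_nonneg_right h (by positivity)).trans hω
  · exact le_rfl

/-- The sum over a row of the probabilities that a truncated entry is changed. -/
theorem IsRealWigner.sum_secondDefect_le (hW : IsRealWigner P W σ σ₁ m₄) {N : ℕ} (i : Fin N)
    {K e : ℝ} (he : 0 < e) (hK : e * (N : ℝ) ^ (1 / 4 : ℝ) ≤ K) :
    ∑ k, 4 * secondDefect P (fun ω => W N ω i k) K / K ^ 2 ≤
      4 * σ₁ ^ 2 / K ^ 2 + 4 * (e⁻¹ ^ 4 * lindebergRow P W i e N) := by
  have hN : (0 : ℝ) < N := by exact_mod_cast i.pos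
  have hr : 0 < (N : ℝ) ^ (1 / 4 : ℝ) := Real.rpow_pos_of_pos hN _
  have hr4 : ((N : ℝ) ^ (1 / 4 : ℝ)) ^ 4 = N := by
    rw [← Real.rpow_natCast, ← Real.rpow_mul hN.le]; norm_num
  have hK0 : 0 < K := (mul_pos he hr).trans_le hK
  rw [← Finset.add_sum_erase _ _ (Finset.mem_univ i)]
  refine add_le_add ?_ ?_
  · gcongr
    exact (secondDefect_le P _ K).trans (hW.second_moment_le N i)
  · unfold lindebergRow
    rw [dif_pos i.2, Finset.mul_sum, Finset.mul_sum, Finset.mul_sum]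
    refine Finset.sum_le_sum fun k hk => ?_
    have hik : i ≠ k := (Finset.ne_of_mem_erase hk).symm
    have h1 := sq_mul_secondDefect_le (hW.measurable N i k) (hW.memLp_offDiag N i k hik) hK0
    have h2 : ∫ ω in {ω | K ≤ |W N ω i k|}, |W N ω i k| ^ 4 ∂P ≤
        ∫ ω in {ω | e * (N : ℝ) ^ (1 / 4 : ℝ) ≤ |W N ω i k|}, |W N ω i k| ^ 4 ∂P :=
      setIntegral_mono_set (hW.integrable_pow_four N hik).integrableOn
        (Eventually.of_forall fun ω => by positivity)
        (Eventually.of_forall fun ω hω => hK.trans hω)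
    change _ ≤ 4 * (e⁻¹ ^ 4 * (1 / (N : ℝ) *
      ∫ ω in {ω | e * (N : ℝ) ^ (1 / 4 : ℝ) ≤ |W N ω i k|}, |W N ω i k| ^ 4 ∂P))
    set I := ∫ ω in {ω | e * (N : ℝ) ^ (1 / 4 : ℝ) ≤ |W N ω i k|}, |W N ω i k| ^ 4 ∂P
    set τ := secondDefect P (fun ω => W N ω i k) K
    -- The fourth moment bound on the defect and the division by `K²` combine to `I/K⁴`, and `K⁴ ≥
    -- e⁴ N` reproduces the normalization `1/N` of the Lindeberg sum. The diagonal entry was bounded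
    -- by its second moment alone.
    have hτ : τ ≤ I / K ^ 2 := by
      rw [le_div_iff₀ (by positivity)]; linarith
    have hI : 0 ≤ I := integral_nonneg fun ω => by positivity
    have hK4 : e ^ 4 * N ≤ K ^ 4 := by
      calc e ^ 4 * N = (e * (N : ℝ) ^ (1 / 4 : ℝ)) ^ 4 := by rw [mul_pow, hr4]
        _ ≤ K ^ 4 := pow_le_pow_left₀ (by positivity) hK 4
    calc 4 * τ / K ^ 2 ≤ 4 * (I / K ^ 2) / K ^ 2 := by gcongr
      _ = 4 * I / K ^ 4 := by field_simp
      _ ≤ 4 * I / (e ^ 4 * N) := by gcongr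
      _ = _ := by field_simp

/-- Truncation levels that tend to zero so slowly that the Lindeberg condition persists. -/
theorem IsRealWigner.exists_levels (hW : IsRealWigner P W σ σ₁ m₄) (m : ℕ)
    (hL : ∀ i : ℕ, i < m → ∀ ε : ℝ, 0 < ε → Tendsto (lindebergRow P W i ε) atTop (𝓝 0)) :
    ∃ e : ℕ → ℝ, (∀ N, 0 < e N) ∧ Tendsto e atTop (𝓝 0) ∧
      Tendsto (fun N : ℕ => e N * (N : ℝ) ^ (1 / 4 : ℝ)) atTop atTop ∧
      Tendsto (fun N => ∑ i ∈ Finset.range m, (e N)⁻¹ ^ 4 * lindebergRow P W i (e N) N)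
        atTop (𝓝 0) := by
  -- The level `1/(n+1)` is paired with the factor `(n+1)⁴`, so that the diagonal sequence also
  -- absorbs the inverse fourth power of the level.
  let g : ℕ → ℕ → ℝ := fun n N => ∑ i ∈ Finset.range m,
    ((n : ℝ) + 1) ^ 4 * lindebergRow P W i (1 / ((n : ℝ) + 1)) N
  have hg : ∀ n, Tendsto (g n) atTop (𝓝 0) := by
    intro n
    have h1 : ∀ i ∈ Finset.range m, Tendsto (fun N => ((n : ℝ) + 1) ^ 4 *
        lindebergRow P W i (1 / ((n : ℝ) + 1)) N) atTop (𝓝 0) := fun i hi => by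
      simpa using (hL i (Finset.mem_range.1 hi) _ (by positivity)).const_mul (((n : ℝ) + 1) ^ 4)
    have h2 := tendsto_finsetSum (Finset.range m) h1
    rw [Finset.sum_const_zero] at h2
    exact h2
  obtain ⟨k, hk, hgk⟩ := exists_tendsto_diagonal hg
  have hr : Tendsto (fun N : ℕ => (N : ℝ) ^ (-(1 / 8) : ℝ)) atTop (𝓝 0) :=
    (tendsto_rpow_neg_atTop (by norm_num)).comp tendsto_natCast_atTop_atTop
  -- The first term keeps the Lindeberg sums small; the second keeps the level times `N^{1/4}` at
  -- least `N^{1/8}`, hence divergent, as the diagonal entries require.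
  refine ⟨fun N => max (1 / ((k N : ℝ) + 1)) ((N : ℝ) ^ (-(1 / 8) : ℝ)), fun N =>
    lt_max_of_lt_left (by positivity), ?_, ?_, ?_⟩
  · simpa using (tendsto_one_div_add_atTop_nhds_zero_nat.comp hk).max hr
  · have h2 : Tendsto (fun N : ℕ => (N : ℝ) ^ (1 / 8 : ℝ)) atTop atTop :=
      (tendsto_rpow_atTop (by norm_num)).comp tendsto_natCast_atTop_atTop
    refine tendsto_atTop_mono' _ ?_ h2
    filter_upwards [eventually_gt_atTop 0] with N hN
    have hN' : (0 : ℝ) < N := by exact_mod_cast hN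
    calc (N : ℝ) ^ (1 / 8 : ℝ) = (N : ℝ) ^ (-(1 / 8) : ℝ) * (N : ℝ) ^ (1 / 4 : ℝ) := by
          rw [← Real.rpow_add hN']; norm_num
      _ ≤ _ := by gcongr; exact le_max_right _ _
  · refine squeeze_zero (fun N => Finset.sum_nonneg fun i _ =>
      mul_nonneg (by positivity) (lindebergRow_nonneg W i _ N)) (fun N => ?_) hgk
    refine Finset.sum_le_sum fun i _ => ?_
    set a : ℝ := max (1 / ((k N : ℝ) + 1)) ((N : ℝ) ^ (-(1 / 8) : ℝ))
    have ha : 1 / ((k N : ℝ) + 1) ≤ a := le_max_left _ _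
    have hinv : a⁻¹ ≤ (k N : ℝ) + 1 := by
      rw [inv_le_comm₀ (lt_of_lt_of_le (by positivity) ha) (by positivity), ← one_div]
      exact ha
    have ha0 : 0 < a := lt_of_lt_of_le (by positivity) ha
    exact mul_le_mul (pow_le_pow_left₀ (by positivity) hinv 4) (hW.lindebergRow_anti i N ha)
      (lindebergRow_nonneg W i _ N) (by positivity)

end Coupling

/-! ### The theorem -/

theorem proposition4p2 (σ σ₁ m₄ : ℝ) :
    ∃ C : ℝ → ℝ,
      ∀ (Ω : Type u) [MeasurableSpace Ω] (P : Measure Ω) [IsProbabilityMeasure P]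
        (W : (N : ℕ) → Ω → Matrix (Fin N) (Fin N) ℝ) (m : ℕ),
        IsRealWigner P W σ σ₁ m₄ → 1 ≤ m →
        (∀ i : ℕ, i < m → ∀ ε : ℝ, 0 < ε → Tendsto (lindebergRow P W i ε) atTop (𝓝 0)) →
        ∃ (Ω' : Type u) (_ : MeasurableSpace Ω') (P' : Measure Ω') (_ : IsProbabilityMeasure P')
          (π : Ω' → Ω) (T : (N : ℕ) → Ω' → Matrix (Fin N) (Fin N) ℝ) (ε : ℕ → ℝ),
          MeasurePreserving π P' P ∧
          (∃ σ₁' m₄' : ℝ, IsRealWigner P' T σ σ₁' m₄') ∧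
          (∀ N, 0 < ε N) ∧ Tendsto ε atTop (𝓝 0) ∧
          -- the entries outside the first `m` rows and columns are unchanged
          (∀ (N : ℕ) (ω : Ω') (j k : Fin N), m ≤ (j : ℕ) → m ≤ (k : ℕ) →
            T N ω j k = W N (π ω) j k) ∧
          -- the first `m` rows are unchanged with probability tending to one
          Tendsto (fun N : ℕ => P' {ω | ∀ i k : Fin N, (i : ℕ) < m →
            T N ω i k = W N (π ω) i k}) atTop (𝓝 1) ∧
          (∀ (N : ℕ) (i k : Fin N), (i : ℕ) < m → ∫ ω, T N ω i k ∂P' = 0) ∧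
          (∀ (N : ℕ) (i k : Fin N), (i : ℕ) < m → i ≠ k →
            variance (fun ω => T N ω i k) P' = σ ^ 2) ∧
          (∃ B : ℝ, ∀ (N : ℕ) (i : Fin N), (i : ℕ) < m →
            variance (fun ω => T N ω i i) P' ≤ B) ∧
          (∃ B : ℝ, ∀ (N : ℕ) (i k : Fin N), (i : ℕ) < m → i ≠ k →
            ∫ ω, (T N ω i k) ^ 4 ∂P' ≤ B) ∧
          (∀ (N : ℕ) (ω : Ω') (i k : Fin N), (i : ℕ) < m →
            |T N ω i k| ≤ ε N * (N : ℝ) ^ (1 / 4 : ℝ)) ∧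
          -- the variance bound
          (∀ s : ℝ, 3 < s → ∀ f : ℝ → ℝ, Continuous f → MemSobolevH s f →
            ∀ (N : ℕ) (i j : Fin N), (i : ℕ) < m →
              MemLp (fun ω => matrixFunEntry f (T N ω) i j) 2 P' ∧
              variance (fun ω => matrixFunEntry f (T N ω) i j) P'
                ≤ C s * sobolevNormSq s f / N) := by
  -- The coupled matrices have fourth moments up to `32 |m₄|`, with the same `σ` and `σ₁`.
  refine ⟨fun s => varianceConst σ σ₁ (32 * |m₄|) s, ?_⟩
  intro Ω _ P _ W m hW _ hL
  obtain ⟨e, he0, he, heN, hsum⟩ := hW.exists_levels m hL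
  -- A floor for the truncation levels: it makes the three-point correction exist for every `N`,
  -- including small ones, and is negligible against `N^{1/4}`.
  set c : ℝ := √(2 * (σ ^ 2 + σ₁ ^ 2)) + 1 with hc
  have hc0 : 0 < c := by positivity
  have hc2 : 2 * (σ ^ 2 + σ₁ ^ 2) ≤ c ^ 2 := by
    have h1 := Real.sq_sqrt (show (0 : ℝ) ≤ 2 * (σ ^ 2 + σ₁ ^ 2) by positivity)
    have h2 := Real.sqrt_nonneg (2 * (σ ^ 2 + σ₁ ^ 2))
    nlinarith
  let K : ℕ → ℝ := fun N => max c (e N * (N : ℝ) ^ (1 / 4 : ℝ))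
  have hK : ∀ N, 0 < K N := fun N => lt_max_of_lt_left hc0
  have hKc : ∀ N, c ≤ K N := fun N => le_max_left _ _
  have hKe : ∀ N, e N * (N : ℝ) ^ (1 / 4 : ℝ) ≤ K N := fun N => le_max_right _ _
  have hKt : Tendsto K atTop atTop := tendsto_atTop_mono hKe heN
  obtain ⟨Ω', mΩ', P', hP', π, T, hπ, hT, hout, hbd, hchange⟩ :=
    hW.exists_truncation m hK fun N => hc2.trans (pow_le_pow_left₀ hc0.le (hKc N) 2)
  have hr : ∀ N : ℕ, N ≠ 0 → 0 < (N : ℝ) ^ (1 / 4 : ℝ) := fun N hN =>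
    Real.rpow_pos_of_pos (by exact_mod_cast Nat.pos_of_ne_zero hN) _
  refine ⟨Ω', mΩ', P', hP', π, T,
    -- Chosen so that `ε_N N^{1/4} = 2 K_N`, the sure bound on a corrected entry; the value at `N =
    -- 0` only has to be positive.
    fun N => if N = 0 then 1 else 2 * K N / (N : ℝ) ^ (1 / 4 : ℝ), hπ, ⟨_, _, hT⟩, ?_, ?_, hout,
    ?_, fun N i k _ => hT.mean N i k, fun N i k _ h => hT.variance_offDiag N i k h,
    ⟨σ₁ ^ 2, fun N i _ => ?_⟩, ⟨_, fun N i k _ h => hT.fourth_moment_le N i k h⟩, ?_,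
    fun s hs f hf hfs N i j _ => hT.variance_matrixFunEntry_le hs hf hfs N i j⟩
  · intro N
    dsimp only
    split_ifs with hN
    · exact one_pos
    · exact div_pos (mul_pos two_pos (hK N)) (hr N hN)
  -- For `N ≥ 1` one has `ε_N = 2 max(c N^{-1/4}, e_N)`, and both terms tend to zero.
  · have h1 : Tendsto (fun N : ℕ => c * (N : ℝ) ^ (-(1 / 4) : ℝ)) atTop (𝓝 (c * 0)) :=
      ((tendsto_rpow_neg_atTop (by norm_num)).comp tendsto_natCast_atTop_atTop).const_mul c
    have h2 := (h1.max he).const_mul 2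
    simp only [mul_zero, max_self] at h2
    refine h2.congr' ?_
    filter_upwards [eventually_ne_atTop 0] with N hN
    have hrN := hr N hN
    rw [if_neg hN, mul_div_assoc, ← max_div_div_right hrN.le, mul_div_cancel_right₀ _ hrN.ne',
      Real.rpow_neg (Nat.cast_nonneg N), ← div_eq_mul_inv]
  · let B : ℕ → ℝ := fun N => ∑ i ∈ Finset.range m,
      (4 * σ₁ ^ 2 / K N ^ 2 + 4 * ((e N)⁻¹ ^ 4 * lindebergRow P W i (e N) N))
    have hB0 : Tendsto B atTop (𝓝 0) := by
      have h1 : Tendsto (fun N => (m : ℝ) * (4 * σ₁ ^ 2 / K N ^ 2)) atTop (𝓝 ((m : ℝ) * 0)) :=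
        (((tendsto_pow_atTop two_ne_zero).comp hKt).const_div_atTop _).const_mul _
      have h2 := h1.add (hsum.const_mul 4)
      simp only [mul_zero, add_zero] at h2
      refine h2.congr fun N => ?_
      simp only [B, Finset.sum_add_distrib, Finset.sum_const, Finset.card_range, nsmul_eq_mul,
        Finset.mul_sum]
    have hB' : Tendsto (fun N => 1 - ENNReal.ofReal (B N)) atTop (𝓝 1) := by
      have := ENNReal.Tendsto.sub (tendsto_const_nhds (x := (1 : ENNReal)) (f := atTop))
        (ENNReal.tendsto_ofReal hB0) (Or.inl ENNReal.one_ne_top)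
      simpa using this
    refine tendsto_of_tendsto_of_tendsto_of_le_of_le hB' tendsto_const_nhds (fun N => ?_)
      fun N => prob_le_one
    set S := {ω | ∀ i k : Fin N, (i : ℕ) < m → T N ω i k = W N (π ω) i k}
    have hnn : ∀ i ∈ Finset.range m, 0 ≤
        4 * σ₁ ^ 2 / K N ^ 2 + 4 * ((e N)⁻¹ ^ 4 * lindebergRow P W i (e N) N) := fun i _ => by
      have := lindebergRow_nonneg (P := P) W i (e N) N
      have := he0 N
      positivity
    -- A union bound over the entries of the first rows. If `N < m` there are fewer than `m` rows,
    -- and the sum over all `i < m` is still an upper bound.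
    have hcompl : P' Sᶜ ≤ ENNReal.ofReal (B N) := by
      have hsub : Sᶜ ⊆ ⋃ i ∈ (Finset.univ.filter fun i : Fin N => (i : ℕ) < m), ⋃ k ∈
          (Finset.univ : Finset (Fin N)), {ω | T N ω i k ≠ W N (π ω) i k} := by
        intro ω hω
        simp only [S, Set.mem_compl_iff, Set.mem_ofPred_eq, not_forall] at hω
        obtain ⟨i, k, hi, hik⟩ := hω
        simp only [Set.mem_iUnion, Finset.mem_filter, Finset.mem_univ, true_and, exists_prop]
        exact ⟨i, hi, k, hik⟩
      have hdef : ∀ i k : Fin N,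
          0 ≤ 4 * secondDefect P (fun ω => W N ω i k) (K N) / K N ^ 2 := fun i k => by
        have := secondDefect_nonneg (hW.measurable N i k) (hW.memLp_two N i k) (hK N)
        positivity
      calc P' Sᶜ ≤ ∑ i ∈ (Finset.univ.filter fun i : Fin N => (i : ℕ) < m), ∑ k,
            P' {ω | T N ω i k ≠ W N (π ω) i k} :=
            (measure_mono hsub).trans ((measure_biUnion_finset_le _ _).trans
              (Finset.sum_le_sum fun i _ => measure_biUnion_finset_le _ _))
        _ ≤ ∑ i ∈ (Finset.univ.filter fun i : Fin N => (i : ℕ) < m), ∑ k,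
            ENNReal.ofReal (4 * secondDefect P (fun ω => W N ω i k) (K N) / K N ^ 2) :=
            Finset.sum_le_sum fun i _ => Finset.sum_le_sum fun k _ => hchange N i k
        _ = ∑ i ∈ (Finset.univ.filter fun i : Fin N => (i : ℕ) < m),
            ENNReal.ofReal (∑ k, 4 * secondDefect P (fun ω => W N ω i k) (K N) / K N ^ 2) :=
            Finset.sum_congr rfl fun i _ =>
              (ENNReal.ofReal_sum_of_nonneg fun k _ => hdef i k).symm
        _ ≤ ∑ i ∈ (Finset.univ.filter fun i : Fin N => (i : ℕ) < m), ENNReal.ofReal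
            (4 * σ₁ ^ 2 / K N ^ 2 + 4 * ((e N)⁻¹ ^ 4 * lindebergRow P W i (e N) N)) :=
            Finset.sum_le_sum fun i _ =>
              ENNReal.ofReal_le_ofReal (hW.sum_secondDefect_le i (he0 N) (hKe N))
        _ ≤ ∑ i ∈ Finset.range m, ENNReal.ofReal
            (4 * σ₁ ^ 2 / K N ^ 2 + 4 * ((e N)⁻¹ ^ 4 * lindebergRow P W i (e N) N)) := by
            rw [← Finset.sum_image (s := Finset.univ.filter fun i : Fin N => (i : ℕ) < m)
              (g := fun i : Fin N => (i : ℕ)) (f := fun i : ℕ => ENNReal.ofReal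
              (4 * σ₁ ^ 2 / K N ^ 2 + 4 * ((e N)⁻¹ ^ 4 * lindebergRow P W i (e N) N)))
              (fun i _ j _ h => Fin.ext h)]
            refine Finset.sum_le_sum_of_subset fun n hn => ?_
            obtain ⟨i, hi, rfl⟩ := Finset.mem_image.1 hn
            exact Finset.mem_range.2 (Finset.mem_filter.1 hi).2
        _ = ENNReal.ofReal (B N) := (ENNReal.ofReal_sum_of_nonneg hnn).symm
    rw [tsub_le_iff_right]
    calc (1 : ENNReal) = P' (S ∪ Sᶜ) := by rw [Set.union_compl_self, measure_univ]
      _ ≤ P' S + P' Sᶜ := measure_union_le _ _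
      _ ≤ _ := by gcongr
  · rw [variance_of_integral_eq_zero (hT.measurable N i i).aemeasurable (hT.mean N i i)]
    exact hT.second_moment_le N i
  · intro N ω i k hi
    have hN : N ≠ 0 := i.pos.ne'
    dsimp only
    rw [if_neg hN, div_mul_cancel₀ _ (hr N hN).ne']
    exact hbd N ω i k hi
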